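/- All manifolds are smooth, finite-dimensional, Hausdorff, second countable and without boundary. A Courant algebroid is a vector bundle $\mathbb{A}\to M$ with a nondegenerate symmetric bilinear form $\langle\cdot,\cdot\rangle$ on the fibres, a bundle map $\mathsf a\colon \mathbb{A}\to TM$ over the identity (the anchor), and an $\mathbb{R}$-bilinear bracket $[\![\cdot,\cdot]\!]$ on $\Gamma(\mathbb{A})$ such that $\mathsf a(\sigma)\langle\tau_1,\tau_2\rangle=\langle[\![\sigma,\tau_1]\!],\tau_2\rangle+\langle\tau_1,[\![\sigma,\tau_2]\!]\rangle$, $[\![\sigma,[\![\tau_1,\tau_2]\!]]\!]=[\![[\![\sigma,\tau_1]\!],\tau_2]\!]+[\![\tau_1,[\![\sigma,\tau_2]\!]]\!]$ and $[\![\tau_1,\tau_2]\!]+[\![\tau_2,\tau_1]\!]=\mathsf a^*\mathrm d\langle\tau_1,\tau_2\rangle$ (with $\mathbb{A}^*\cong\mathbb{A}$ by the metric). A Dirac structure is a subbundle $E\subset\mathbb{A}$ with $E=E^\perp$ whose space of sections is closed under the bracket. Let $\mathbb{A}\to M$ be a Courant algebroid, and let $S\subset M$ be a (possibly only immersed) submanifold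 with $\mathsf a(\mathbb{A}|_S)\subset TS$. Let $p\colon\nu(M,S)=TM|_S/TS\to S$ be the normal bundle, and let $\nu(\mathbb{A},\mathbb{A}|_S)=p^*(\mathbb{A}|_S)\to\nu(M,S)$. For a vector field $Y$ on $M$ tangent to $S$ let $\nu(Y)$ be its linear approximation, the vector field on $\nu(M,S)$ with $\mathcal L_{\nu(Y)}\,p^*(f|_S)=p^*((\mathcal L_Yf)|_S)$ for all $f\in C^\infty(M)$ and $\mathcal L_{\nu(Y)}f^\nu=(\mathcal L_Yf)^\nu$ for all $f$ vanishing along $S$ (locally on $S$, in the immersed case), where $f^\nu([u])=\mathrm df(u)$. 1. There is a unique Courant algebroid structure on $\mathbb{A}|_S\to S$ with the restricted metric and anchor such that the restriction $\Gamma(\mathbb{A})\to\Gamma(\mathbb{A}|_S)$ is bracket preserving. 2. There is a unique Courant algebroid structure on $\nu(\mathbb{A},\mathbb{A}|_S)\to\nu(M,S)$ whose metric is the pull-back of the metric of $\mathbb{A}|_S$, whose anchor is $\nu(\mathsf a)\colon\nu(\mathbb{A},\mathbb{A}|_S)\to\nu(TM,TS)\cong T\nu(M,S)$, i.e. the bundle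 map that takes $p^*(\sigma|_S)$ to $\nu(\mathsf a(\sigma))$ for all $\sigma\in\Gamma(\mathbb{A})$, and for which the pull-back $p^*\colon\Gamma(\mathbb{A}|_S)\to\Gamma(\nu(\mathbb{A},\mathbb{A}|_S))$ is bracket preserving. 3. If $E\subset\mathbb{A}$ is a Dirac structure, then $\nu(E,E|_S)=p^*(E|_S)$ is a Dirac structure in $\nu(\mathbb{A},\mathbb{A}|_S)$. 4. Suppose that $S=\{m\}$ is a point, so that $\mathsf a$ vanishes at $m$. Then $\mathfrak d=\mathbb{A}_m$ with the bracket $[\sigma|_m,\tau|_m]=[\![\sigma,\tau]\!]|_m$ and the metric at $m$ is a metrized Lie algebra (a Lie algebra with an $\mathrm{ad}$-invariant nondegenerate symmetric bilinear form); $\varrho(\sigma|_m)\,Z|_m=[\mathsf a(\sigma),Z]|_m$ (for $\sigma\in\Gamma(\mathbb{A})$ and vector fields $Z$ on $M$) is a well-defined representation of $\mathfrak d$ on $T_mM$; the stabilizers $\mathfrak d_u=\{\zeta:\varrho(\zeta)u=0\}$ of all $u\in T_mM$ are coisotropic, $\mathfrak d_u^\perp\subset\mathfrak d_u$; and, under the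 canonical diffeomorphism $T_mM\cong\nu(M,\{m\})$, the Courant algebroid $\nu(\mathbb{A},\mathbb{A}_m)$ is the action Courant algebroid $T_mM\times\mathfrak d$: its metric is that of $\mathfrak d$, its anchor takes $(u,\zeta)$ to $-\varrho(\zeta)u\in T_u(T_mM)$ (the value at $u$ of the vector field generating the linear action), and its bracket extends the Lie bracket of $\mathfrak d$, whose elements are regarded as constant sections. -/

import Mathlib

open Bundle Manifold ContDiff Set Function Topology

noncomputable section

set_option linter.unusedSectionVars false

/-! ## Courant algebroids -/

instance Bundle.Pullback.instAddCommGroup {B B' : Type*} (f : B' → B) (V : B → Type*)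
    [∀ x, AddCommGroup (V x)] (x : B') : AddCommGroup ((f *ᵖ V) x) :=
  inferInstanceAs (AddCommGroup (V (f x)))

section Courant

variable {E : Type*} [NormedAddCommGroup E] [NormedSpace ℝ E] {H : Type*} [TopologicalSpace H]
  {M : Type*} [TopologicalSpace M] [ChartedSpace H M] (I : ModelWithCorners ℝ E H)

/-- The differential `d_m f : T_m M → ℝ` of a real function, so that `dR I f m (X m)` is the
derivative `(L_X f)(m)`. -/
def dR (f : M → ℝ) (m : M) : TangentSpace I m →ₗ[ℝ] ℝ :=
  (mfderiv I 𝓘(ℝ, ℝ) f m).toLinearMap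

/-- A Courant algebroid structure on the vector bundle `A → M` (with model fibre `F`).
`Cₛ^∞⟮I; F, A⟯` is the space `Γ(A)` of smooth sections. -/
@[ext]
structure CourantAlgebroid [IsManifold I ∞ M]
    (F : Type*) [NormedAddCommGroup F] [NormedSpace ℝ F]
    (A : M → Type*) [∀ m, AddCommGroup (A m)] [∀ m, Module ℝ (A m)]
    [TopologicalSpace (TotalSpace F A)] [∀ m, TopologicalSpace (A m)] [FiberBundle F A]
    [VectorBundle ℝ F A] where
  /-- The fibre metrics (nondegenerate, of any signature). -/
  metric : ∀ m, LinearMap.BilinForm ℝ (A m)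
  /-- The anchor, a bundle map over the identity. -/
  anchor : ∀ m, A m →ₗ[ℝ] TangentSpace I m
  /-- The Courant bracket. -/
  bracket : Cₛ^∞⟮I; F, A⟯ →ₗ[ℝ] Cₛ^∞⟮I; F, A⟯ →ₗ[ℝ] Cₛ^∞⟮I; F, A⟯
  metric_symm : ∀ m v w, metric m v w = metric m w v
  metric_nondegenerate : ∀ m v, (∀ w, metric m v w = 0) → v = 0
  contMDiff_metric : ∀ σ τ : Cₛ^∞⟮I; F, A⟯,
    ContMDiff I 𝓘(ℝ, ℝ) ∞ (fun m => metric m (σ m) (τ m))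
  contMDiff_anchor : ContMDiff (I.prod 𝓘(ℝ, F)) I.tangent ∞
    (fun v : TotalSpace F A => (⟨v.proj, anchor v.proj v.snd⟩ : TangentBundle I M))
  /-- `a(σ)⟨τ₁, τ₂⟩ = ⟨⟦σ, τ₁⟧, τ₂⟩ + ⟨τ₁, ⟦σ, τ₂⟧⟩`. -/
  anchor_metric : ∀ (σ τ₁ τ₂ : Cₛ^∞⟮I; F, A⟯) (m : M),
    dR I (fun x => metric x (τ₁ x) (τ₂ x)) m (anchor m (σ m)) =
      metric m (bracket σ τ₁ m) (τ₂ m) + metric m (τ₁ m) (bracket σ τ₂ m)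
  /-- `⟦σ, ⟦τ₁, τ₂⟧⟧ = ⟦⟦σ, τ₁⟧, τ₂⟧ + ⟦τ₁, ⟦σ, τ₂⟧⟧`. -/
  jacobi : ∀ σ τ₁ τ₂ : Cₛ^∞⟮I; F, A⟯,
    bracket σ (bracket τ₁ τ₂) = bracket (bracket σ τ₁) τ₂ + bracket τ₁ (bracket σ τ₂)
  /-- `⟦τ₁, τ₂⟧ + ⟦τ₂, τ₁⟧ = a^* d⟨τ₁, τ₂⟩`, where `a^* α` is the element of `A` with
  `⟨a^* α, v⟩ = α (a v)` for all `v`. -/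
  bracket_symm : ∀ (τ₁ τ₂ : Cₛ^∞⟮I; F, A⟯) (m : M) (v : A m),
    metric m (bracket τ₁ τ₂ m + bracket τ₂ τ₁ m) v =
      dR I (fun x => metric x (τ₁ x) (τ₂ x)) m (anchor m v)

variable [IsManifold I ∞ M]
  {F : Type*} [NormedAddCommGroup F] [NormedSpace ℝ F]
  {A : M → Type*} [∀ m, AddCommGroup (A m)] [∀ m, Module ℝ (A m)]
  [TopologicalSpace (TotalSpace F A)] [∀ m, TopologicalSpace (A m)] [FiberBundle F A]
  [VectorBundle ℝ F A]

variable (F A) in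
/-- A smooth vector subbundle `D ⊂ A`: near every point it has a smooth frame. -/
def IsSmoothSubbundle (D : ∀ m, Submodule ℝ (A m)) : Prop :=
  ∀ m₀ : M, ∃ (k : ℕ) (e : Fin k → Cₛ^∞⟮I; F, A⟯), ∀ᶠ m in 𝓝 m₀,
    LinearIndependent ℝ (fun i => e i m) ∧ Submodule.span ℝ (range (fun i => e i m)) = D m

variable {I} in
/-- A Dirac structure: a subbundle `D ⊂ A` with `D = D^⊥` whose sections are closed under the
Courant bracket. -/
structure CourantAlgebroid.IsDirac (C : CourantAlgebroid I F A)
    (D : ∀ m, Submodule ℝ (A m)) : Prop where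
  isSmoothSubbundle : IsSmoothSubbundle I F A D
  lagrangian : ∀ m, (C.metric m).orthogonal (D m) = D m
  involutive : ∀ σ τ : Cₛ^∞⟮I; F, A⟯, (∀ m, σ m ∈ D m) → (∀ m, τ m ∈ D m) →
    ∀ m, C.bracket σ τ m ∈ D m

variable {I} {E' : Type*} [NormedAddCommGroup E'] [NormedSpace ℝ E'] {H' : Type*}
  [TopologicalSpace H'] {M' : Type*} [TopologicalSpace M'] [ChartedSpace H' M']
  {I' : ModelWithCorners ℝ E' H'}

/-- The pull-back `f^* σ = σ ∘ f ∈ Γ(f^* A)` of a section `σ ∈ Γ(A)`. -/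
def pullbackSection (f : C^∞⟮I', M'; I, M⟯) (σ : Cₛ^∞⟮I; F, A⟯) :
    Cₛ^∞⟮I'; F, f *ᵖ A⟯ where
  toFun x := σ (f x)
  contMDiff_toFun := by
    intro x₀
    have h := (contMDiffAt_section (f x₀)).1 (σ.contMDiff (f x₀))
    exact (contMDiffAt_section (E := f *ᵖ A) (s := fun x => σ (f x)) x₀).2
      (h.comp x₀ (f.contMDiff x₀))

end Courant

/-! ## The normal bundle of an immersed submanifold -/

namespace NormalBundle
variable {E : Type*} [NormedAddCommGroup E] [NormedSpace ℝ E]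
  {M : Type*} [TopologicalSpace M] [ChartedSpace E M] [IsManifold 𝓘(ℝ, E) ∞ M]
  {ES : Type*} [NormedAddCommGroup ES] [NormedSpace ℝ ES]
  {S : Type*} [TopologicalSpace S] [ChartedSpace ES S] [IsManifold 𝓘(ℝ, ES) ∞ S]
  {F : Type*} [NormedAddCommGroup F] [NormedSpace ℝ F]
  {ι : C^∞⟮𝓘(ℝ, ES), S; 𝓘(ℝ, E), M⟯}

/-- The tangent space `T_s S`, as the subspace `dι(T_s S)` of `T_{ι s} M`. -/
def tangentRange (ι : C^∞⟮𝓘(ℝ, ES), S; 𝓘(ℝ, E), M⟯) (s : S) :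
    Submodule ℝ (TangentSpace 𝓘(ℝ, E) (ι s)) :=
  LinearMap.range (mfderiv 𝓘(ℝ, ES) 𝓘(ℝ, E) ι s).toLinearMap

/-- The fibre `T_{ι s} M / T_s S` of the normal bundle `ν(M, S)`. The immersion property `_hι`, in
which `F` is the type of the complements of the tangent spaces of `S`, is recorded because the bundle
structure below, with model fibre `F`, comes from the slice charts. -/
def _root_.NormalFiber (_hι : IsImmersionOfComplement F 𝓘(ℝ, ES) 𝓘(ℝ, E) ∞ ι) (s : S) : Type _ :=
  TangentSpace 𝓘(ℝ, E) (ι s) ⧸ tangentRange ι s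

variable (hι : IsImmersionOfComplement F 𝓘(ℝ, ES) 𝓘(ℝ, E) ∞ ι)

instance (s : S) : AddCommGroup (NormalFiber hι s) :=
  inferInstanceAs (AddCommGroup (TangentSpace 𝓘(ℝ, E) (ι s) ⧸ tangentRange ι s))
instance (s : S) : Module ℝ (NormalFiber hι s) :=
  inferInstanceAs (Module ℝ (TangentSpace 𝓘(ℝ, E) (ι s) ⧸ tangentRange ι s))
instance (s : S) : TopologicalSpace (NormalFiber hι s) :=
  inferInstanceAs (TopologicalSpace (TangentSpace 𝓘(ℝ, E) (ι s) ⧸ tangentRange ι s))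

/-- The quotient map `u ↦ [u]`. -/
def mk (s : S) : TangentSpace 𝓘(ℝ, E) (ι s) →ₗ[ℝ] NormalFiber hι s :=
  (tangentRange ι s).mkQ

/-- The normal component of a tangent vector in the slice chart around `s₀`. -/
def normalComp (s₀ s : S) : TangentSpace 𝓘(ℝ, E) (ι s) →L[ℝ] F :=
  ((ContinuousLinearMap.snd ℝ ES F).comp ((hι s₀).equiv.symm : E →L[ℝ] ES × F)).comp
    (mfderiv 𝓘(ℝ, E) 𝓘(ℝ, E) (hι s₀).codChart (ι s))

lemma codChart_mdiff (s₀ : S) :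
    (hι s₀).codChart.MDifferentiable 𝓘(ℝ, E) 𝓘(ℝ, E) := by
  have h := (hι s₀).codChart_mem_maximalAtlas
  exact ⟨(contMDiffOn_of_mem_maximalAtlas h).mdifferentiableOn (by simp),
   (contMDiffOn_symm_of_mem_maximalAtlas h).mdifferentiableOn (by simp)⟩

lemma domChart_mdiff (s₀ : S) :
    (hι s₀).domChart.MDifferentiable 𝓘(ℝ, ES) 𝓘(ℝ, ES) := by
  have h := (hι s₀).domChart_mem_maximalAtlas
  exact ⟨(contMDiffOn_of_mem_maximalAtlas h).mdifferentiableOn (by simp),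
   (contMDiffOn_symm_of_mem_maximalAtlas h).mdifferentiableOn (by simp)⟩

lemma chart_eq (s₀ : S) {s : S} (hs : s ∈ (hι s₀).domChart.source) :
    (hι s₀).codChart (ι s) = (hι s₀).equiv ((hι s₀).domChart s, 0) := by
  have h := (hι s₀).writtenInCharts ((OpenPartialHomeomorph.extend_source (f := (hι s₀).domChart)
    (I := 𝓘(ℝ, ES)) ▸ ((hι s₀).domChart.extend 𝓘(ℝ, ES)).map_source) (by simpa using hs))
  simpa [hs] using h

lemma mfderiv_chart_comp (s₀ : S) {s : S} (hs : s ∈ (hι s₀).domChart.source)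
    (v : TangentSpace 𝓘(ℝ, ES) s) :
    mfderiv 𝓘(ℝ, E) 𝓘(ℝ, E) (hι s₀).codChart (ι s) (mfderiv 𝓘(ℝ, ES) 𝓘(ℝ, E) ι s v) =
      (hι s₀).equiv (mfderiv 𝓘(ℝ, ES) 𝓘(ℝ, ES) (hι s₀).domChart s v, 0) := by
  have hcod := (codChart_mdiff hι s₀).mdifferentiableAt ((hι s₀).source_subset_preimage_source hs)
  have hι' : MDifferentiableAt 𝓘(ℝ, ES) 𝓘(ℝ, E) ι s :=
    ι.contMDiff.mdifferentiableAt (by simp)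
  have hdom := (domChart_mdiff hι s₀).mdifferentiableAt hs
  let Λ : ES →L[ℝ] E := ((hι s₀).equiv : ES × F →L[ℝ] E).comp (ContinuousLinearMap.inl ℝ ES F)
  have h1 : (hι s₀).codChart ∘ ι =ᶠ[𝓝 s] Λ ∘ (hι s₀).domChart := by
    filter_upwards [(hι s₀).domChart.open_source.mem_nhds hs] with t ht
    simpa [Λ] using chart_eq hι s₀ ht
  have h2 := h1.mfderiv_eq (I := 𝓘(ℝ, ES)) (I' := 𝓘(ℝ, E))
  rw [mfderiv_comp s hcod hι', mfderiv_comp s Λ.mdifferentiableAt hdom] at h2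
  have h3 := congrArg (fun L => L v) h2
  rw [Λ.mfderiv_eq] at h3
  exact h3

lemma ker_normalComp (s₀ : S) {s : S} (hs : s ∈ (hι s₀).domChart.source) :
    LinearMap.ker (normalComp hι s₀ s).toLinearMap = tangentRange ι s := by
  ext u
  constructor
  · intro hu
    have hu' : ((hι s₀).equiv.symm (mfderiv 𝓘(ℝ, E) 𝓘(ℝ, E) (hι s₀).codChart (ι s) u)).2 = 0 := hu
    obtain ⟨v, hv⟩ := (domChart_mdiff hι s₀).mfderiv_surjective hs
      ((hι s₀).equiv.symm (mfderiv 𝓘(ℝ, E) 𝓘(ℝ, E) (hι s₀).codChart (ι s) u)).1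
    refine ⟨v, ?_⟩
    apply (codChart_mdiff hι s₀).mfderiv_injective ((hι s₀).source_subset_preimage_source hs)
    refine (mfderiv_chart_comp hι s₀ hs v).trans ?_
    apply (hι s₀).equiv.symm.injective
    rw [ContinuousLinearEquiv.symm_apply_apply]
    exact Prod.ext hv hu'.symm
  · rintro ⟨v, rfl⟩
    change ((hι s₀).equiv.symm (mfderiv 𝓘(ℝ, E) 𝓘(ℝ, E) (hι s₀).codChart (ι s)
      (mfderiv 𝓘(ℝ, ES) 𝓘(ℝ, E) ι s v))).2 = 0
    rw [mfderiv_chart_comp hι s₀ hs v]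
    simp

/-- A right inverse of `normalComp`. -/
def normalLift (s₀ s : S) : F →L[ℝ] TangentSpace 𝓘(ℝ, E) (ι s) :=
  (mfderiv 𝓘(ℝ, E) 𝓘(ℝ, E) (hι s₀).codChart.symm ((hι s₀).codChart (ι s))).comp
    (((hι s₀).equiv : ES × F →L[ℝ] E).comp (ContinuousLinearMap.inr ℝ ES F))

lemma codChart_symm_comp (s₀ : S) {s : S} (hs : s ∈ (hι s₀).domChart.source) (w : E) :
    mfderiv 𝓘(ℝ, E) 𝓘(ℝ, E) (hι s₀).codChart (ι s)
      (mfderiv 𝓘(ℝ, E) 𝓘(ℝ, E) (hι s₀).codChart.symm ((hι s₀).codChart (ι s)) w) = w :=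
  ((codChart_mdiff hι s₀).mfderiv ((hι s₀).source_subset_preimage_source hs)).right_inv w

lemma normalComp_lift (s₀ : S) {s : S} (hs : s ∈ (hι s₀).domChart.source) (v : F) :
    normalComp hι s₀ s (normalLift hι s₀ s v) = v := by
  have h := codChart_symm_comp hι s₀ hs ((hι s₀).equiv (0, v))
  have h2 := congrArg (fun w => ((hι s₀).equiv.symm w).2) h
  simp only [ContinuousLinearEquiv.symm_apply_apply] at h2
  exact h2

/-- The linear isomorphism `T_{ι s} M / T_s S ≃ F` given by the slice chart around `s₀`. -/
def fiberEquiv (s₀ : S) {s : S} (hs : s ∈ (hι s₀).domChart.source) :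
    NormalFiber hι s ≃ₗ[ℝ] F :=
  (Submodule.quotEquivOfEq _ _ (ker_normalComp hι s₀ hs).symm).trans
    ((normalComp hι s₀ s).toLinearMap.quotKerEquivOfSurjective
      (fun v => ⟨_, normalComp_lift hι s₀ hs v⟩))

lemma fiberEquiv_mk (s₀ : S) {s : S} (hs : s ∈ (hι s₀).domChart.source)
    (u : TangentSpace 𝓘(ℝ, E) (ι s)) :
    fiberEquiv hι s₀ hs (mk hι s u) = normalComp hι s₀ s u := rfl

lemma fiberEquiv_symm (s₀ : S) {s : S} (hs : s ∈ (hι s₀).domChart.source) (v : F) :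
    (fiberEquiv hι s₀ hs).symm v = mk hι s (normalLift hι s₀ s v) := by
  rw [LinearEquiv.symm_apply_eq, fiberEquiv_mk, normalComp_lift hι s₀ hs]

lemma continuous_fiberEquiv (s₀ : S) {s : S} (hs : s ∈ (hι s₀).domChart.source) :
    Continuous (fiberEquiv hι s₀ hs) :=
  (tangentRange ι s).isQuotientMap_mkQ.continuous_iff.2 (normalComp hι s₀ s).continuous

lemma continuous_fiberEquiv_symm (s₀ : S) {s : S} (hs : s ∈ (hι s₀).domChart.source) :
    Continuous (fiberEquiv hι s₀ hs).symm := by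
  have : ((fiberEquiv hι s₀ hs).symm : F → NormalFiber hι s) =
      (tangentRange ι s).mkQ ∘ normalLift hι s₀ s := funext (fiberEquiv_symm hι s₀ hs)
  rw [this]
  exact (tangentRange ι s).isQuotientMap_mkQ.continuous.comp (normalLift hι s₀ s).continuous

open scoped Classical in
/-- The local trivialization of the normal bundle over the domain of the slice chart around
`s₀`. -/
def pretriv (s₀ : S) : Pretrivialization F (π F (NormalFiber hι)) where
  toFun x := (x.1, if h : x.1 ∈ (hι s₀).domChart.source then fiberEquiv hι s₀ h x.2 else 0)
  invFun p := ⟨p.1, if h : p.1 ∈ (hι s₀).domChart.source then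
    (fiberEquiv hι s₀ h).symm p.2 else 0⟩
  source := π F (NormalFiber hι) ⁻¹' (hι s₀).domChart.source
  target := (hι s₀).domChart.source ×ˢ univ
  baseSet := (hι s₀).domChart.source
  map_source' x hx := ⟨hx, trivial⟩
  map_target' p hp := hp.1
  left_inv' := by
    rintro ⟨s, x⟩ hx
    have hx' : s ∈ (hι s₀).domChart.source := hx
    simp [hx']
  right_inv' := by
    rintro ⟨s, v⟩ hp
    have hx' : s ∈ (hι s₀).domChart.source := hp.1
    simp [hx']
  open_target := (hι s₀).domChart.open_source.prod isOpen_univ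
  open_baseSet := (hι s₀).domChart.open_source
  source_eq := rfl
  target_eq := rfl
  proj_toFun _ _ := rfl

lemma pretriv_apply (s₀ : S) {s : S} (hs : s ∈ (hι s₀).domChart.source) (x : NormalFiber hι s) :
    pretriv hι s₀ ⟨s, x⟩ = (s, fiberEquiv hι s₀ hs x) := by
  change (s, _) = _
  simp [hs]

lemma pretriv_symm (s₀ : S) {s : S} (hs : s ∈ (hι s₀).domChart.source) (v : F) :
    (pretriv hι s₀).symm s v = (fiberEquiv hι s₀ hs).symm v := by
  apply (fiberEquiv hι s₀ hs).injective
  have h := (pretriv hι s₀).apply_mk_symm (b := s) hs v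
  rw [pretriv_apply hι s₀ hs] at h
  rw [LinearEquiv.apply_symm_apply]
  exact (Prod.ext_iff.1 h).2

/-- The transition functions of the normal bundle. -/
def coordChange (i j s : S) : F →L[ℝ] F :=
  ((ContinuousLinearMap.snd ℝ ES F).comp ((hι j).equiv.symm : E →L[ℝ] ES × F)).comp
    ((fderiv ℝ ((hι j).codChart ∘ (hι i).codChart.symm) ((hι i).codChart (ι s))).comp
      (((hι i).equiv : ES × F →L[ℝ] E).comp (ContinuousLinearMap.inr ℝ ES F)))

lemma coordChange_apply (i j : S) {s : S} (hi : s ∈ (hι i).domChart.source)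
    (hj : s ∈ (hι j).domChart.source) (v : F) :
    coordChange hι i j s v = fiberEquiv hι j hj ((fiberEquiv hι i hi).symm v) := by
  have hi' : ι s ∈ (hι i).codChart.source := (hι i).source_subset_preimage_source hi
  have hj' : ι s ∈ (hι j).codChart.source := (hι j).source_subset_preimage_source hj
  have h1 := (codChart_mdiff hι j).mdifferentiableAt hj'
  have h2 := (codChart_mdiff hι i).mdifferentiableAt_symm ((hι i).codChart.map_source hi')
  have h3 : (hι i).codChart.symm ((hι i).codChart (ι s)) = ι s := (hι i).codChart.left_inv hi'
  rw [fiberEquiv_symm, fiberEquiv_mk, coordChange, ← mfderiv_eq_fderiv,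
    mfderiv_comp (I' := 𝓘(ℝ, E)) _ (by rw [h3]; exact h1) h2]
  rw [h3]
  rfl

lemma contMDiffOn_coordChange (i j : S) :
    ContMDiffOn 𝓘(ℝ, ES) 𝓘(ℝ, F →L[ℝ] F) ∞ (coordChange hι i j)
      ((hι i).domChart.source ∩ (hι j).domChart.source) := by
  have hi := (hι i).codChart_mem_maximalAtlas
  have hj := (hι j).codChart_mem_maximalAtlas
  let U : Set E := ((hι i).codChart.symm.trans (hι j).codChart).source
  have hU : IsOpen U := ((hι i).codChart.symm.trans (hι j).codChart).open_source
  have hUe : U = (hι i).codChart.target ∩ (hι i).codChart.symm ⁻¹' (hι j).codChart.source :=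
    OpenPartialHomeomorph.trans_source _ _
  have h1 : ContDiffOn ℝ ∞ ((hι j).codChart ∘ (hι i).codChart.symm) U := by
    rw [← contMDiffOn_iff_contDiffOn]
    refine (contMDiffOn_of_mem_maximalAtlas hj).comp
      ((contMDiffOn_symm_of_mem_maximalAtlas hi).mono ?_) ?_
    · rw [hUe]; exact inter_subset_left
    · rw [hUe]; exact fun x hx => hx.2
  have h2 : ContDiffOn ℝ ∞ (fderiv ℝ ((hι j).codChart ∘ (hι i).codChart.symm)) U :=
    h1.fderiv_of_isOpen hU (by simp)
  have h3 : ContMDiffOn 𝓘(ℝ, ES) 𝓘(ℝ, E) ∞ (fun s => (hι i).codChart (ι s))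
      ((hι i).domChart.source ∩ (hι j).domChart.source) :=
    (contMDiffOn_of_mem_maximalAtlas hi).comp ι.contMDiff.contMDiffOn
      (fun s hs => (hι i).source_subset_preimage_source hs.1)
  have h4 := h2.contMDiffOn.comp h3 (fun s hs => by
    have hi' : ι s ∈ (hι i).codChart.source := (hι i).source_subset_preimage_source hs.1
    have hj' : ι s ∈ (hι j).codChart.source := (hι j).source_subset_preimage_source hs.2
    change _ ∈ U
    rw [hUe]
    refine ⟨(hι i).codChart.map_source hi', ?_⟩
    rw [mem_preimage, (hι i).codChart.left_inv hi']
    exact hj')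
  exact (contMDiffOn_const.clm_comp (h4.clm_comp contMDiffOn_const))

/-- The local trivializations of the normal bundle, coming from the slice charts. -/
def prebundle : VectorPrebundle ℝ F (NormalFiber hι) where
  pretrivializationAtlas := range (pretriv hι)
  pretrivialization_linear' := by
    rintro _ ⟨i, rfl⟩
    refine ⟨fun s hs => ?_⟩
    have hs' : s ∈ (hι i).domChart.source := hs
    have h : (fun x : NormalFiber hι s => (pretriv hι i ⟨s, x⟩).2) = fiberEquiv hι i hs' :=
      funext fun x => by rw [pretriv_apply hι i hs']
    rw [h]
    exact (fiberEquiv hι i hs').toLinearMap.isLinear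
  pretrivializationAt := pretriv hι
  mem_base_pretrivializationAt s := (hι s).mem_domChart_source
  pretrivialization_mem_atlas s := ⟨s, rfl⟩
  exists_coordChange := by
    rintro _ ⟨i, rfl⟩ _ ⟨j, rfl⟩
    refine ⟨coordChange hι i j, (contMDiffOn_coordChange hι i j).continuousOn, ?_⟩
    intro s hs v
    rw [pretriv_symm hι i hs.1, pretriv_apply hι j hs.2, coordChange_apply hι i j hs.1 hs.2]
  totalSpaceMk_isInducing s := by
    have hs := (hι s).mem_domChart_source
    have h : pretriv hι s ∘ TotalSpace.mk s = fun x => (s, fiberEquiv hι s hs x) :=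
      funext fun x => pretriv_apply hι s hs x
    rw [h]
    let e : NormalFiber hι s ≃ₜ F :=
      { (fiberEquiv hι s hs).toEquiv with
        continuous_toFun := continuous_fiberEquiv hι s hs
        continuous_invFun := continuous_fiberEquiv_symm hι s hs }
    exact (isInducing_const_prod.2 e.isInducing)

instance : (prebundle hι).IsContMDiff 𝓘(ℝ, ES) ∞ where
  exists_contMDiffCoordChange := by
    rintro _ ⟨i, rfl⟩ _ ⟨j, rfl⟩
    refine ⟨coordChange hι i j, contMDiffOn_coordChange hι i j, ?_⟩
    intro s hs v
    rw [pretriv_symm hι i hs.1, pretriv_apply hι j hs.2, coordChange_apply hι i j hs.1 hs.2]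

instance : TopologicalSpace (TotalSpace F (NormalFiber hι)) := (prebundle hι).totalSpaceTopology
instance : FiberBundle F (NormalFiber hι) := (prebundle hι).toFiberBundle
instance : VectorBundle ℝ F (NormalFiber hι) := (prebundle hι).toVectorBundle
instance : ContMDiffVectorBundle ∞ F (NormalFiber hι) 𝓘(ℝ, ES) :=
  (prebundle hι).contMDiffVectorBundle 𝓘(ℝ, ES)

end NormalBundle

/-! ## Linear approximations along a submanifold -/

section Linearization

variable {E : Type*} [NormedAddCommGroup E] [NormedSpace ℝ E]
  {M : Type*} [TopologicalSpace M] [ChartedSpace E M] [IsManifold 𝓘(ℝ, E) ∞ M]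
  {ES : Type*} [NormedAddCommGroup ES] [NormedSpace ℝ ES]
  {S : Type*} [TopologicalSpace S] [ChartedSpace ES S] [IsManifold 𝓘(ℝ, ES) ∞ S]
  {F : Type*} [NormedAddCommGroup F] [NormedSpace ℝ F]
  {ι : C^∞⟮𝓘(ℝ, ES), S; 𝓘(ℝ, E), M⟯}

/-- The total space of the normal bundle `ν(M, S) = ι^* TM / TS`, a smooth manifold. -/
abbrev NormalTotal (hι : IsImmersionOfComplement F 𝓘(ℝ, ES) 𝓘(ℝ, E) ∞ ι) : Type _ :=
  TotalSpace F (NormalFiber hι)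

/-- The projection `p : ν(M, S) → S`. -/
def normalProj (hι : IsImmersionOfComplement F 𝓘(ℝ, ES) 𝓘(ℝ, E) ∞ ι) :
    C^∞⟮𝓘(ℝ, ES).prod 𝓘(ℝ, F), NormalTotal hι; 𝓘(ℝ, ES), S⟯ :=
  ⟨TotalSpace.proj, contMDiff_proj (NormalFiber hι)⟩

open scoped Classical in
/-- The fibrewise linear function `f^ν : ν(M, S) → ℝ`, `f^ν([u]) = d f (u)`, of a function `f` on
`M` that is constant along `S` (wherever `df` does not vanish on `TS`, so that this is
meaningless, the value is `0`). -/
def normalDeriv (hι : IsImmersionOfComplement F 𝓘(ℝ, ES) 𝓘(ℝ, E) ∞ ι) (f : M → ℝ)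
    (x : NormalTotal hι) : ℝ :=
  if h : NormalBundle.tangentRange ι x.proj ≤ LinearMap.ker (dR 𝓘(ℝ, E) f (ι x.proj)) then
    (NormalBundle.tangentRange ι x.proj).liftQ (dR 𝓘(ℝ, E) f (ι x.proj)) h x.snd
  else 0

/-- For a vector field `Y` on `M` that is tangent to `S`: the vector field `Z` on `ν(M, S)` is the
linear approximation `ν(Y)` of `Y`, that is, `L_Z (p^* f|_S) = p^* (L_Y f)|_S` for all
`f ∈ C^∞(M)`, and `L_Z f^ν = (L_Y f)^ν` if `f` vanishes along `S`. (`f` needs to vanish only along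
a neighbourhood of the point of `S` under consideration; this makes a difference only if `S` is
not embedded.) -/
structure IsLinearApproximation (hι : IsImmersionOfComplement F 𝓘(ℝ, ES) 𝓘(ℝ, E) ∞ ι)
    (Y : ∀ m : M, TangentSpace 𝓘(ℝ, E) m)
    (Z : ∀ x : NormalTotal hι, TangentSpace (𝓘(ℝ, ES).prod 𝓘(ℝ, F)) x) : Prop where
  deriv_pullback : ∀ (f : C^∞⟮𝓘(ℝ, E), M; 𝓘(ℝ, ℝ), ℝ⟯) (x : NormalTotal hι),
    dR (𝓘(ℝ, ES).prod 𝓘(ℝ, F)) (fun y : NormalTotal hι => f (ι y.proj)) x (Z x) =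
      dR 𝓘(ℝ, E) f (ι x.proj) (Y (ι x.proj))
  deriv_normalDeriv : ∀ (f : C^∞⟮𝓘(ℝ, E), M; 𝓘(ℝ, ℝ), ℝ⟯) (x : NormalTotal hι),
    (∀ᶠ s in 𝓝 x.proj, f (ι s) = 0) →
      dR (𝓘(ℝ, ES).prod 𝓘(ℝ, F)) (normalDeriv hι f) x (Z x) =
        normalDeriv hι (fun m => dR 𝓘(ℝ, E) f m (Y m)) x

variable {FA : Type*} [NormedAddCommGroup FA] [NormedSpace ℝ FA]
  {A : M → Type*} [∀ m, AddCommGroup (A m)] [∀ m, Module ℝ (A m)]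
  [TopologicalSpace (TotalSpace FA A)] [∀ m, TopologicalSpace (A m)] [FiberBundle FA A]
  [VectorBundle ℝ FA A]

/-- The Courant algebroid `A|_S = ι^* A → S`: its metric and anchor are the restrictions of those of
`A`, and the restriction map `Γ(A) → Γ(A|_S)` is bracket preserving. -/
structure CourantAlgebroid.IsRestriction (C : CourantAlgebroid 𝓘(ℝ, E) FA A)
    (AS : CourantAlgebroid 𝓘(ℝ, ES) FA (ι *ᵖ A)) : Prop where
  metric_eq : ∀ (s : S) (v w : A (ι s)), AS.metric s v w = C.metric (ι s) v w
  anchor_eq : ∀ (s : S) (v : A (ι s)),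
    mfderiv 𝓘(ℝ, ES) 𝓘(ℝ, E) ι s (AS.anchor s v) = C.anchor (ι s) v
  bracket_eq : ∀ σ τ : Cₛ^∞⟮𝓘(ℝ, E); FA, A⟯,
    AS.bracket (pullbackSection ι σ) (pullbackSection ι τ) = pullbackSection ι (C.bracket σ τ)

/-- The Courant algebroid `ν(A, A|_S) = p^*(A|_S) → ν(M, S)`: its metric is the pull-back of the
metric of `A|_S`, its anchor is `ν(a) : ν(A, A|_S) → ν(TM, TS) ≅ Tν(M, S)`, that is
(as `ν(a) ∘ ν(σ) = ν(a ∘ σ)` and `ν(σ) = p^* σ|_S`), for every `σ ∈ Γ(A)` the vector field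
`ν(a)(p^* σ|_S)` on `ν(M, S)` is the linear approximation `ν(a(σ))` of `a(σ)`; and
the pull-back map `p^* : Γ(A|_S) → Γ(ν(A, A|_S))` is bracket preserving. -/
structure CourantAlgebroid.IsLinearization (C : CourantAlgebroid 𝓘(ℝ, E) FA A)
    (hι : IsImmersionOfComplement F 𝓘(ℝ, ES) 𝓘(ℝ, E) ∞ ι)
    (AS : CourantAlgebroid 𝓘(ℝ, ES) FA (ι *ᵖ A))
    (N : CourantAlgebroid (𝓘(ℝ, ES).prod 𝓘(ℝ, F)) FA (normalProj hι *ᵖ (ι *ᵖ A))) :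
    Prop where
  metric_eq : ∀ (x : NormalTotal hι) (v w : A (ι x.proj)),
    N.metric x v w = AS.metric x.proj v w
  anchor_eq : ∀ σ : Cₛ^∞⟮𝓘(ℝ, E); FA, A⟯,
    IsLinearApproximation hι (fun m => C.anchor m (σ m)) (fun x => N.anchor x (σ (ι x.proj)))
  bracket_eq : ∀ σ τ : Cₛ^∞⟮𝓘(ℝ, ES); FA, ι *ᵖ A⟯,
    N.bracket (pullbackSection (normalProj hι) σ) (pullbackSection (normalProj hι) τ) =
      pullbackSection (normalProj hι) (AS.bracket σ τ)

/-- The canonical map `T_m M → ν(M, S)`, `u ↦ [u]`, for `m = ι s₀`. (The tangent space `T_m M` is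
`E`, which is here also considered as a manifold.) -/
def fromTangent (hι : IsImmersionOfComplement F 𝓘(ℝ, ES) 𝓘(ℝ, E) ∞ ι) (s₀ : S) (u : E) :
    NormalTotal hι :=
  ⟨s₀, NormalBundle.mk hι s₀ u⟩

end Linearization

/-! ## Metrized Lie algebras -/

section Lie

variable {d V : Type*} [AddCommGroup d] [Module ℝ d] [AddCommGroup V] [Module ℝ V]

/-- `β` is a Lie bracket, and `g` is a nondegenerate `ad`-invariant symmetric bilinear form. -/
structure IsMetrizedLieAlgebra (g : LinearMap.BilinForm ℝ d) (β : d →ₗ[ℝ] d →ₗ[ℝ] d) : Prop where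
  alternating : ∀ ζ, β ζ ζ = 0
  jacobi : ∀ ζ η θ, β ζ (β η θ) = β (β ζ η) θ + β η (β ζ θ)
  symm : ∀ ζ η, g ζ η = g η ζ
  nondegenerate : ∀ ζ, (∀ η, g ζ η = 0) → ζ = 0
  invariant : ∀ ζ η θ, g (β ζ η) θ + g η (β ζ θ) = 0

/-- `ϱ` is a representation of the Lie algebra `(d, β)` on `V`, and for every `u ∈ V` the
stabilizer `d_u = {ζ | ϱ(ζ) u = 0}` is coisotropic, `d_u^⊥ ⊂ d_u`. -/
structure IsCoisotropicRepresentation (g : LinearMap.BilinForm ℝ d) (β : d →ₗ[ℝ] d →ₗ[ℝ] d)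
    (ϱ : d →ₗ[ℝ] Module.End ℝ V) : Prop where
  map_bracket : ∀ ζ η, ϱ (β ζ η) = ϱ ζ * ϱ η - ϱ η * ϱ ζ
  coisotropic : ∀ u : V, g.orthogonal (LinearMap.ker (ϱ.flip u)) ≤ LinearMap.ker (ϱ.flip u)

end Lie

end

/-!
The bracket of a Courant algebroid satisfies two Leibniz rules, so that it is determined by its
values on any set of sections containing local frames (`PreCourant.bracket_unique`). Conversely,
if a bracket satisfies the Leibniz rules and if `a ∘ a^* = 0`, then the defects of the axioms of a
Courant algebroid, and of the compatibility of the anchor with brackets, are tensors, so that the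
axioms need to be checked on generators only (`PreCourant.toCourantAlgebroid`).

The bundles in question are pull-backs `f^* A`, with `f` the immersion `ι : S → M` or the
projection `p : ν(M, S) → S`, and they are generated by pull-back sections. Uniqueness is
therefore immediate once the anchor is known. For existence, let `b : f^* A → TN` be a lift of the
anchor of `A` whose kernel is coisotropic and which preserves brackets of pull-back sections
(`CourantAlgebroid.IsPullbackAnchor`). A bracket on `f^* A` that satisfies the Leibniz rules and
extends the bracket of pull-back sections is given in a local trivialization of `A`, with its flat
connection `∇`, by `H(s, t) + ∇_{b s} t - ∇_{b t} s + ⟨∇_{b (·)} s, t⟩^♯`, where `H` is the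
bracket of constant sections (`CourantAlgebroid.pullbackBracketAt`). The axioms for pull-back
sections are those of `A` (`CourantAlgebroid.IsPullbackAnchor.exists_courantAlgebroid`).

For `A|_S` the conditions on the anchor are inherited from `A`, as functions on `S` extend locally
to `M`. For `ν(A, A|_S)` everything is tested on the functions `p^* f` and `f^ν`, whose
differentials separate tangent vectors of `ν(M, S)` (`eq_zero_of_pullback_normalDeriv`). This
shows that `ν(a)` is unique and preserves brackets; it exists since at the point `[X|_s]`, for a
vector field `X` on `M`, its value on `σ` is the image of `a(σ)` under the differential of the
section `[X|_S]`, plus the vertical vector `[X, a(σ)]`. The point that needs a new argument is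
that the kernel of `ν(a)` is coisotropic. If `f` and `g` vanish along `S`, then `a^* df` and
`a^* dg` vanish along `S`, and the second derivative of `⟨a^* df, a^* dg⟩ = 0` in a direction `u`
shows that the derivatives of `a^* df` and `a^* dg` in this direction are orthogonal
(`CourantAlgebroid.metric_eq_zero_of_deriv`, `CourantAlgebroid.linAnchor_coisotropic`).

Dirac structures are spanned by sections, so the same generation argument gives the involutivity
of their pull-backs (`CourantAlgebroid.IsDirac.pullback`). If `S` is a point `m`, then the anchor
is zero there, so the bracket at `m` depends only on the values of the sections, and the
derivative at `m` of `a(σ) f` only on `σ|_m`; this gives the Lie algebra and its representation,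
and the coisotropy of the stabilizers is again the second derivative argument. The anchor of
`ν(A, A_m)` is identified by its action on the functions `f^ν`, which are linear on `T_m M`.
-/

open Bundle Manifold ContDiff Set Function Topology

noncomputable section

set_option linter.unusedSectionVars false

/-! ### Smooth functions, sections and their germs -/

section Tools

variable {E : Type*} [NormedAddCommGroup E] [NormedSpace ℝ E] {H : Type*} [TopologicalSpace H]
  {N : Type*} [TopologicalSpace N] [ChartedSpace H N] {I : ModelWithCorners ℝ E H}

section Injective

variable {V W : Type*} [NormedAddCommGroup V] [NormedSpace ℝ V] [FiniteDimensional ℝ V]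
  [NormedAddCommGroup W] [NormedSpace ℝ W] [FiniteDimensional ℝ W]

/-- A vector-valued function `c` is smooth near `x` if `L y (c y)` is, for a smooth family `L` of
linear maps that is injective at `x`: near `x`, `c` is recovered by inverting `Λ ∘ L y` for a left
inverse `Λ` of `L x`. -/
lemma eventually_contMDiffAt_of_injective {L : N → V →ₗ[ℝ] W} {x : N}
    (hL : ∀ w, ∀ᶠ y in 𝓝 x, ContMDiffAt I 𝓘(ℝ, W) ∞ (fun y => L y w) y)
    (hinj : Injective (L x)) {c : N → V}
    (hc : ∀ᶠ y in 𝓝 x, ContMDiffAt I 𝓘(ℝ, W) ∞ (fun y => L y (c y)) y) :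
    ∀ᶠ y in 𝓝 x, ContMDiffAt I 𝓘(ℝ, V) ∞ c y := by
  obtain ⟨Λ, hΛ⟩ := (L x).exists_leftInverse_of_injective (LinearMap.ker_eq_bot.2 hinj)
  let Λ' : W →L[ℝ] V := LinearMap.toContinuousLinearMap Λ
  let b := Module.finBasis ℝ V
  let Q : N → V →L[ℝ] V := fun y => Λ'.comp (LinearMap.toContinuousLinearMap (L y))
  have hQ (y : N) : Q y = ∑ i, (LinearMap.toContinuousLinearMap (b.coord i)).smulRight
      (Λ' (L y (b i))) := by
    ext v
    conv_lhs => rw [← b.sum_repr v]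
    simp only [Q, ContinuousLinearMap.comp_apply, map_sum, map_smul,
      sum_apply, ContinuousLinearMap.smulRight_apply,
      LinearMap.coe_toContinuousLinearMap', Module.Basis.coord_apply]
  have hQs : ∀ᶠ y in 𝓝 x, ContMDiffAt I 𝓘(ℝ, V →L[ℝ] V) ∞ Q y := by
    have h := Filter.eventually_all.2 (fun i => hL (b i))
    filter_upwards [h] with y hy
    have : Q = fun y => ∑ i, (ContinuousLinearMap.smulRightL ℝ V V
      (LinearMap.toContinuousLinearMap (b.coord i))) (Λ' (L y (b i))) := by
      ext1 y; exact hQ y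
    rw [this]
    refine contMDiffAt_finsetSum fun i _ => ?_
    exact ((ContinuousLinearMap.smulRightL ℝ V V
      (LinearMap.toContinuousLinearMap (b.coord i))).contMDiff.contMDiffAt).comp y
      (Λ'.contMDiff.contMDiffAt.comp y (hy i))
  have hQx : Q x = 1 := by
    ext v
    exact congrArg (fun T => T v) hΛ
  have hunit : ∀ᶠ y in 𝓝 x, IsUnit (Q y) := by
    have hcont := hQs.self_of_nhds.continuousAt
    have : {T : V →L[ℝ] V | IsUnit T} ∈ 𝓝 (Q x) := Units.isOpen.mem_nhds (by simp [hQx])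
    exact hcont this
  have hceq : ∀ᶠ y in 𝓝 x, c y = Ring.inverse (Q y) (Λ' (L y (c y))) := by
    filter_upwards [hunit] with y hy
    have h := Ring.inverse_mul_cancel _ hy
    exact (congrArg (fun T => T (c y)) h).symm
  filter_upwards [hQs, hunit, hc, hceq.eventually_nhds] with y hy1 hy2 hy3 hy4
  refine ContMDiffAt.congr_of_eventuallyEq ?_ hy4
  have h1 : ContMDiffAt I 𝓘(ℝ, V →L[ℝ] V) ∞ (fun y => Ring.inverse (Q y)) y := by
    obtain ⟨u, hu⟩ := hy2
    have := contDiffAt_ringInverse ℝ (n := ∞) u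
    rw [hu] at this
    exact this.contMDiffAt.comp y hy1
  exact h1.clm_apply (Λ'.contMDiff.contMDiffAt.comp y hy3)

end Injective

variable [FiniteDimensional ℝ E] [T2Space N]

lemma exists_bump {x : N} {U : Set N} (hU : U ∈ 𝓝 x) [IsManifold I ∞ N] :
    ∃ ρ : C^∞⟮I, N; 𝓘(ℝ, ℝ), ℝ⟯, (∀ᶠ y in 𝓝 x, ρ y = 1) ∧ tsupport ρ ⊆ U := by
  obtain ⟨ρ, -, hρ⟩ := (SmoothBumpFunction.nhds_basis_tsupport (I := I) x).mem_iff.1 hU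
  exact ⟨⟨ρ, ρ.contMDiff⟩, ρ.eventuallyEq_one, hρ⟩

/-- Germs of functions that are smooth near a point are germs of globally defined smooth functions.
Smoothness is assumed at all nearby points, as smoothness of class `C^∞` at `x` alone gives only
neighbourhoods depending on the order of differentiability. -/
lemma exists_function_eventuallyEq [IsManifold I ∞ N] {x : N} {φ : N → ℝ}
    (h : ∀ᶠ y in 𝓝 x, ContMDiffAt I 𝓘(ℝ, ℝ) ∞ φ y) :
    ∃ ψ : C^∞⟮I, N; 𝓘(ℝ, ℝ), ℝ⟯, ∀ᶠ y in 𝓝 x, ψ y = φ y := by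
  obtain ⟨ρ, hρ1, hρ⟩ := exists_bump (I := I) h
  refine ⟨⟨fun y => ρ y * φ y, contMDiff_of_tsupport fun y hy => ?_⟩, ?_⟩
  · exact ρ.contMDiff.contMDiffAt.mul (hρ (tsupport_mul_subset_left hy))
  · filter_upwards [hρ1] with y hy
    simp [hy]

variable [IsManifold I ∞ N] {F : Type*} [NormedAddCommGroup F] [NormedSpace ℝ F]
  {B : N → Type*} [∀ m, AddCommGroup (B m)] [∀ m, Module ℝ (B m)]
  [TopologicalSpace (TotalSpace F B)] [∀ m, TopologicalSpace (B m)] [FiberBundle F B]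
  [VectorBundle ℝ F B]

variable (F) in
/-- The fibre coordinate at `y` in the distinguished trivialization around `x` (zero off its base
set). -/
def bcoord (x y : N) : B y →ₗ[ℝ] F := (trivializationAt F B x).linearMapAt ℝ y

variable (F) in
/-- The element of the fibre over `y` with given coordinate in the distinguished trivialization
around `x` (zero off its base set). -/
def bsymm (x y : N) : F →ₗ[ℝ] B y := (trivializationAt F B x).symmₗ ℝ y

lemma eventually_mem_baseSet (x : N) : ∀ᶠ y in 𝓝 x, y ∈ (trivializationAt F B x).baseSet :=
  (trivializationAt F B x).open_baseSet.mem_nhds (FiberBundle.mem_baseSet_trivializationAt' x)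

lemma bsymm_bcoord {x y : N} (h : y ∈ (trivializationAt F B x).baseSet) (v : B y) :
    bsymm F x y (bcoord F x y v) = v :=
  (trivializationAt F B x).symmₗ_linearMapAt h v

lemma bcoord_bsymm {x y : N} (h : y ∈ (trivializationAt F B x).baseSet) (w : F) :
    bcoord F x y (bsymm F x y w : B y) = w :=
  (trivializationAt F B x).linearMapAt_symmₗ h w

lemma bsymm_bcoord_self (x : N) (v : B x) : bsymm F x x (bcoord F x x v) = v :=
  bsymm_bcoord (FiberBundle.mem_baseSet_trivializationAt' x) v

lemma bcoord_bsymm_self (x : N) (w : F) : bcoord F x x (bsymm F x x w : B x) = w :=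
  bcoord_bsymm (FiberBundle.mem_baseSet_trivializationAt' x) w

lemma contMDiffAt_section_iff_bcoord {x y : N} (h : y ∈ (trivializationAt F B x).baseSet)
    [ContMDiffVectorBundle ∞ F B I] (s : ∀ y, B y) :
    ContMDiffAt I (I.prod 𝓘(ℝ, F)) ∞ (fun y => TotalSpace.mk' F y (s y)) y ↔
      ContMDiffAt I 𝓘(ℝ, F) ∞ (fun y => bcoord F x y (s y)) y := by
  rw [(trivializationAt F B x).contMDiffAt_section_iff h]
  refine Filter.EventuallyEq.contMDiffAt_iff ?_
  filter_upwards [(trivializationAt F B x).open_baseSet.mem_nhds h] with z hz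
  simp [bcoord, Trivialization.linearMapAt_apply, hz]

lemma finiteDimensional_fiber [FiniteDimensional ℝ F] (x : N) : FiniteDimensional ℝ (B x) :=
  FiniteDimensional.of_injective (bcoord F x x : B x →ₗ[ℝ] F)
    (LeftInverse.injective (bsymm_bcoord_self x))

variable [ContMDiffVectorBundle ∞ F B I]

lemma contMDiffAt_bsymm {x y : N} (h : y ∈ (trivializationAt F B x).baseSet) (w : F) :
    ContMDiffAt I (I.prod 𝓘(ℝ, F)) ∞ (fun y => TotalSpace.mk' F y (bsymm F x y w : B y)) y := by
  rw [contMDiffAt_section_iff_bcoord h]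
  refine contMDiffAt_const (c := w) |>.congr_of_eventuallyEq ?_
  filter_upwards [(trivializationAt F B x).open_baseSet.mem_nhds h] with z hz
  exact bcoord_bsymm hz w

/-- The product of a section with a smooth function. -/
def fsmul (φ : C^∞⟮I, N; 𝓘(ℝ, ℝ), ℝ⟯) (s : Cₛ^∞⟮I; F, B⟯) : Cₛ^∞⟮I; F, B⟯ where
  toFun y := φ y • s y
  contMDiff_toFun := φ.contMDiff.smul_section s.contMDiff

omit [FiniteDimensional ℝ E] [T2Space N] [IsManifold I ∞ N] [ContMDiffVectorBundle ∞ F B I] in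
@[simp] lemma fsmul_apply (φ : C^∞⟮I, N; 𝓘(ℝ, ℝ), ℝ⟯) (s : Cₛ^∞⟮I; F, B⟯) (y : N) :
    fsmul φ s y = φ y • s y := rfl

variable (I F B) in
lemma exists_extend (x : N) : ∃ ext : F →ₗ[ℝ] Cₛ^∞⟮I; F, B⟯,
    ∀ᶠ y in 𝓝 x, ∀ w, ext w y = bsymm F x y w := by
  obtain ⟨ρ, hρ1, hρ⟩ := exists_bump (I := I) (eventually_mem_baseSet (F := F) (B := B) x)
  refine ⟨{ toFun := fun w => ⟨fun y => ρ y • bsymm F x y w, ?_⟩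
            map_add' := fun v w => ?_, map_smul' := fun c w => ?_ }, ?_⟩
  · exact ContMDiffOn.smul_section_of_tsupport ρ.contMDiff.contMDiffOn
      (trivializationAt F B x).open_baseSet hρ
      (fun y hy => (contMDiffAt_bsymm hy w).contMDiffWithinAt)
  · ext y
    change ρ y • (bsymm F x y (v + w) : B y) =
      ρ y • (bsymm F x y v : B y) + ρ y • (bsymm F x y w : B y)
    rw [map_add, smul_add]
  · ext y
    change ρ y • (bsymm F x y (c • w) : B y) = c • ρ y • (bsymm F x y w : B y)
    rw [map_smul, smul_comm]
  · filter_upwards [hρ1] with y hy w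
    simp [hy]

variable (I F B) in
/-- The extension of a vector in the model fibre to a section that is constant near `x` in the
distinguished trivialization around `x`. -/
def extF (x : N) : F →ₗ[ℝ] Cₛ^∞⟮I; F, B⟯ := (exists_extend I F B x).choose

lemma extF_eventually (x : N) : ∀ᶠ y in 𝓝 x, ∀ w, extF I F B x w y = bsymm F x y w :=
  (exists_extend I F B x).choose_spec

variable (I F) in
/-- The extension of a vector in the fibre at `x` to a section that is constant near `x` in the
distinguished trivialization around `x`. -/
def extB (x : N) : B x →ₗ[ℝ] Cₛ^∞⟮I; F, B⟯ := (extF I F B x).comp (bcoord F x x)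

@[simp] lemma extB_self (x : N) (v : B x) : extB I F x v x = v := by
  change extF I F B x (bcoord F x x v) x = v
  rw [(extF_eventually x).self_of_nhds, bsymm_bcoord_self]

lemma bcoord_extB (x : N) (v : B x) :
    ∀ᶠ y in 𝓝 x, bcoord F x y (extB I F x v y) = bcoord F x x v := by
  filter_upwards [extF_eventually (I := I) (F := F) (B := B) x,
    eventually_mem_baseSet (F := F) (B := B) x] with y hy hy'
  change bcoord F x y (extF I F B x (bcoord F x x v) y) = _
  rw [hy, bcoord_bsymm hy']

lemma extF_bcoord (x : N) : ∀ᶠ y in 𝓝 x, ∀ v : B y, extF I F B x (bcoord F x y v) y = v := by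
  filter_upwards [extF_eventually (I := I) (F := F) (B := B) x,
    eventually_mem_baseSet (F := F) (B := B) x] with y hy hy' v
  rw [hy, bsymm_bcoord hy']

lemma extF_injective (x : N) {w : F} (h : extF I F B x w x = 0) : w = 0 := by
  rw [(extF_eventually x).self_of_nhds] at h
  rw [← bcoord_bsymm_self (B := B) x w, h, map_zero]

end Tools

/-! ### Differentials of functions -/

section Differential

variable {E : Type*} [NormedAddCommGroup E] [NormedSpace ℝ E] {H : Type*} [TopologicalSpace H]
  {N : Type*} [TopologicalSpace N] [ChartedSpace H N] {I : ModelWithCorners ℝ E H}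
  {E' : Type*} [NormedAddCommGroup E'] [NormedSpace ℝ E'] {H' : Type*} [TopologicalSpace H']
  {M : Type*} [TopologicalSpace M] [ChartedSpace H' M] {I' : ModelWithCorners ℝ E' H'}

lemma ContMDiffMap.mdiffAt (φ : C^∞⟮I, N; 𝓘(ℝ, ℝ), ℝ⟯) (x : N) :
    MDifferentiableAt I 𝓘(ℝ, ℝ) φ x := φ.contMDiff.mdifferentiableAt (by simp)

lemma dR_congr {f g : N → ℝ} {x : N} (h : ∀ᶠ y in 𝓝 x, f y = g y) : dR I f x = dR I g x := by
  have h' : f =ᶠ[𝓝 x] g := h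
  unfold dR
  rw [h'.mfderiv_eq]

lemma dR_mul {f g : N → ℝ} {x : N} (hf : MDifferentiableAt I 𝓘(ℝ, ℝ) f x)
    (hg : MDifferentiableAt I 𝓘(ℝ, ℝ) g x) (v : TangentSpace I x) :
    dR I (fun y => f y * g y) x v = f x * dR I g x v + g x * dR I f x v := by
  have h := (hf.hasMFDerivAt.mul hg.hasMFDerivAt).mfderiv
  have h2 := congrArg (fun T => T v) h
  exact h2

lemma dR_add {f g : N → ℝ} {x : N} (hf : MDifferentiableAt I 𝓘(ℝ, ℝ) f x)
    (hg : MDifferentiableAt I 𝓘(ℝ, ℝ) g x) (v : TangentSpace I x) :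
    dR I (fun y => f y + g y) x v = dR I f x v + dR I g x v := by
  have h := (hf.hasMFDerivAt.add hg.hasMFDerivAt).mfderiv
  exact congrArg (fun T => T v) h

lemma dR_sub {f g : N → ℝ} {x : N} (hf : MDifferentiableAt I 𝓘(ℝ, ℝ) f x)
    (hg : MDifferentiableAt I 𝓘(ℝ, ℝ) g x) (v : TangentSpace I x) :
    dR I (fun y => f y - g y) x v = dR I f x v - dR I g x v := by
  have h := (hf.hasMFDerivAt.sub hg.hasMFDerivAt).mfderiv
  exact congrArg (fun T => T v) h

@[simp] lemma dR_const (c : ℝ) (x : N) : dR I (fun _ : N => c) x = 0 := by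
  have h : mfderiv I 𝓘(ℝ, ℝ) (fun _ : N => c) x = 0 := mfderiv_const
  unfold dR
  rw [h]
  rfl

lemma dR_eq_zero_of_eventually {f : N → ℝ} {x : N} {c : ℝ} (h : ∀ᶠ y in 𝓝 x, f y = c) :
    dR I f x = 0 := (dR_congr h).trans (dR_const c x)

lemma dR_sum {ι : Type*} (s : Finset ι) {f : ι → N → ℝ} {x : N}
    (hf : ∀ i, MDifferentiableAt I 𝓘(ℝ, ℝ) (f i) x) (v : TangentSpace I x) :
    dR I (fun y => ∑ i ∈ s, f i y) x v = ∑ i ∈ s, dR I (f i) x v := by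
  classical
  have key : MDifferentiableAt I 𝓘(ℝ, ℝ) (fun y => ∑ i ∈ s, f i y) x ∧
      dR I (fun y => ∑ i ∈ s, f i y) x v = ∑ i ∈ s, dR I (f i) x v := by
    induction s using Finset.induction_on with
    | empty => simp [mdifferentiableAt_const]
    | insert a s ha ih =>
      simp only [Finset.sum_insert ha]
      exact ⟨(hf a).add ih.1, by rw [dR_add (hf a) ih.1, ih.2]⟩
  exact key.2

lemma dR_comp {f : M → ℝ} {g : N → M} {x : N} (hf : MDifferentiableAt I' 𝓘(ℝ, ℝ) f (g x))
    (hg : MDifferentiableAt I I' g x) (v : TangentSpace I x) :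
    dR I (fun y => f (g y)) x v = dR I' f (g x) (mfderiv I I' g x v) := by
  have h : mfderiv I 𝓘(ℝ, ℝ) (fun y => f (g y)) x = _ := mfderiv_comp x hf hg
  exact congrArg (fun T => T v) h

variable [IsManifold I ∞ N]

/-- The derivative of a smooth function along a smooth vector field. -/
def lieD (X : Cₛ^∞⟮I; E, (TangentSpace I : N → Type _)⟯) (φ : C^∞⟮I, N; 𝓘(ℝ, ℝ), ℝ⟯) :
    C^∞⟮I, N; 𝓘(ℝ, ℝ), ℝ⟯ where
  val y := dR I φ y (X y)
  property := by
    have h1 : ContMDiff I.tangent 𝓘(ℝ, ℝ).tangent ∞ (tangentMap I 𝓘(ℝ, ℝ) φ) :=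
      φ.contMDiff.contMDiff_tangentMap (by simp)
    exact (contMDiff_snd_tangentBundle_modelSpace ℝ 𝓘(ℝ, ℝ)).comp (h1.comp X.contMDiff)

lemma lieD_apply (X : Cₛ^∞⟮I; E, (TangentSpace I : N → Type _)⟯)
    (φ : C^∞⟮I, N; 𝓘(ℝ, ℝ), ℝ⟯) (y : N) : lieD X φ y = dR I φ y (X y) := rfl

variable [FiniteDimensional ℝ E] [T2Space N]

lemma eventually_contMDiffAt_extChartAt (x : N) :
    ∀ᶠ y in 𝓝 x, ContMDiffAt I 𝓘(ℝ, E) ∞ (extChartAt I x) y := by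
  filter_upwards [(chartAt H x).open_source.mem_nhds (mem_chart_source H x)] with y hy
  exact (contMDiffOn_extChartAt (n := ∞) y hy).contMDiffAt
    ((chartAt H x).open_source.mem_nhds hy)

/-- Every covector at `x` is the differential of a globally defined function vanishing at `x`. -/
lemma exists_dR_eq (x : N) (ξ : TangentSpace I x →ₗ[ℝ] ℝ) :
    ∃ φ : C^∞⟮I, N; 𝓘(ℝ, ℝ), ℝ⟯, dR I φ x = ξ ∧ φ x = 0 := by
  let ξ' : E →L[ℝ] ℝ := LinearMap.toContinuousLinearMap (E := E) ξ
  obtain ⟨ψ, hψ⟩ := exists_function_eventuallyEq (I := I) (x := x)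
    (φ := fun y => ξ' (extChartAt I x y) - ξ' (extChartAt I x x)) (by
      filter_upwards [eventually_contMDiffAt_extChartAt (I := I) x] with y hy
      exact (ξ'.contMDiff.contMDiffAt.comp y hy).sub contMDiffAt_const)
  refine ⟨ψ, ?_, by simpa using hψ.self_of_nhds⟩
  ext v
  have h1 := (eventually_contMDiffAt_extChartAt (I := I) x).self_of_nhds.mdifferentiableAt
    (by simp)
  have h2 : MDifferentiableAt I 𝓘(ℝ, ℝ) (fun y => ξ' (extChartAt I x y)) x :=
    ξ'.mdifferentiableAt.comp x h1
  rw [dR_congr hψ, dR_sub h2 mdifferentiableAt_const, dR_const, LinearMap.zero_apply, sub_zero,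
    dR_comp (f := ξ') ξ'.mdifferentiableAt h1]
  have h3 := mfderiv_extChartAt_self (I := I) (x := x)
  unfold dR
  rw [h3, ξ'.mfderiv_eq]
  rfl

lemma eq_zero_of_dR_eq_zero {x : N} {v : TangentSpace I x}
    (h : ∀ φ : C^∞⟮I, N; 𝓘(ℝ, ℝ), ℝ⟯, dR I φ x v = 0) : v = 0 := by
  refine (Module.forall_dual_apply_eq_zero_iff ℝ v).1 fun ξ => ?_
  obtain ⟨φ, hφ, -⟩ := exists_dR_eq x ξ
  rw [← hφ, h]

lemma eq_of_dR_eq {x : N} {v w : TangentSpace I x}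
    (h : ∀ φ : C^∞⟮I, N; 𝓘(ℝ, ℝ), ℝ⟯, dR I φ x v = dR I φ x w) : v = w :=
  sub_eq_zero.1 (eq_zero_of_dR_eq_zero fun φ => by rw [map_sub, h, sub_self])

/-- On a manifold without boundary the bracket of vector fields is the commutator of derivations:
`[V, W] f = V (W f) - W (V f)`. -/
lemma dR_mlieBracket [I.Boundaryless] (V W : Cₛ^∞⟮I; E, (TangentSpace I : N → Type _)⟯)
    (f : C^∞⟮I, N; 𝓘(ℝ, ℝ), ℝ⟯) (x : N) :
    dR I f x (VectorField.mlieBracket I V W x) =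
      dR I (lieD W f) x (V x) - dR I (lieD V f) x (W x) := by
  set φ := extChartAt I x with hφ
  have hr : range I = univ := I.range_eq_univ
  have hopen : IsOpen φ.target := isOpen_extChartAt_target x
  have hxt : φ x ∈ φ.target := mem_extChartAt_target x
  have hsymm : φ.symm (φ x) = x := extChartAt_to_inv x
  -- the derivative of a function in terms of its expression in the chart
  have hchart (g : C^∞⟮I, N; 𝓘(ℝ, ℝ), ℝ⟯) {z : E} (hz : z ∈ φ.target)
      (X : ∀ y, TangentSpace I y) :
      dR I g (φ.symm z) (X (φ.symm z)) = fderiv ℝ (g ∘ φ.symm) z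
        (VectorField.mpullbackWithin 𝓘(ℝ, E) I φ.symm X (range I) z) := by
    have h1 : MDifferentiableAt 𝓘(ℝ, E) I φ.symm z :=
      (mdifferentiableWithinAt_extChartAt_symm hz).mdifferentiableAt (by simp [hr])
    have h2 := isInvertible_mfderivWithin_extChartAt_symm (I := I) hz
    rw [← mfderiv_eq_fderiv, mfderiv_comp z (g.mdiffAt _) h1, VectorField.mpullbackWithin_apply]
    have h3 : mfderiv 𝓘(ℝ, E) I φ.symm z
        ((mfderivWithin 𝓘(ℝ, E) I φ.symm (range I) z).inverse (X (φ.symm z))) =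
        X (φ.symm z) := by
      rw [← mfderivWithin_univ, ← hr]
      exact h2.self_apply_inverse _
    exact (congrArg (mfderiv I 𝓘(ℝ, ℝ) g (φ.symm z)) h3).symm
  have hchart_x (g : C^∞⟮I, N; 𝓘(ℝ, ℝ), ℝ⟯) (u : TangentSpace I x) :
      dR I g x u = fderiv ℝ (g ∘ φ.symm) (φ x) u := by
    have h1 : MDifferentiableAt I 𝓘(ℝ, E) φ x :=
      mdifferentiableAt_extChartAt (mem_chart_source H x)
    have h2 : DifferentiableAt ℝ (g ∘ φ.symm) (φ x) :=
      ((g.mdiffAt _).comp (φ x) ((mdifferentiableWithinAt_extChartAt_symm hxt).mdifferentiableAt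
        (by simp [hr]))).differentiableAt
    have h3 : ∀ᶠ y in 𝓝 x, g y = (g ∘ φ.symm) (φ y) := by
      filter_upwards [extChartAt_source_mem_nhds (I := I) x] with y hy
      exact (congrArg g (φ.left_inv hy)).symm
    rw [dR_congr h3, dR_comp h2.mdifferentiableAt h1, mfderiv_extChartAt_self]
    unfold dR
    rw [mfderiv_eq_fderiv]
    rfl
  have : CompleteSpace E := FiniteDimensional.complete ℝ E
  let P (X : Cₛ^∞⟮I; E, (TangentSpace I : N → Type _)⟯) : E → E := fun z =>
    VectorField.mpullbackWithin 𝓘(ℝ, E) I φ.symm X (range I) z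
  let f' : E → ℝ := f ∘ φ.symm
  have hf' : ContDiffAt ℝ ∞ f' (φ x) := by
    have h1 : ContMDiffAt 𝓘(ℝ, E) I ∞ φ.symm (φ x) :=
      (contMDiffOn_extChartAt_symm x).contMDiffAt (hopen.mem_nhds hxt)
    exact (f.contMDiff.contMDiffAt.comp (φ x) h1).contDiffAt
  have hdiff (X : Cₛ^∞⟮I; E, (TangentSpace I : N → Type _)⟯) :
      DifferentiableAt ℝ (P X) (φ x) := by
    have h : DifferentiableWithinAt ℝ (P X) (φ.symm ⁻¹' univ ∩ range I) (φ x) :=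
      (X.mdifferentiableAt (x := x)).mdifferentiableWithinAt (s := univ)
        |>.differentiableWithinAt_mpullbackWithin_vectorField
    rwa [preimage_univ, univ_inter, hr, differentiableWithinAt_univ] at h
  have hsecond (X Y : Cₛ^∞⟮I; E, (TangentSpace I : N → Type _)⟯) :
      dR I (lieD Y f) x (X x) = fderiv ℝ (fderiv ℝ f') (φ x) (P X (φ x)) (P Y (φ x)) +
        fderiv ℝ f' (φ x) (fderiv ℝ (P Y) (φ x) (P X (φ x))) := by
    have h1 := hchart (lieD Y f) hxt X
    rw [hsymm] at h1
    have h2 : (lieD Y f) ∘ φ.symm =ᶠ[𝓝 (φ x)] fun z => fderiv ℝ f' z (P Y z) := by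
      filter_upwards [hopen.mem_nhds hxt] with z hz
      exact hchart f hz Y
    have h3 : DifferentiableAt ℝ (fderiv ℝ f') (φ x) :=
      (hf'.fderiv_right (m := 1) (by norm_cast)).differentiableAt (by simp)
    have h4 : fderiv ℝ ((lieD Y f) ∘ φ.symm) (φ x) (P X (φ x)) =
        fderiv ℝ (fun z => fderiv ℝ f' z (P Y z)) (φ x) (P X (φ x)) := by
      rw [h2.fderiv_eq]
    have h5 := congrArg (fun T => T (P X (φ x))) (fderiv_clm_apply h3 (hdiff Y))
    exact h1.trans (h4.trans (h5.trans (add_comm _ _)))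
  -- the second derivatives of `f` cancel in the commutator
  have hsymm2 : fderiv ℝ (fderiv ℝ f') (φ x) (P V (φ x)) (P W (φ x)) =
      fderiv ℝ (fderiv ℝ f') (φ x) (P W (φ x)) (P V (φ x)) :=
    (hf'.isSymmSndFDerivAt (by rw [minSmoothness_of_isRCLikeNormedField]; norm_cast)).eq _ _
  have hinv (u : TangentSpace I x) : (mfderiv I 𝓘(ℝ, E) φ x).inverse u = u := by
    have h0 : mfderiv I 𝓘(ℝ, E) φ x u = u :=
      congrArg (fun T : TangentSpace I x →L[ℝ] TangentSpace I x => T u)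
        (mfderiv_extChartAt_self (I := I) (x := x))
    have h1 := (isInvertible_mfderiv_extChartAt (I := I)
      (mem_extChartAt_source (I := I) x)).inverse_apply_self u
    exact (congrArg (mfderiv I 𝓘(ℝ, E) φ x).inverse h0).symm.trans h1
  -- the chart at `x` has derivative the identity at `x`
  have hbr : VectorField.mlieBracket I V W x =
      fderiv ℝ (P W) (φ x) (P V (φ x)) - fderiv ℝ (P V) (φ x) (P W (φ x)) := by
    refine Eq.trans ?_ (hinv (fderiv ℝ (P W) (φ x) (P V (φ x)) -
      fderiv ℝ (P V) (φ x) (P W (φ x)) : E))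
    have h1 : VectorField.lieBracketWithin ℝ (P V) (P W) (φ.symm ⁻¹' univ ∩ range I) (φ x) =
      fderiv ℝ (P W) (φ x) (P V (φ x)) - fderiv ℝ (P V) (φ x) (P W (φ x)) := by
      rw [preimage_univ, univ_inter, hr, VectorField.lieBracketWithin_univ]
      rfl
    rw [← h1]
    rfl
  have h5 : fderiv ℝ f' (φ x) (VectorField.mlieBracket I V W x) =
      fderiv ℝ f' (φ x) (fderiv ℝ (P W) (φ x) (P V (φ x))) -
        fderiv ℝ f' (φ x) (fderiv ℝ (P V) (φ x) (P W (φ x))) := by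
    rw [hbr]
    exact map_sub (fderiv ℝ f' (φ x)) _ _
  rw [hsecond V W, hsecond W V, hchart_x]
  linarith [hsymm2, h5]

end Differential

/-! ### Local frames -/

section Frames

variable {E : Type*} [NormedAddCommGroup E] [NormedSpace ℝ E] [FiniteDimensional ℝ E]
  {H : Type*} [TopologicalSpace H]
  {N : Type*} [TopologicalSpace N] [T2Space N] [ChartedSpace H N] {I : ModelWithCorners ℝ E H}
  [IsManifold I ∞ N]
  {F : Type*} [NormedAddCommGroup F] [NormedSpace ℝ F] [FiniteDimensional ℝ F]
  {B : N → Type*} [∀ m, AddCommGroup (B m)] [∀ m, Module ℝ (B m)]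
  [TopologicalSpace (TotalSpace F B)] [∀ m, TopologicalSpace (B m)] [FiberBundle F B]
  [VectorBundle ℝ F B] [ContMDiffVectorBundle ∞ F B I]

lemma eventually_contMDiffAt_bcoord (x : N) (s : Cₛ^∞⟮I; F, B⟯) :
    ∀ᶠ y in 𝓝 x, ContMDiffAt I 𝓘(ℝ, F) ∞ (fun y => bcoord F x y (s y)) y := by
  filter_upwards [eventually_mem_baseSet (F := F) (B := B) x] with y hy
  exact (contMDiffAt_section_iff_bcoord hy _).1 (s.contMDiff y)

/-- A section that is pointwise in the span of sections which are linearly independent at `x` is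
near `x` a combination of these with smooth coefficients. -/
lemma exists_coeff {k : ℕ} {e : Fin k → Cₛ^∞⟮I; F, B⟯} {x : N}
    (li : LinearIndependent ℝ (fun i => e i x)) (s : Cₛ^∞⟮I; F, B⟯)
    (hs : ∀ᶠ y in 𝓝 x, s y ∈ Submodule.span ℝ (range (fun i => e i y))) :
    ∃ φ : Fin k → C^∞⟮I, N; 𝓘(ℝ, ℝ), ℝ⟯, ∀ᶠ y in 𝓝 x, s y = ∑ i, φ i y • e i y := by
  classical
  have h1 : ∀ y, ∃ c : Fin k → ℝ, s y ∈ Submodule.span ℝ (range (fun i => e i y)) →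
      ∑ i, c i • e i y = s y := fun y => by
    by_cases h : s y ∈ Submodule.span ℝ (range (fun i => e i y))
    · obtain ⟨c, hc⟩ := (Submodule.mem_span_range_iff_exists_fun ℝ).1 h
      exact ⟨c, fun _ => hc⟩
    · exact ⟨0, fun h' => absurd h' h⟩
  choose c hc using h1
  -- in the trivialization, the combinations of the `e i` depend injectively on the coefficients
  let L : N → (Fin k → ℝ) →ₗ[ℝ] F := fun y =>
    Fintype.linearCombination ℝ (fun i => bcoord F x y (e i y))
  have hL (y : N) (w : Fin k → ℝ) : L y w = ∑ i, w i • bcoord F x y (e i y) :=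
    Fintype.linearCombination_apply ..
  have hcs := eventually_contMDiffAt_of_injective (I := I) (L := L) (x := x) (c := c)
    (fun w => by
      filter_upwards [Filter.eventually_all.2
        (fun i => eventually_contMDiffAt_bcoord (I := I) x (e i))] with y hy
      simp only [hL]
      have h2 (i) : ContMDiffAt I 𝓘(ℝ, F) ∞ (fun y => w i • bcoord F x y (e i y)) y := by
        have h3 : ContMDiffAt I 𝓘(ℝ, ℝ) ∞ (fun _ : N => w i) y := contMDiffAt_const
        exact h3.smul (hy i)
      exact contMDiffAt_finsetSum fun i _ => h2 i)
    (by
      rw [← LinearMap.ker_eq_bot, LinearMap.ker_eq_bot']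
      intro w hw
      have h2 : bcoord F x x (∑ i, w i • e i x) = 0 := by
        rw [map_sum, ← hw, hL]
        simp
      have h3 : ∑ i, w i • e i x = 0 := by
        rw [← bsymm_bcoord_self (F := F) x (∑ i, w i • e i x), h2, map_zero]
      exact funext (Fintype.linearIndependent_iff.1 li w h3))
    (by
      filter_upwards [eventually_contMDiffAt_bcoord (I := I) x s, hs.eventually_nhds] with y hy hy'
      refine hy.congr_of_eventuallyEq ?_
      filter_upwards [hy'] with z hz
      rw [hL, ← hc z hz, map_sum]
      simp)
  have h4 (i : Fin k) := exists_function_eventuallyEq (I := I) (x := x) (φ := fun y => c y i) (by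
    filter_upwards [hcs] with y hy
    exact contMDiffAt_pi_space.1 hy i)
  choose φ hφ using h4
  refine ⟨φ, ?_⟩
  filter_upwards [hs, Filter.eventually_all.2 hφ] with y hy hy'
  simp only [hy', hc y hy]

/-- Sections satisfying a property that is stable under sums and products with functions, and
is detected by cutting off near `x`: it holds for all sections that are combinations near `x` of
finitely many ones that satisfy it and are linearly independent at `x`. -/
lemma section_induction {P : Cₛ^∞⟮I; F, B⟯ → Prop} {x : N} (zero : P 0)
    (add : ∀ s t, P s → P t → P (s + t))
    (smul : ∀ (φ : C^∞⟮I, N; 𝓘(ℝ, ℝ), ℝ⟯) s, P s → P (fsmul φ s))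
    (cut : ∀ (ρ : C^∞⟮I, N; 𝓘(ℝ, ℝ), ℝ⟯) s, (∀ᶠ y in 𝓝 x, ρ y = 1) → P (fsmul ρ s) → P s)
    {k : ℕ} {e : Fin k → Cₛ^∞⟮I; F, B⟯} (li : LinearIndependent ℝ (fun i => e i x))
    (he : ∀ i, P (e i)) (s : Cₛ^∞⟮I; F, B⟯)
    (hs : ∀ᶠ y in 𝓝 x, s y ∈ Submodule.span ℝ (range (fun i => e i y))) : P s := by
  obtain ⟨φ, hφ⟩ := exists_coeff li s hs
  obtain ⟨ρ, hρ1, hρ⟩ := exists_bump (I := I) hφ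
  have hsum (T : Finset (Fin k)) : P (∑ i ∈ T, fsmul (φ i) (e i)) := by
    induction T using Finset.cons_induction with
    | empty => simpa using zero
    | cons i T hi ih =>
      rw [Finset.sum_cons]
      exact add _ _ (smul _ _ (he i)) ih
  refine cut ρ s hρ1 ?_
  convert smul ρ _ (hsum Finset.univ) using 1
  ext y
  by_cases hy : y ∈ tsupport ρ
  · have hsy : (∑ i, fsmul (φ i) (e i)) y = ∑ i, φ i y • e i y := by
      refine (congrFun (map_sum (ContMDiffSection.coeAddHom I F ∞ B)
        (fun i => fsmul (φ i) (e i)) Finset.univ) y).trans ?_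
      rw [Finset.sum_apply]
      rfl
    rw [fsmul_apply, fsmul_apply, hsy, ← hρ hy]
  · rw [fsmul_apply, fsmul_apply, image_eq_zero_of_notMem_tsupport hy, zero_smul, zero_smul]

/-- `e` is a frame at `x`: linearly independent at `x` and spanning all fibres near `x`. -/
structure IsFrameAt {k : ℕ} (e : Fin k → Cₛ^∞⟮I; F, B⟯) (x : N) : Prop where
  linearIndependent : LinearIndependent ℝ (fun i => e i x)
  span : ∀ᶠ y in 𝓝 x, Submodule.span ℝ (range (fun i => e i y)) = ⊤

variable (I F B) in
/-- The frame near `x` given by the distinguished trivialization around `x`. -/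
def stdFrame (x : N) (i : Fin (Module.finrank ℝ F)) : Cₛ^∞⟮I; F, B⟯ :=
  extF I F B x (Module.finBasis ℝ F i)

lemma isFrameAt_stdFrame (x : N) : IsFrameAt (stdFrame I F B x) x := by
  constructor
  · rw [Fintype.linearIndependent_iff]
    intro g hg
    have h1 : extF I F B x (∑ i, g i • Module.finBasis ℝ F i) x = 0 := by
      rw [(extF_eventually x).self_of_nhds, map_sum, ← hg]
      refine Finset.sum_congr rfl fun i _ => ?_
      rw [stdFrame, (extF_eventually x).self_of_nhds, map_smul]
    exact Fintype.linearIndependent_iff.1 (Module.finBasis ℝ F).linearIndependent g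
      (extF_injective x h1)
  · filter_upwards [extF_bcoord (I := I) (F := F) (B := B) x,
      extF_eventually (I := I) (F := F) (B := B) x] with y hy hy'
    rw [eq_top_iff]
    rintro v -
    rw [← hy v, hy', ← (Module.finBasis ℝ F).sum_repr (bcoord F x y v), map_sum]
    refine Submodule.sum_mem _ fun i _ => ?_
    rw [map_smul, ← hy']
    exact Submodule.smul_mem _ _ (Submodule.subset_span ⟨i, rfl⟩)

lemma stdFrame_eq_extB (x : N) (i : Fin (Module.finrank ℝ F)) :
    stdFrame I F B x i = extB I F x (bsymm F x x (Module.finBasis ℝ F i)) := by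
  rw [extB, LinearMap.comp_apply, bcoord_bsymm_self, stdFrame]

/-- A section whose products with all smooth sections for a smooth nondegenerate fibre metric are
smooth is itself smooth. -/
lemma contMDiffAt_of_metric {g : ∀ m, LinearMap.BilinForm ℝ (B m)} {x : N}
    (hnd : ∀ v, (∀ w, g x v w = 0) → v = 0)
    (hg : ∀ σ τ : Cₛ^∞⟮I; F, B⟯, ContMDiff I 𝓘(ℝ, ℝ) ∞ (fun m => g m (σ m) (τ m)))
    {v : ∀ y, B y} (hv : ∀ τ : Cₛ^∞⟮I; F, B⟯,
      ∀ᶠ y in 𝓝 x, ContMDiffAt I 𝓘(ℝ, ℝ) ∞ (fun m => g m (v m) (τ m)) y) :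
    ContMDiffAt I (I.prod 𝓘(ℝ, F)) ∞ (fun y => TotalSpace.mk' F y (v y)) x := by
  have hx : x ∈ (trivializationAt F B x).baseSet := FiberBundle.mem_baseSet_trivializationAt' x
  rw [contMDiffAt_section_iff_bcoord hx]
  let e := stdFrame I F B x
  let evx (y : N) : F →ₗ[ℝ] B y :=
    { toFun := fun w => extF I F B x w y
      map_add' := fun v w => by rw [map_add]; rfl
      map_smul' := fun c w => by rw [map_smul]; rfl }
  -- the products with a local frame, as functions of the coordinate
  let L : N → F →ₗ[ℝ] (Fin (Module.finrank ℝ F) → ℝ) := fun y =>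
    LinearMap.pi fun i => ((g y).flip (e i y)).comp (evx y)
  have hL (y : N) (w : F) (i) : L y w i = g y (extF I F B x w y) (e i y) := rfl
  refine (eventually_contMDiffAt_of_injective (I := I) (L := L) (fun w => ?_) ?_ ?_).self_of_nhds
  · refine Filter.Eventually.of_forall fun y => contMDiffAt_pi_space.2 fun i => ?_
    exact (hg (extF I F B x w) (e i)) y
  · rw [← LinearMap.ker_eq_bot, LinearMap.ker_eq_bot']
    intro w hw
    refine extF_injective (I := I) (B := B) x (hnd _ fun u => ?_)
    have hu : u ∈ Submodule.span ℝ (range (fun i => e i x)) := by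
      rw [(isFrameAt_stdFrame x).span.self_of_nhds]; trivial
    induction hu using Submodule.span_induction with
    | mem u hu => obtain ⟨i, rfl⟩ := hu; exact congrFun hw i
    | zero => simp
    | add a b _ _ ha hb => rw [map_add, ha, hb, add_zero]
    | smul c a _ ha => rw [map_smul, ha, smul_zero]
  · filter_upwards [Filter.eventually_all.2 (fun i => hv (e i)),
      (extF_bcoord (I := I) (F := F) (B := B) x).eventually_nhds] with y hy hy'
    refine contMDiffAt_pi_space.2 fun i => (hy i).congr_of_eventuallyEq ?_
    filter_upwards [hy'] with z hz
    rw [hL, hz]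

/-- A vector field is smooth if its derivatives of finitely many functions are smooth whose
differentials span the cotangent space. -/
lemma contMDiffAt_vectorField {k : ℕ} {φ : Fin k → C^∞⟮I, N; 𝓘(ℝ, ℝ), ℝ⟯} {x : N}
    (hinj : ∀ v : TangentSpace I x, (∀ i, dR I (φ i) x v = 0) → v = 0)
    {Z : ∀ y, TangentSpace I y}
    (hZ : ∀ i, ∀ᶠ y in 𝓝 x, ContMDiffAt I 𝓘(ℝ, ℝ) ∞ (fun m => dR I (φ i) m (Z m)) y) :
    ContMDiffAt I (I.prod 𝓘(ℝ, E)) ∞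
      (fun y => TotalSpace.mk' E y (Z y : (TangentSpace I : N → Type _) y)) x := by
  have hx : x ∈ (trivializationAt E (TangentSpace I : N → Type _) x).baseSet :=
    FiberBundle.mem_baseSet_trivializationAt' x
  rw [contMDiffAt_section_iff_bcoord hx]
  let X := extF I E (TangentSpace I : N → Type _) x
  let evx (y : N) : E →ₗ[ℝ] TangentSpace I y :=
    { toFun := fun w => X w y
      map_add' := fun v w => by rw [map_add]; rfl
      map_smul' := fun c w => by rw [map_smul]; rfl }
  let L : N → E →ₗ[ℝ] (Fin k → ℝ) := fun y => LinearMap.pi fun i => (dR I (φ i) y).comp (evx y)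
  have hL (y : N) (w : E) (i) : L y w i = dR I (φ i) y (X w y) := rfl
  refine (eventually_contMDiffAt_of_injective (I := I) (L := L) (fun w => ?_) ?_ ?_).self_of_nhds
  · refine Filter.Eventually.of_forall fun y => contMDiffAt_pi_space.2 fun i => ?_
    exact (lieD (X w) (φ i)).contMDiff y
  · rw [← LinearMap.ker_eq_bot, LinearMap.ker_eq_bot']
    intro w hw
    exact extF_injective (I := I) (B := (TangentSpace I : N → Type _)) x
      (hinj _ fun i => congrFun hw i)
  · filter_upwards [Filter.eventually_all.2 hZ,
      (extF_bcoord (I := I) (F := E) (B := (TangentSpace I : N → Type _)) x).eventually_nhds]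
      with y hy hy'
    refine contMDiffAt_pi_space.2 fun i => (hy i).congr_of_eventuallyEq ?_
    filter_upwards [hy'] with z hz
    rw [hL, show X _ z = Z z from hz (Z z)]

/-- To check the smoothness of a vector field it suffices to differentiate a set of functions whose
differentials separate tangent vectors. -/
lemma contMDiffAt_vectorField_of_separating {𝓕 : Set C^∞⟮I, N; 𝓘(ℝ, ℝ), ℝ⟯} {x : N}
    (hsep : ∀ v : TangentSpace I x, (∀ φ ∈ 𝓕, dR I φ x v = 0) → v = 0)
    {Z : ∀ y, TangentSpace I y}
    (hZ : ∀ φ ∈ 𝓕, ∀ᶠ y in 𝓝 x, ContMDiffAt I 𝓘(ℝ, ℝ) ∞ (fun m => dR I φ m (Z m)) y) :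
    ContMDiffAt I (I.prod 𝓘(ℝ, E)) ∞
      (fun y => TotalSpace.mk' E y (Z y : (TangentSpace I : N → Type _) y)) x := by
  have : FiniteDimensional ℝ (TangentSpace I x) := inferInstanceAs (FiniteDimensional ℝ E)
  obtain ⟨ξ, hξ, hspan, -⟩ := Submodule.exists_fun_fin_finrank_span_eq ℝ
    ((fun φ : C^∞⟮I, N; 𝓘(ℝ, ℝ), ℝ⟯ => dR I φ x) '' 𝓕)
  choose φ hφ hφξ using hξ
  refine contMDiffAt_vectorField (φ := φ) (fun v hv => hsep v fun ψ hψ => ?_) fun i => hZ _ (hφ i)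
  have h1 : dR I ψ x ∈ Submodule.span ℝ (range ξ) := by
    rw [hspan]; exact Submodule.subset_span (mem_image_of_mem _ hψ)
  have h2 : Submodule.span ℝ (range ξ) ≤ LinearMap.ker (Module.Dual.eval ℝ _ v) := by
    rw [Submodule.span_le]
    rintro _ ⟨i, rfl⟩
    rw [← hφξ i]
    exact hv i
  exact h2 h1

/-- A bundle map to the tangent bundle is smooth if it takes the members of local frames to smooth
vector fields. -/
lemma contMDiff_bundleMap {b : ∀ y, B y →ₗ[ℝ] TangentSpace I y}
    (h : ∀ x, ∃ (k : ℕ) (e : Fin k → Cₛ^∞⟮I; F, B⟯), IsFrameAt e x ∧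
      ∀ i, ContMDiff I I.tangent ∞ (fun y => (⟨y, b y (e i y)⟩ : TangentBundle I N))) :
    ContMDiff (I.prod 𝓘(ℝ, F)) I.tangent ∞
      (fun v : TotalSpace F B => (⟨v.proj, b v.proj v.snd⟩ : TangentBundle I N)) := by
  have hsec (s : Cₛ^∞⟮I; F, B⟯) :
      ContMDiff I I.tangent ∞ (fun y => (⟨y, b y (s y)⟩ : TangentBundle I N)) := by
    intro x
    obtain ⟨k, e, he, hb⟩ := h x
    refine section_induction (x := x) (P := fun s => ContMDiffAt I I.tangent ∞
      (fun y => (⟨y, b y (s y)⟩ : TangentBundle I N)) x) ?_ ?_ ?_ ?_ he.linearIndependent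
      (fun i => hb i x) s ?_
    · have h0 := (0 : Cₛ^∞⟮I; E, (TangentSpace I : N → Type _)⟯).contMDiff x
      convert h0 using 3 with y
      exact map_zero (b y)
    · intro s t hs ht
      have h0 := hs.add_section ht
      convert h0 using 3 with y
      exact map_add (b y) _ _
    · intro φ s hs
      have h0 := (φ.contMDiff x).smul_section hs
      convert h0 using 3 with y
      exact map_smul (b y) _ _
    · intro ρ s hρ hs
      refine hs.congr_of_eventuallyEq ?_
      filter_upwards [hρ] with y hy
      simp [hy]
    · filter_upwards [he.span] with y hy
      rw [hy]; trivial
  -- in trivializations, `b v` is the combination of the vectors `b (e i)`, for the frame `e` of the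
  -- trivialization, with the coordinates of `v` as coefficients
  intro v₀
  set x := v₀.proj with hx
  refine (contMDiffAt_totalSpace).2 ⟨contMDiff_proj B v₀, ?_⟩
  change ContMDiffAt (I.prod 𝓘(ℝ, F)) 𝓘(ℝ, E) ∞ (fun v : TotalSpace F B =>
    (trivializationAt E (TangentSpace I : N → Type _) x ⟨v.proj, b v.proj v.snd⟩).2) v₀
  have hcoord : ContMDiffAt (I.prod 𝓘(ℝ, F)) 𝓘(ℝ, F) ∞
      (fun v : TotalSpace F B => (trivializationAt F B x v).2) v₀ :=
    (contMDiffAt_totalSpace.1 (contMDiffAt_id (x := v₀))).2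
  have hmem : ∀ᶠ v : TotalSpace F B in 𝓝 v₀, v.proj ∈ (trivializationAt F B x).baseSet ∧
      v.proj ∈ (trivializationAt E (TangentSpace I : N → Type _) x).baseSet ∧
      ∀ w : B v.proj, extF I F B x (bcoord F x v.proj w) v.proj = w :=
    (FiberBundle.continuous_proj F B).continuousAt.eventually
      ((eventually_mem_baseSet (F := F) (B := B) x).and
      ((eventually_mem_baseSet (F := E) (B := (TangentSpace I : N → Type _)) x).and
      (extF_bcoord (I := I) (F := F) (B := B) x)))
  have hfr (i) : ContMDiffAt (I.prod 𝓘(ℝ, F)) 𝓘(ℝ, E) ∞ (fun v : TotalSpace F B =>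
      bcoord E x v.proj (b v.proj (stdFrame I F B x i v.proj) : TangentSpace I v.proj)) v₀ := by
    have h1 := (contMDiffAt_section_iff_bcoord
      (FiberBundle.mem_baseSet_trivializationAt' (F := E) (E := (TangentSpace I : N → Type _)) x)
      (fun y => b y (stdFrame I F B x i y))).1 (hsec (stdFrame I F B x i) x)
    exact h1.comp v₀ (contMDiff_proj B v₀)
  have hsum : ContMDiffAt (I.prod 𝓘(ℝ, F)) 𝓘(ℝ, E) ∞ (fun v : TotalSpace F B =>
      ∑ i, (Module.finBasis ℝ F).coord i (trivializationAt F B x v).2 •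
        bcoord E x v.proj (b v.proj (stdFrame I F B x i v.proj) : TangentSpace I v.proj)) v₀ := by
    have h1 (i) : ContMDiffAt (I.prod 𝓘(ℝ, F)) 𝓘(ℝ, ℝ) ∞ (fun v : TotalSpace F B =>
        (Module.finBasis ℝ F).coord i (trivializationAt F B x v).2) v₀ :=
      ((LinearMap.toContinuousLinearMap
        ((Module.finBasis ℝ F).coord i)).contMDiff.contMDiffAt).comp v₀ hcoord
    exact contMDiffAt_finsetSum fun i _ => (h1 i).smul (hfr i)
  refine hsum.congr_of_eventuallyEq ?_
  filter_upwards [hmem] with v hv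
  have h1 : (trivializationAt F B x v).2 = bcoord F x v.proj v.snd := by
    simp [bcoord, Trivialization.linearMapAt_apply, hv.1]
  have h2 : (trivializationAt E (TangentSpace I : N → Type _) x
      ⟨v.proj, b v.proj v.snd⟩).2 = bcoord E x v.proj (b v.proj v.snd) := by
    simp only [bcoord, Trivialization.linearMapAt_apply, if_pos hv.2.1]
  have h3 : v.snd = ∑ i, (Module.finBasis ℝ F).coord i (bcoord F x v.proj v.snd) •
      stdFrame I F B x i v.proj := by
    conv_lhs => rw [← hv.2.2 v.snd, ← (Module.finBasis ℝ F).sum_repr (bcoord F x v.proj v.snd),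
      map_sum]
    refine (congrFun (map_sum (ContMDiffSection.coeAddHom I F ∞ B) _ Finset.univ)
      v.proj).trans ?_
    rw [Finset.sum_apply]
    refine Finset.sum_congr rfl fun i _ => ?_
    rw [map_smul]
    rfl
  rw [h2, h1]
  conv_lhs => rw [h3]
  rw [map_sum, map_sum]
  refine Finset.sum_congr rfl fun i _ => ?_
  rw [map_smul, map_smul]

end Frames

/-! ### Brackets satisfying the Leibniz rules -/

section PreCourant

variable {E : Type*} [NormedAddCommGroup E] [NormedSpace ℝ E] [FiniteDimensional ℝ E]
  {H : Type*} [TopologicalSpace H]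
  {N : Type*} [TopologicalSpace N] [T2Space N] [ChartedSpace H N] {I : ModelWithCorners ℝ E H}
  [IsManifold I ∞ N]
  {F : Type*} [NormedAddCommGroup F] [NormedSpace ℝ F] [FiniteDimensional ℝ F]
  {B : N → Type*} [∀ m, AddCommGroup (B m)] [∀ m, Module ℝ (B m)]
  [TopologicalSpace (TotalSpace F B)] [∀ m, TopologicalSpace (B m)] [FiberBundle F B]
  [VectorBundle ℝ F B] [ContMDiffVectorBundle ∞ F B I]

/-- The sections in `𝒢` contain a frame at every point. -/
def HasFrames (𝒢 : Set (Cₛ^∞⟮I; F, B⟯)) : Prop :=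
  ∀ x, ∃ (k : ℕ) (e : Fin k → Cₛ^∞⟮I; F, B⟯), IsFrameAt e x ∧ ∀ i, e i ∈ 𝒢

variable (I F B) in
lemma hasFrames_univ : HasFrames (univ : Set (Cₛ^∞⟮I; F, B⟯)) := fun x =>
  ⟨_, stdFrame I F B x, isFrameAt_stdFrame x, fun _ => mem_univ _⟩

lemma IsFrameAt.induction {x : N} {k : ℕ} {e : Fin k → Cₛ^∞⟮I; F, B⟯} (he : IsFrameAt e x)
    {P : Cₛ^∞⟮I; F, B⟯ → Prop} (zero : P 0) (add : ∀ s t, P s → P t → P (s + t))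
    (smul : ∀ (φ : C^∞⟮I, N; 𝓘(ℝ, ℝ), ℝ⟯) s, P s → P (fsmul φ s))
    (cut : ∀ (ρ : C^∞⟮I, N; 𝓘(ℝ, ℝ), ℝ⟯) s, (∀ᶠ y in 𝓝 x, ρ y = 1) → P (fsmul ρ s) → P s)
    (gen : ∀ i, P (e i)) (s : Cₛ^∞⟮I; F, B⟯) : P s := by
  refine section_induction zero add smul cut he.linearIndependent gen s ?_
  filter_upwards [he.span] with y hy
  rw [hy]; trivial

/-- A `C^∞(N)`-linear expression in a section, evaluated at `x`, vanishes if it does so for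
the members of a frame at `x`. -/
lemma IsFrameAt.tensor_eq_zero {x : N} {k : ℕ} {e : Fin k → Cₛ^∞⟮I; F, B⟯} (he : IsFrameAt e x)
    {W : Type*} [AddCommGroup W] [Module ℝ W] (T : Cₛ^∞⟮I; F, B⟯ → W)
    (add : ∀ s t, T (s + t) = T s + T t)
    (smul : ∀ (φ : C^∞⟮I, N; 𝓘(ℝ, ℝ), ℝ⟯) s, T (fsmul φ s) = φ x • T s)
    (gen : ∀ i, T (e i) = 0) (s : Cₛ^∞⟮I; F, B⟯) : T s = 0 := by
  refine he.induction (P := fun s => T s = 0) ?_ ?_ ?_ ?_ gen s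
  · have h := add 0 0
    rw [add_zero] at h
    simpa using h
  · intro s t hs ht; rw [add, hs, ht, add_zero]
  · intro φ s hs; rw [smul, hs, smul_zero]
  · intro ρ s hρ hs
    rwa [smul, hρ.self_of_nhds, one_smul] at hs

lemma HasFrames.tensor_eq_zero {𝒢 : Set (Cₛ^∞⟮I; F, B⟯)} (h𝒢 : HasFrames 𝒢) (x : N)
    {W : Type*} [AddCommGroup W] [Module ℝ W] (T : Cₛ^∞⟮I; F, B⟯ → W)
    (add : ∀ s t, T (s + t) = T s + T t)
    (smul : ∀ (φ : C^∞⟮I, N; 𝓘(ℝ, ℝ), ℝ⟯) s, T (fsmul φ s) = φ x • T s)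
    (gen : ∀ s ∈ 𝒢, T s = 0) (s : Cₛ^∞⟮I; F, B⟯) : T s = 0 := by
  obtain ⟨k, e, he, heG⟩ := h𝒢 x
  exact he.tensor_eq_zero T add smul (fun i => gen _ (heG i)) s

variable (I F B) in
/-- A vector bundle with a fibre metric, an anchor and a bracket on its sections that satisfies the
two Leibniz rules of a Courant algebroid (but not necessarily the axioms of one). -/
structure PreCourant where
  /-- The fibre metrics. -/
  metric : ∀ m, LinearMap.BilinForm ℝ (B m)
  /-- The anchor. -/
  anchor : ∀ m, B m →ₗ[ℝ] TangentSpace I m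
  /-- The bracket. -/
  bracket : Cₛ^∞⟮I; F, B⟯ →ₗ[ℝ] Cₛ^∞⟮I; F, B⟯ →ₗ[ℝ] Cₛ^∞⟮I; F, B⟯
  metric_symm : ∀ m v w, metric m v w = metric m w v
  metric_nondegenerate : ∀ m v, (∀ w, metric m v w = 0) → v = 0
  contMDiff_metric : ∀ σ τ : Cₛ^∞⟮I; F, B⟯,
    ContMDiff I 𝓘(ℝ, ℝ) ∞ (fun m => metric m (σ m) (τ m))
  contMDiff_anchor : ContMDiff (I.prod 𝓘(ℝ, F)) I.tangent ∞
    (fun v : TotalSpace F B => (⟨v.proj, anchor v.proj v.snd⟩ : TangentBundle I N))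
  leibniz_right : ∀ (s : Cₛ^∞⟮I; F, B⟯) (φ : C^∞⟮I, N; 𝓘(ℝ, ℝ), ℝ⟯) (t : Cₛ^∞⟮I; F, B⟯) (x : N),
    bracket s (fsmul φ t) x = φ x • bracket s t x + dR I φ x (anchor x (s x)) • t x
  leibniz_left : ∀ (φ : C^∞⟮I, N; 𝓘(ℝ, ℝ), ℝ⟯) (s t : Cₛ^∞⟮I; F, B⟯) (x : N) (u : B x),
    metric x (bracket (fsmul φ s) t x) u = φ x * metric x (bracket s t x) u -
      dR I φ x (anchor x (t x)) * metric x (s x) u + metric x (s x) (t x) * dR I φ x (anchor x u)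

namespace PreCourant

variable (Q : PreCourant I F B)

/-- The vector field `a(s)` of a section `s`. -/
def anchorSec (s : Cₛ^∞⟮I; F, B⟯) : Cₛ^∞⟮I; E, (TangentSpace I : N → Type _)⟯ where
  toFun y := Q.anchor y (s y)
  contMDiff_toFun := Q.contMDiff_anchor.comp s.contMDiff

/-- The function `⟨s, t⟩`. -/
def pair (s t : Cₛ^∞⟮I; F, B⟯) : C^∞⟮I, N; 𝓘(ℝ, ℝ), ℝ⟯ :=
  ⟨fun m => Q.metric m (s m) (t m), Q.contMDiff_metric s t⟩

/-- The function `a(s) φ`. -/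
def act (s : Cₛ^∞⟮I; F, B⟯) (φ : C^∞⟮I, N; 𝓘(ℝ, ℝ), ℝ⟯) : C^∞⟮I, N; 𝓘(ℝ, ℝ), ℝ⟯ :=
  lieD (Q.anchorSec s) φ

@[simp] lemma pair_apply (s t : Cₛ^∞⟮I; F, B⟯) (x : N) :
    Q.pair s t x = Q.metric x (s x) (t x) := rfl

@[simp] lemma act_apply (s : Cₛ^∞⟮I; F, B⟯) (φ : C^∞⟮I, N; 𝓘(ℝ, ℝ), ℝ⟯) (x : N) :
    Q.act s φ x = dR I φ x (Q.anchor x (s x)) := rfl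

lemma metric_ext {x : N} {v w : B x} (h : ∀ u, Q.metric x v u = Q.metric x w u) : v = w := by
  refine sub_eq_zero.1 (Q.metric_nondegenerate x _ fun u => ?_)
  rw [map_sub, LinearMap.sub_apply, h, sub_self]

lemma pair_comm (s t : Cₛ^∞⟮I; F, B⟯) : Q.pair s t = Q.pair t s := by
  ext x; exact Q.metric_symm x _ _

lemma dR_pair_add_left (s s' t : Cₛ^∞⟮I; F, B⟯) (x : N) (v : TangentSpace I x) :
    dR I (Q.pair (s + s') t) x v = dR I (Q.pair s t) x v + dR I (Q.pair s' t) x v := by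
  rw [← dR_add (ContMDiffMap.mdiffAt _ x) (ContMDiffMap.mdiffAt _ x)]
  congr 2
  ext y
  simp

lemma dR_pair_add_right (s t t' : Cₛ^∞⟮I; F, B⟯) (x : N) (v : TangentSpace I x) :
    dR I (Q.pair s (t + t')) x v = dR I (Q.pair s t) x v + dR I (Q.pair s t') x v := by
  simp only [Q.pair_comm s, dR_pair_add_left]

lemma dR_pair_fsmul_left (φ : C^∞⟮I, N; 𝓘(ℝ, ℝ), ℝ⟯) (s t : Cₛ^∞⟮I; F, B⟯) (x : N)
    (v : TangentSpace I x) :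
    dR I (Q.pair (fsmul φ s) t) x v =
      φ x * dR I (Q.pair s t) x v + Q.metric x (s x) (t x) * dR I φ x v := by
  rw [← Q.pair_apply s t, ← dR_mul (ContMDiffMap.mdiffAt _ x) (ContMDiffMap.mdiffAt _ x)]
  congr 2
  ext y
  simp

lemma dR_pair_fsmul_right (φ : C^∞⟮I, N; 𝓘(ℝ, ℝ), ℝ⟯) (s t : Cₛ^∞⟮I; F, B⟯) (x : N)
    (v : TangentSpace I x) :
    dR I (Q.pair s (fsmul φ t)) x v =
      φ x * dR I (Q.pair s t) x v + Q.metric x (s x) (t x) * dR I φ x v := by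
  rw [Q.pair_comm s, dR_pair_fsmul_left, Q.pair_comm t, Q.metric_symm]

lemma dR_act_add (s t : Cₛ^∞⟮I; F, B⟯) (φ : C^∞⟮I, N; 𝓘(ℝ, ℝ), ℝ⟯) (x : N)
    (v : TangentSpace I x) :
    dR I (Q.act (s + t) φ) x v = dR I (Q.act s φ) x v + dR I (Q.act t φ) x v := by
  rw [← dR_add (ContMDiffMap.mdiffAt _ x) (ContMDiffMap.mdiffAt _ x)]
  congr 2
  ext y
  simp

lemma dR_act_fsmul (ψ : C^∞⟮I, N; 𝓘(ℝ, ℝ), ℝ⟯) (s : Cₛ^∞⟮I; F, B⟯)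
    (φ : C^∞⟮I, N; 𝓘(ℝ, ℝ), ℝ⟯) (x : N) (v : TangentSpace I x) :
    dR I (Q.act (fsmul ψ s) φ) x v =
      ψ x * dR I (Q.act s φ) x v + dR I φ x (Q.anchor x (s x)) * dR I ψ x v := by
  rw [← Q.act_apply s φ, ← dR_mul (ContMDiffMap.mdiffAt _ x) (ContMDiffMap.mdiffAt _ x)]
  congr 2
  ext y
  simp

lemma bracket_fsmul_right (s : Cₛ^∞⟮I; F, B⟯) (φ : C^∞⟮I, N; 𝓘(ℝ, ℝ), ℝ⟯)
    (t : Cₛ^∞⟮I; F, B⟯) :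
    Q.bracket s (fsmul φ t) = fsmul φ (Q.bracket s t) + fsmul (Q.act s φ) t := by
  ext x
  exact Q.leibniz_right s φ t x

lemma bracket_cut_right {ρ : C^∞⟮I, N; 𝓘(ℝ, ℝ), ℝ⟯} {x : N} (hρ : ∀ᶠ y in 𝓝 x, ρ y = 1)
    (s t : Cₛ^∞⟮I; F, B⟯) : Q.bracket s (fsmul ρ t) x = Q.bracket s t x := by
  rw [Q.leibniz_right, hρ.self_of_nhds, dR_eq_zero_of_eventually hρ]
  simp

lemma bracket_cut_left {ρ : C^∞⟮I, N; 𝓘(ℝ, ℝ), ℝ⟯} {x : N} (hρ : ∀ᶠ y in 𝓝 x, ρ y = 1)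
    (s t : Cₛ^∞⟮I; F, B⟯) : Q.bracket (fsmul ρ s) t x = Q.bracket s t x := by
  refine Q.metric_ext fun u => ?_
  rw [Q.leibniz_left, hρ.self_of_nhds, dR_eq_zero_of_eventually hρ]
  simp

lemma exists_sharp (x : N) (ξ : B x →ₗ[ℝ] ℝ) : ∃ v : B x, ∀ u, Q.metric x v u = ξ u := by
  have := finiteDimensional_fiber (F := F) (B := B) x
  have hinj : Injective (Q.metric x) := fun v w h => Q.metric_ext fun u => by rw [h]
  have hsurj : Surjective (Q.metric x) :=
    (LinearMap.injective_iff_surjective_of_finrank_eq_finrank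
      (Subspace.dual_finrank_eq (K := ℝ) (V := B x)).symm).1 hinj
  obtain ⟨v, hv⟩ := hsurj ξ
  exact ⟨v, fun u => by rw [hv]⟩

/-- The element of the fibre that is metrically dual to a linear form. -/
def sharp (x : N) (ξ : B x →ₗ[ℝ] ℝ) : B x := (Q.exists_sharp x ξ).choose

@[simp] lemma metric_sharp (x : N) (ξ : B x →ₗ[ℝ] ℝ) (u : B x) :
    Q.metric x (Q.sharp x ξ) u = ξ u := (Q.exists_sharp x ξ).choose_spec u

/-- The section `a^* dφ`, metrically dual to `dφ ∘ a`. -/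
def D (φ : C^∞⟮I, N; 𝓘(ℝ, ℝ), ℝ⟯) : Cₛ^∞⟮I; F, B⟯ where
  toFun x := Q.sharp x ((dR I φ x).comp (Q.anchor x))
  contMDiff_toFun := fun x => by
    refine contMDiffAt_of_metric (g := Q.metric) (Q.metric_nondegenerate x)
      Q.contMDiff_metric fun τ => Filter.Eventually.of_forall fun y => ?_
    refine ((Q.act τ φ).contMDiff y).congr_of_eventuallyEq (Filter.Eventually.of_forall fun z => ?_)
    exact Q.metric_sharp z ((dR I φ z).comp (Q.anchor z)) (τ z)

lemma metric_D (φ : C^∞⟮I, N; 𝓘(ℝ, ℝ), ℝ⟯) (x : N) (u : B x) :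
    Q.metric x (Q.D φ x) u = dR I φ x (Q.anchor x u) :=
  Q.metric_sharp x ((dR I φ x).comp (Q.anchor x)) u

lemma bracket_fsmul_left (φ : C^∞⟮I, N; 𝓘(ℝ, ℝ), ℝ⟯) (s t : Cₛ^∞⟮I; F, B⟯) :
    Q.bracket (fsmul φ s) t =
      fsmul φ (Q.bracket s t) - fsmul (Q.act t φ) s + fsmul (Q.pair s t) (Q.D φ) := by
  ext x
  refine Q.metric_ext fun u => ?_
  rw [Q.leibniz_left]
  change _ = Q.metric x (φ x • Q.bracket s t x - Q.act t φ x • s x + Q.pair s t x • Q.D φ x) u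
  simp [metric_D]

/-- A bracket satisfying the Leibniz rules is determined by its values on generators. -/
lemma bracket_unique {Q Q' : PreCourant I F B} (hm : Q.metric = Q'.metric)
    (ha : Q.anchor = Q'.anchor) {𝒢 : Set (Cₛ^∞⟮I; F, B⟯)} (h𝒢 : HasFrames 𝒢)
    (hb : ∀ s ∈ 𝒢, ∀ t ∈ 𝒢, Q.bracket s t = Q'.bracket s t) : Q.bracket = Q'.bracket := by
  have h1 (s) (hs : s ∈ 𝒢) (t) : Q.bracket s t = Q'.bracket s t := by
    ext x
    refine sub_eq_zero.1 (h𝒢.tensor_eq_zero x (fun t => Q.bracket s t x - Q'.bracket s t x)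
      ?_ ?_ ?_ t)
    · intro t t'
      simp only [map_add, ContMDiffSection.coe_add, Pi.add_apply]
      abel
    · intro φ t
      simp only [leibniz_right, ha, smul_sub]
      abel
    · intro t ht
      simp [hb s hs t ht]
  ext s t x
  refine sub_eq_zero.1 (h𝒢.tensor_eq_zero x (fun s => Q.bracket s t x - Q'.bracket s t x)
      ?_ ?_ ?_ s)
  · intro t t'
    simp only [map_add, ContMDiffSection.coe_add, Pi.add_apply, LinearMap.add_apply]
    abel
  · intro φ s
    refine Q.metric_ext fun u => ?_
    have h2 := Q.leibniz_left φ s t x u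
    have h3 := Q'.leibniz_left φ s t x u
    rw [← hm, ← ha] at h3
    simp only [map_sub, LinearMap.sub_apply, map_smul, LinearMap.smul_apply, h2, h3, smul_eq_mul]
    ring
  · intro s hs
    simp [h1 s hs t]

end PreCourant

end PreCourant

/-! ### The axioms of a Courant algebroid on generators -/

namespace PreCourant

variable {E : Type*} [NormedAddCommGroup E] [NormedSpace ℝ E] [FiniteDimensional ℝ E]
  {H : Type*} [TopologicalSpace H]
  {N : Type*} [TopologicalSpace N] [T2Space N] [ChartedSpace H N] {I : ModelWithCorners ℝ E H}
  [IsManifold I ∞ N]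
  {F : Type*} [NormedAddCommGroup F] [NormedSpace ℝ F] [FiniteDimensional ℝ F]
  {B : N → Type*} [∀ m, AddCommGroup (B m)] [∀ m, Module ℝ (B m)]
  [TopologicalSpace (TotalSpace F B)] [∀ m, TopologicalSpace (B m)] [FiberBundle F B]
  [VectorBundle ℝ F B] [ContMDiffVectorBundle ∞ F B I]
  (Q : PreCourant I F B) {𝒢 : Set (Cₛ^∞⟮I; F, B⟯)}

/-- Compatibility of bracket and metric for three sections. -/
def AnchorMetric (s t₁ t₂ : Cₛ^∞⟮I; F, B⟯) : Prop :=
  ∀ x, dR I (Q.pair t₁ t₂) x (Q.anchor x (s x)) =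
    Q.metric x (Q.bracket s t₁ x) (t₂ x) + Q.metric x (t₁ x) (Q.bracket s t₂ x)

/-- The bracket of two sections is skew up to the section `D ⟨t₁, t₂⟩`. -/
def SkewUpToD (t₁ t₂ : Cₛ^∞⟮I; F, B⟯) : Prop :=
  Q.bracket t₁ t₂ + Q.bracket t₂ t₁ = Q.D (Q.pair t₁ t₂)

/-- The anchor takes the bracket of two sections to the commutator of derivations. -/
def AnchorHom (s t : Cₛ^∞⟮I; F, B⟯) : Prop :=
  ∀ (φ : C^∞⟮I, N; 𝓘(ℝ, ℝ), ℝ⟯) (x : N), dR I φ x (Q.anchor x (Q.bracket s t x)) =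
    dR I (Q.act t φ) x (Q.anchor x (s x)) - dR I (Q.act s φ) x (Q.anchor x (t x))

/-- The kernel of the anchor is coisotropic: `a ∘ a^* = 0`. -/
def IsCoisotropic : Prop :=
  ∀ (x : N) (w : B x) (ξ : TangentSpace I x →ₗ[ℝ] ℝ),
    (∀ u, Q.metric x w u = ξ (Q.anchor x u)) → Q.anchor x w = 0

/-- The Jacobiator of three sections. -/
def jac (s t₁ t₂ : Cₛ^∞⟮I; F, B⟯) : Cₛ^∞⟮I; F, B⟯ :=
  Q.bracket s (Q.bracket t₁ t₂) - Q.bracket (Q.bracket s t₁) t₂ - Q.bracket t₁ (Q.bracket s t₂)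

variable {Q}

/-- The defect of the compatibility of bracket and metric is `C^∞`-linear in all three sections, by
the Leibniz rules. -/
lemma AnchorMetric.of_generators (h𝒢 : HasFrames 𝒢)
    (h : ∀ s ∈ 𝒢, ∀ t₁ ∈ 𝒢, ∀ t₂ ∈ 𝒢, Q.AnchorMetric s t₁ t₂) (s t₁ t₂ : Cₛ^∞⟮I; F, B⟯) :
    Q.AnchorMetric s t₁ t₂ := by
  intro x
  let T (s t₁ t₂ : Cₛ^∞⟮I; F, B⟯) : ℝ := dR I (Q.pair t₁ t₂) x (Q.anchor x (s x)) -
    (Q.metric x (Q.bracket s t₁ x) (t₂ x) + Q.metric x (t₁ x) (Q.bracket s t₂ x))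
  have hcomm (s t₁ t₂) : T s t₁ t₂ = T s t₂ t₁ := by
    simp only [T, Q.pair_comm t₁ t₂, Q.metric_symm x (Q.bracket s t₁ x),
      Q.metric_symm x (t₁ x)]
    ring
  have hadd3 (s t₁ t t') : T s t₁ (t + t') = T s t₁ t + T s t₁ t' := by
    simp only [T, dR_pair_add_right, map_add, ContMDiffSection.coe_add, Pi.add_apply]
    ring
  have hsmul3 (s t₁ φ t) : T s t₁ (fsmul φ t) = φ x • T s t₁ t := by
    simp only [T, dR_pair_fsmul_right, leibniz_right, fsmul_apply, map_add, map_smul, smul_eq_mul]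
    ring
  have h1 (s) (hs : s ∈ 𝒢) (t₁) (ht₁ : t₁ ∈ 𝒢) (t₂) : T s t₁ t₂ = 0 :=
    h𝒢.tensor_eq_zero x (T s t₁) (hadd3 s t₁) (hsmul3 s t₁)
      (fun t₂ ht₂ => sub_eq_zero.2 (h s hs t₁ ht₁ t₂ ht₂ x)) t₂
  have h2 (s) (hs : s ∈ 𝒢) (t₁ t₂) : T s t₁ t₂ = 0 := by
    rw [hcomm]
    exact h𝒢.tensor_eq_zero x (T s t₂) (hadd3 s t₂) (hsmul3 s t₂)
      (fun t₁ ht₁ => by rw [hcomm]; exact h1 s hs t₁ ht₁ t₂) t₁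
  refine sub_eq_zero.1 (h𝒢.tensor_eq_zero x (fun s => T s t₁ t₂) ?_ ?_
    (fun s hs => h2 s hs t₁ t₂) s)
  · intro s s'
    simp only [T, map_add, ContMDiffSection.coe_add, Pi.add_apply, LinearMap.add_apply]
    ring
  · intro φ s
    simp only [T, leibniz_left, Q.metric_symm x (t₁ x), fsmul_apply, map_smul, smul_eq_mul]
    ring

/-- The defect of the skew symmetry is symmetric and `C^∞`-linear in each section. -/
lemma SkewUpToD.of_generators (h𝒢 : HasFrames 𝒢)
    (h : ∀ t₁ ∈ 𝒢, ∀ t₂ ∈ 𝒢, Q.SkewUpToD t₁ t₂) (t₁ t₂ : Cₛ^∞⟮I; F, B⟯) :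
    Q.SkewUpToD t₁ t₂ := by
  unfold SkewUpToD at h ⊢
  ext x
  refine Q.metric_ext fun u => ?_
  let T (t₁ t₂ : Cₛ^∞⟮I; F, B⟯) : ℝ := Q.metric x (Q.bracket t₁ t₂ x) u +
    Q.metric x (Q.bracket t₂ t₁ x) u - dR I (Q.pair t₁ t₂) x (Q.anchor x u)
  have hT (t₁ t₂) (h : Q.bracket t₁ t₂ + Q.bracket t₂ t₁ = Q.D (Q.pair t₁ t₂)) : T t₁ t₂ = 0 := by
    refine sub_eq_zero.2 ?_
    rw [← Q.metric_D, ← h]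
    simp
  have hcomm (t₁ t₂) : T t₁ t₂ = T t₂ t₁ := by
    simp only [T, Q.pair_comm t₁ t₂]; ring
  have hadd (t₁ t t') : T t₁ (t + t') = T t₁ t + T t₁ t' := by
    simp only [T, dR_pair_add_right, map_add, ContMDiffSection.coe_add, Pi.add_apply,
      LinearMap.add_apply]
    ring
  have hsmul (t₁ φ t) : T t₁ (fsmul φ t) = φ x • T t₁ t := by
    simp only [T, dR_pair_fsmul_right, leibniz_right, leibniz_left, map_add, map_smul, smul_eq_mul,
      LinearMap.add_apply, LinearMap.smul_apply, Q.metric_symm x (t₁ x) (t x)]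
    ring
  have h1 (t₁) (ht₁ : t₁ ∈ 𝒢) (t₂) : T t₁ t₂ = 0 :=
    h𝒢.tensor_eq_zero x (T t₁) (hadd t₁) (hsmul t₁) (fun t₂ ht₂ => hT _ _ (h t₁ ht₁ t₂ ht₂)) t₂
  have h2 : T t₁ t₂ = 0 := by
    rw [hcomm]
    exact h𝒢.tensor_eq_zero x (T t₂) (hadd t₂) (hsmul t₂)
      (fun t₁ ht₁ => by rw [hcomm]; exact h1 t₁ ht₁ t₂) t₁
  rw [Q.metric_D, ← sub_eq_zero, ← h2]
  simp [T]

lemma IsCoisotropic.anchor_D (hco : Q.IsCoisotropic) (φ : C^∞⟮I, N; 𝓘(ℝ, ℝ), ℝ⟯) (x : N) :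
    Q.anchor x (Q.D φ x) = 0 := hco x _ (dR I φ x) (Q.metric_D φ x)

/-- If `a ∘ a^* = 0`, then the defect of the bracket preservation of the anchor is skew, and it is
`C^∞`-linear in each section. -/
lemma AnchorHom.of_generators (h𝒢 : HasFrames 𝒢) (hsk : ∀ s t, Q.SkewUpToD s t)
    (hco : Q.IsCoisotropic) (h : ∀ s ∈ 𝒢, ∀ t ∈ 𝒢, Q.AnchorHom s t) (s t : Cₛ^∞⟮I; F, B⟯) :
    Q.AnchorHom s t := by
  intro φ x
  let T (s t : Cₛ^∞⟮I; F, B⟯) : ℝ := dR I φ x (Q.anchor x (Q.bracket s t x)) -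
    (dR I (Q.act t φ) x (Q.anchor x (s x)) - dR I (Q.act s φ) x (Q.anchor x (t x)))
  have hcomm (s t) : T s t = - T t s := by
    have h1 : Q.anchor x (Q.bracket s t x) = - Q.anchor x (Q.bracket t s x) := by
      rw [eq_neg_iff_add_eq_zero, ← map_add, ← hco.anchor_D (Q.pair s t) x, ← hsk s t]
      rfl
    simp only [T, h1, map_neg]
    ring
  have hadd (s t t') : T s (t + t') = T s t + T s t' := by
    simp only [T, dR_act_add, map_add, ContMDiffSection.coe_add, Pi.add_apply]
    ring
  have hsmul (s ψ t) : T s (fsmul ψ t) = ψ x • T s t := by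
    simp only [T, dR_act_fsmul, leibniz_right, fsmul_apply, map_add, map_smul, smul_eq_mul]
    ring
  have h1 (s) (hs : s ∈ 𝒢) (t) : T s t = 0 :=
    h𝒢.tensor_eq_zero x (T s) (hadd s) (hsmul s)
      (fun t ht => sub_eq_zero.2 (h s hs t ht φ x)) t
  refine sub_eq_zero.1 (show T s t = 0 from ?_)
  rw [hcomm, neg_eq_zero]
  exact h𝒢.tensor_eq_zero x (T t) (hadd t) (hsmul t)
    (fun s hs => by rw [hcomm, h1 s hs t, neg_zero]) s

/-- `⟦s, D φ⟧ = D (a(s) φ)`, which makes the Jacobiator skew. -/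
lemma bracket_D (ham : ∀ s t₁ t₂, Q.AnchorMetric s t₁ t₂) (hho : ∀ s t, Q.AnchorHom s t)
    (s : Cₛ^∞⟮I; F, B⟯) (φ : C^∞⟮I, N; 𝓘(ℝ, ℝ), ℝ⟯) :
    Q.bracket s (Q.D φ) = Q.D (Q.act s φ) := by
  ext x
  refine Q.metric_ext fun u => ?_
  rw [Q.metric_D]
  have h1 := ham s (Q.D φ) (extB I F x u) x
  have h2 : Q.pair (Q.D φ) (extB I F x u) = Q.act (extB I F x u) φ := by
    ext y; exact Q.metric_D φ y _
  have h3 := hho s (extB I F x u) φ x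
  rw [h2, Q.metric_D, h3, extB_self] at h1
  linarith

lemma D_bracket (ham : ∀ s t₁ t₂, Q.AnchorMetric s t₁ t₂) (hho : ∀ s t, Q.AnchorHom s t)
    (hsk : ∀ s t, Q.SkewUpToD s t) (φ : C^∞⟮I, N; 𝓘(ℝ, ℝ), ℝ⟯) (s : Cₛ^∞⟮I; F, B⟯) :
    Q.bracket (Q.D φ) s = 0 := by
  have h1 : Q.bracket (Q.D φ) s + Q.bracket s (Q.D φ) = Q.D (Q.pair (Q.D φ) s) := hsk _ _
  have h2 : Q.pair (Q.D φ) s = Q.act s φ := by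
    ext y; exact Q.metric_D φ y _
  rw [bracket_D ham hho, h2] at h1
  simpa using h1

lemma D_add (φ ψ : C^∞⟮I, N; 𝓘(ℝ, ℝ), ℝ⟯) : Q.D (φ + ψ) = Q.D φ + Q.D ψ := by
  ext x
  refine Q.metric_ext fun u => ?_
  rw [ContMDiffSection.coe_add, Pi.add_apply, map_add, LinearMap.add_apply, Q.metric_D, Q.metric_D,
    Q.metric_D, ← dR_add (ContMDiffMap.mdiffAt _ x) (ContMDiffMap.mdiffAt _ x)]
  rfl

/-- The Jacobiator is totally skew and linear over functions, hence vanishes if it does so on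
generators. -/
lemma jac_eq_zero_of_generators (h𝒢 : HasFrames 𝒢) (ham : ∀ s t₁ t₂, Q.AnchorMetric s t₁ t₂)
    (hho : ∀ s t, Q.AnchorHom s t) (hsk : ∀ s t, Q.SkewUpToD s t)
    (h : ∀ s ∈ 𝒢, ∀ t₁ ∈ 𝒢, ∀ t₂ ∈ 𝒢, Q.jac s t₁ t₂ = 0) (s t₁ t₂ : Cₛ^∞⟮I; F, B⟯) :
    Q.jac s t₁ t₂ = 0 := by
  have h12 (s t₁ t₂) : Q.jac s t₁ t₂ = - Q.jac t₁ s t₂ := by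
    have h1 : Q.bracket (Q.bracket s t₁) t₂ + Q.bracket (Q.bracket t₁ s) t₂ = 0 := by
      rw [← LinearMap.add_apply, ← map_add, show _ + _ = _ from hsk s t₁, D_bracket ham hho hsk]
    unfold jac
    rw [eq_neg_of_add_eq_zero_left h1]
    abel
  have h23 (s t₁ t₂) : Q.jac s t₁ t₂ = - Q.jac s t₂ t₁ := by
    have h1 : Q.bracket s (Q.bracket t₁ t₂) + Q.bracket s (Q.bracket t₂ t₁) =
        (Q.bracket (Q.bracket s t₁) t₂ + Q.bracket t₂ (Q.bracket s t₁)) +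
        (Q.bracket t₁ (Q.bracket s t₂) + Q.bracket (Q.bracket s t₂) t₁) := by
      rw [← map_add, show _ + _ = _ from hsk t₁ t₂, show _ + _ = _ from hsk (Q.bracket s t₁) t₂,
        show _ + _ = _ from hsk t₁ (Q.bracket s t₂), bracket_D ham hho, ← D_add]
      congr 1
      ext x
      exact ham s t₁ t₂ x
    unfold jac
    rw [eq_sub_of_add_eq h1]
    abel
  have hadd (s t₁ t t') : Q.jac s t₁ (t + t') = Q.jac s t₁ t + Q.jac s t₁ t' := by
    simp only [jac, map_add]
    abel
  have hsmul (s t₁ ψ t) (x) : Q.jac s t₁ (fsmul ψ t) x = ψ x • Q.jac s t₁ t x := by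
    have h1 := hho s t₁ ψ x
    simp only [jac, bracket_fsmul_right, map_add, ContMDiffSection.coe_add,
      ContMDiffSection.coe_sub, Pi.add_apply, Pi.sub_apply, fsmul_apply, act_apply, smul_sub]
    rw [h1, sub_smul]
    abel
  have h1 (s) (hs : s ∈ 𝒢) (t₁) (ht₁ : t₁ ∈ 𝒢) (t₂) : Q.jac s t₁ t₂ = 0 := by
    ext x
    exact h𝒢.tensor_eq_zero x (fun t => Q.jac s t₁ t x) (fun t t' => by rw [hadd]; rfl)
      (fun φ t => hsmul s t₁ φ t x) (fun t ht => by rw [h s hs t₁ ht₁ t ht]; rfl) t₂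
  have h2 (s) (hs : s ∈ 𝒢) (t₁ t₂) : Q.jac s t₁ t₂ = 0 := by
    rw [h23, neg_eq_zero]
    ext x
    exact h𝒢.tensor_eq_zero x (fun t => Q.jac s t₂ t x) (fun t t' => by rw [hadd]; rfl)
      (fun φ t => hsmul s t₂ φ t x) (fun t ht => by rw [h23, h1 s hs t ht, neg_zero]; rfl) t₁
  rw [h12, h23, neg_neg]
  ext x
  exact h𝒢.tensor_eq_zero x (fun t => Q.jac t₁ t₂ t x) (fun t t' => by rw [hadd]; rfl)
    (fun φ t => hsmul t₁ t₂ φ t x) (fun t ht => by rw [h23, h12, neg_neg, h2 t ht]; rfl) s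

variable (Q) in
/-- A bracket that satisfies the Leibniz rules is a Courant bracket if it satisfies the axioms on
generators, provided that on generators the anchor preserves brackets and that the kernel of the
anchor is coisotropic. -/
def toCourantAlgebroid (h𝒢 : HasFrames 𝒢)
    (ham : ∀ s ∈ 𝒢, ∀ t₁ ∈ 𝒢, ∀ t₂ ∈ 𝒢, Q.AnchorMetric s t₁ t₂)
    (hsk : ∀ t₁ ∈ 𝒢, ∀ t₂ ∈ 𝒢, Q.SkewUpToD t₁ t₂) (hco : Q.IsCoisotropic)
    (hho : ∀ s ∈ 𝒢, ∀ t ∈ 𝒢, Q.AnchorHom s t)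
    (hja : ∀ s ∈ 𝒢, ∀ t₁ ∈ 𝒢, ∀ t₂ ∈ 𝒢, Q.jac s t₁ t₂ = 0) : CourantAlgebroid I F B where
  metric := Q.metric
  anchor := Q.anchor
  bracket := Q.bracket
  metric_symm := Q.metric_symm
  metric_nondegenerate := Q.metric_nondegenerate
  contMDiff_metric := Q.contMDiff_metric
  contMDiff_anchor := Q.contMDiff_anchor
  anchor_metric := AnchorMetric.of_generators h𝒢 ham
  jacobi s t₁ t₂ := by
    have h := jac_eq_zero_of_generators h𝒢 (AnchorMetric.of_generators h𝒢 ham)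
      (AnchorHom.of_generators h𝒢 (SkewUpToD.of_generators h𝒢 hsk) hco hho)
      (SkewUpToD.of_generators h𝒢 hsk) hja s t₁ t₂
    rw [jac, sub_sub, sub_eq_zero] at h
    exact h
  bracket_symm t₁ t₂ x v := by
    have h : Q.bracket t₁ t₂ + Q.bracket t₂ t₁ = _ := SkewUpToD.of_generators h𝒢 hsk t₁ t₂
    have h2 : Q.bracket t₁ t₂ x + Q.bracket t₂ t₁ x = Q.D (Q.pair t₁ t₂) x := by
      rw [← h]; rfl
    rw [h2, Q.metric_D]
    rfl

end PreCourant

/-! ### Consequences of the axioms of a Courant algebroid -/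

namespace CourantAlgebroid

variable {E : Type*} [NormedAddCommGroup E] [NormedSpace ℝ E] [FiniteDimensional ℝ E]
  {H : Type*} [TopologicalSpace H]
  {N : Type*} [TopologicalSpace N] [T2Space N] [ChartedSpace H N] {I : ModelWithCorners ℝ E H}
  [IsManifold I ∞ N]
  {F : Type*} [NormedAddCommGroup F] [NormedSpace ℝ F] [FiniteDimensional ℝ F]
  {B : N → Type*} [∀ m, AddCommGroup (B m)] [∀ m, Module ℝ (B m)]
  [TopologicalSpace (TotalSpace F B)] [∀ m, TopologicalSpace (B m)] [FiberBundle F B]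
  [VectorBundle ℝ F B] [ContMDiffVectorBundle ∞ F B I]
  (C : CourantAlgebroid I F B)

lemma leibniz_right (s : Cₛ^∞⟮I; F, B⟯) (φ : C^∞⟮I, N; 𝓘(ℝ, ℝ), ℝ⟯) (t : Cₛ^∞⟮I; F, B⟯) (x : N) :
    C.bracket s (fsmul φ t) x =
      φ x • C.bracket s t x + dR I φ x (C.anchor x (s x)) • t x := by
  refine sub_eq_zero.1 (C.metric_nondegenerate x _ fun u => ?_)
  have h1 := C.anchor_metric s (fsmul φ t) (extB I F x u) x
  have h2 := C.anchor_metric s t (extB I F x u) x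
  have h3 := dR_mul (I := I) (φ.mdiffAt x) (ContMDiffMap.mdiffAt
    ⟨fun m => C.metric m (t m) (extB I F x u m), C.contMDiff_metric _ _⟩ x) (C.anchor x (s x))
  have h4 : dR I (fun y => C.metric y (fsmul φ t y) (extB I F x u y)) x =
      dR I (fun y => φ y * C.metric y (t y) (extB I F x u y)) x := by
    congr 1
    ext y
    simp
  rw [h4] at h1
  simp only [ContMDiffMap.coeFn_mk] at h3
  rw [h3, h2] at h1
  simp only [fsmul_apply, map_smul, LinearMap.smul_apply, smul_eq_mul, extB_self] at h1
  simp only [map_sub, map_add, map_smul, LinearMap.sub_apply, LinearMap.add_apply,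
    LinearMap.smul_apply, smul_eq_mul]
  linarith

/-- The bracket of a Courant algebroid satisfies the Leibniz rules: the right one follows from the
compatibility with the metric, and the left one from the right one by skew symmetry. -/
def toPreCourant : PreCourant I F B where
  metric := C.metric
  anchor := C.anchor
  bracket := C.bracket
  metric_symm := C.metric_symm
  metric_nondegenerate := C.metric_nondegenerate
  contMDiff_metric := C.contMDiff_metric
  contMDiff_anchor := C.contMDiff_anchor
  leibniz_right := C.leibniz_right
  leibniz_left φ s t x u := by
    have h1 := C.bracket_symm (fsmul φ s) t x u
    have h2 := C.bracket_symm s t x u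
    rw [C.leibniz_right] at h1
    have h3 := dR_mul (I := I) (φ.mdiffAt x) (ContMDiffMap.mdiffAt
      ⟨fun m => C.metric m (s m) (t m), C.contMDiff_metric _ _⟩ x) (C.anchor x u)
    have h4 : dR I (fun y => C.metric y (fsmul φ s y) (t y)) x =
        dR I (fun y => φ y * C.metric y (s y) (t y)) x := by
      congr 1
      ext y
      simp
    rw [h4] at h1
    simp only [ContMDiffMap.coeFn_mk] at h3
    rw [h3, ← h2] at h1
    simp only [map_add, map_smul, LinearMap.add_apply, LinearMap.smul_apply, smul_eq_mul] at h1
    linarith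

lemma skewUpToD (t₁ t₂ : Cₛ^∞⟮I; F, B⟯) : C.toPreCourant.SkewUpToD t₁ t₂ := by
  unfold PreCourant.SkewUpToD
  ext x
  refine C.toPreCourant.metric_ext fun u => ?_
  rw [PreCourant.metric_D]
  exact C.bracket_symm t₁ t₂ x u

/-- If the fibre at `x` is not zero then there are sections with `⟨s, t⟩ = 1` at `x`. -/
lemma exists_pair_eq_one (x : N) [Nontrivial (B x)] : ∃ s t : Cₛ^∞⟮I; F, B⟯,
    C.metric x (s x) (t x) = 1 := by
  obtain ⟨v, hv⟩ := exists_ne (0 : B x)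
  have h : ∃ w, C.metric x v w ≠ 0 := by
    by_contra h
    push Not at h
    exact hv (C.metric_nondegenerate x v h)
  obtain ⟨w, hw⟩ := h
  refine ⟨extB I F x v, extB I F x ((C.metric x v w)⁻¹ • w), ?_⟩
  rw [extB_self, extB_self, map_smul, smul_eq_mul, inv_mul_cancel₀ hw]

/-- The anchor of a Courant algebroid is bracket preserving, by the Jacobi identity for
`s`, `t` and `φ • r`. -/
lemma anchorHom (s t : Cₛ^∞⟮I; F, B⟯) : C.toPreCourant.AnchorHom s t := by
  intro φ x
  rcases subsingleton_or_nontrivial (B x) with hx | hx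
  · rw [Subsingleton.elim (C.toPreCourant.bracket s t x) 0, Subsingleton.elim (s x) 0,
      Subsingleton.elim (t x) 0]
    simp
  obtain ⟨r, r', hr⟩ := C.exists_pair_eq_one (F := F) x
  have hrx : r x ≠ 0 := by
    intro h; rw [h] at hr; simp at hr
  let Q := C.toPreCourant
  have h1 : Q.jac s t (fsmul φ r) x = 0 := by
    have : Q.jac s t (fsmul φ r) = 0 := by
      rw [PreCourant.jac, sub_sub, sub_eq_zero]; exact C.jacobi s t (fsmul φ r)
    rw [this]; rfl
  have h2 : φ x • Q.jac s t r x = 0 := by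
    have : Q.jac s t r = 0 := by
      rw [PreCourant.jac, sub_sub, sub_eq_zero]; exact C.jacobi s t r
    rw [this]; exact smul_zero _
  have h3 : (dR I (Q.act t φ) x (Q.anchor x (s x)) - dR I (Q.act s φ) x (Q.anchor x (t x)) -
      dR I φ x (Q.anchor x (Q.bracket s t x))) • r x = 0 := by
    rw [← sub_eq_zero.2 (h1.trans h2.symm)]
    simp only [PreCourant.jac, PreCourant.bracket_fsmul_right, map_add, ContMDiffSection.coe_add,
      ContMDiffSection.coe_sub, Pi.add_apply, Pi.sub_apply, fsmul_apply, PreCourant.act_apply,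
      smul_sub, sub_smul]
    abel
  have h4 := (smul_eq_zero.1 h3).resolve_right hrx
  linarith

/-- `a ∘ a^* = 0`: the anchor kills `⟦s, t⟧ + ⟦t, s⟧ = D ⟨s, t⟩`; replace `s` by `φ • s`. -/
lemma isCoisotropic : C.toPreCourant.IsCoisotropic := by
  intro x w ξ hw
  rcases subsingleton_or_nontrivial (B x) with hx | hx
  · rw [Subsingleton.elim w 0, map_zero]
  let Q := C.toPreCourant
  obtain ⟨φ, hφ, -⟩ := exists_dR_eq x ξ
  have hwD : w = Q.D φ x := by
    refine Q.metric_ext fun u => ?_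
    rw [Q.metric_D, hφ]; exact hw u
  have h1 (s t) : Q.anchor x (Q.D (Q.pair s t) x) = 0 := by
    refine eq_zero_of_dR_eq_zero fun ψ => ?_
    rw [← show _ + _ = _ from C.skewUpToD s t, ContMDiffSection.coe_add, Pi.add_apply, map_add,
      map_add, show _ = _ from C.anchorHom s t ψ x, show _ = _ from C.anchorHom t s ψ x]
    ring
  obtain ⟨s, t, hst⟩ := C.exists_pair_eq_one (F := F) x
  have h2 : Q.D (Q.pair (fsmul φ s) t) x = φ x • Q.D (Q.pair s t) x + Q.D φ x := by
    refine Q.metric_ext fun u => ?_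
    rw [Q.metric_D, Q.dR_pair_fsmul_left, map_add, LinearMap.add_apply, map_smul,
      LinearMap.smul_apply, Q.metric_D, Q.metric_D, show Q.metric x (s x) (t x) = 1 from hst]
    simp
  have h3 := h1 (fsmul φ s) t
  rw [h2, map_add, map_smul, h1, smul_zero, zero_add] at h3
  rw [hwD]
  exact h3

lemma eq_of_generators {C C' : CourantAlgebroid I F B} (hm : C.metric = C'.metric)
    (ha : C.anchor = C'.anchor) {𝒢 : Set (Cₛ^∞⟮I; F, B⟯)} (h𝒢 : HasFrames 𝒢)
    (hb : ∀ s ∈ 𝒢, ∀ t ∈ 𝒢, C.bracket s t = C'.bracket s t) : C = C' :=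
  CourantAlgebroid.ext hm ha (PreCourant.bracket_unique (Q := C.toPreCourant)
    (Q' := C'.toPreCourant) hm ha h𝒢 hb)

end CourantAlgebroid

/-! ### Pull-backs of Courant algebroids -/

section Pullback

variable {E : Type*} [NormedAddCommGroup E] [NormedSpace ℝ E] [FiniteDimensional ℝ E]
  {H : Type*} [TopologicalSpace H]
  {M : Type*} [TopologicalSpace M] [T2Space M] [ChartedSpace H M] {I : ModelWithCorners ℝ E H}
  [IsManifold I ∞ M]
  {F : Type*} [NormedAddCommGroup F] [NormedSpace ℝ F] [FiniteDimensional ℝ F]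
  {A : M → Type*} [∀ m, AddCommGroup (A m)] [∀ m, Module ℝ (A m)]
  [TopologicalSpace (TotalSpace F A)] [∀ m, TopologicalSpace (A m)] [FiberBundle F A]
  [VectorBundle ℝ F A] [ContMDiffVectorBundle ∞ F A I]
  {E' : Type*} [NormedAddCommGroup E'] [NormedSpace ℝ E'] [FiniteDimensional ℝ E']
  {H' : Type*} [TopologicalSpace H']
  {N : Type*} [TopologicalSpace N] [T2Space N] [ChartedSpace H' N] {I' : ModelWithCorners ℝ E' H'}
  [IsManifold I' ∞ N]

variable (I' F) in
/-- The section `s` of `f^* A` is differentiable at `x`, in the distinguished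
trivialization of `A` around `f x`. -/
def SecDiffAt (f : N → M) (x : N) (s : ∀ y, A (f y)) : Prop :=
  MDifferentiableAt I' 𝓘(ℝ, F) (fun y => bcoord F (f x) (f y) (s y)) x

variable (I' F) in
/-- The covariant derivative at `x` of a section of `f^* A`, for the flat connection given by the
distinguished trivialization of `A` around `f x`. -/
def nab (f : N → M) (x : N) (s : ∀ y, A (f y)) : TangentSpace I' x →ₗ[ℝ] A (f x) :=
  (bsymm F (f x) (f x)).comp (show TangentSpace I' x →ₗ[ℝ] F from
    (mfderiv I' 𝓘(ℝ, F) (fun y => bcoord F (f x) (f y) (s y)) x).toLinearMap)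

lemma nab_add {f : N → M} {x : N} {s t : ∀ y, A (f y)} (hs : SecDiffAt F I' f x s)
    (ht : SecDiffAt F I' f x t) (v : TangentSpace I' x) :
    nab F I' f x (fun y => s y + t y) v = nab F I' f x s v + nab F I' f x t v := by
  have h1 : (fun y => bcoord F (f x) (f y) (s y + t y)) =
      fun y => bcoord F (f x) (f y) (s y) + bcoord F (f x) (f y) (t y) :=
    funext fun y => map_add _ _ _
  have h2 := congrArg (fun T : E' →L[ℝ] F => T v) (hs.hasMFDerivAt.add ht.hasMFDerivAt).mfderiv
  unfold nab
  rw [h1]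
  exact (congrArg (bsymm F (f x) (f x)) h2).trans (map_add _ _ _)

lemma nab_smul {f : N → M} {x : N} {φ : N → ℝ} {s : ∀ y, A (f y)}
    (hφ : MDifferentiableAt I' 𝓘(ℝ, ℝ) φ x) (hs : SecDiffAt F I' f x s) (v : TangentSpace I' x) :
    nab F I' f x (fun y => φ y • s y) v = φ x • nab F I' f x s v + dR I' φ x v • s x := by
  have h1 : (fun y => bcoord F (f x) (f y) (φ y • s y)) =
      fun y => φ y • bcoord F (f x) (f y) (s y) := funext fun y => map_smul _ _ _
  have h2 := congrArg (fun T : E' →L[ℝ] F => T v) (mvfderiv_smul hφ hs)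
  unfold nab
  rw [h1]
  refine (congrArg (bsymm F (f x) (f x)) h2).trans ((map_add _ _ _).trans ?_)
  refine congrArg₂ (· + ·) (map_smul _ _ _) ((map_smul _ _ _).trans ?_)
  rw [bsymm_bcoord_self]
  rfl

lemma nab_comp {f : N → M} {x : N} {σ : ∀ m, A m} (hf : MDifferentiableAt I' I f x)
    (hσ : SecDiffAt F I id (f x) σ) (v : TangentSpace I' x) :
    nab F I' f x (fun y => σ (f y)) v = nab F I id (f x) σ (mfderiv I' I f x v) := by
  have h := congrArg (fun T : E' →L[ℝ] F => T v) (mfderiv_comp (I' := I) x hσ hf)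
  exact congrArg (bsymm F (f x) (f x)) h

lemma secDiffAt_id (m : M) (σ : Cₛ^∞⟮I; F, A⟯) : SecDiffAt F I id m σ :=
  (eventually_contMDiffAt_bcoord m σ).self_of_nhds.mdifferentiableAt (by simp)

/-- The sections `extB I F m w` are parallel at `m`. -/
lemma nab_extB (m : M) (w : A m) : nab F I id m (extB I F m w) = 0 := by
  have h1 : (fun y => bcoord F m y (extB I F m w y)) =ᶠ[𝓝 m] fun _ => bcoord F m m w :=
    bcoord_extB m w
  ext v
  have h2 : mfderiv I 𝓘(ℝ, F) (fun y => bcoord F m y (extB I F m w y)) m = 0 := by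
    rw [h1.mfderiv_eq]; exact mfderiv_const
  have h3 := congrArg (fun T : E →L[ℝ] F => T v) h2
  exact (congrArg (bsymm F m m) h3).trans (map_zero _)

namespace CourantAlgebroid

variable (C : CourantAlgebroid I F A)

/-- The value at `x` of the bracket of two sections of `f^* A`, computed in the distinguished
trivialization of `A` around `f x`: for the flat connection `∇` it is
`H(s, t) + ∇_{b s} t - ∇_{b t} s + ⟨∇_{b (·)} s, t⟩^♯`, where `H` is the bracket of the constant
sections. -/
def pullbackBracketAt (f : N → M) (x : N) (b : A (f x) →ₗ[ℝ] TangentSpace I' x)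
    (s t : ∀ y, A (f y)) : A (f x) :=
  C.bracket (extB I F (f x) (s x)) (extB I F (f x) (t x)) (f x) + nab F I' f x t (b (s x)) -
    nab F I' f x s (b (t x)) +
    C.toPreCourant.sharp (f x) (((C.metric (f x)).flip (t x)).comp ((nab F I' f x s).comp b))

section

variable {f : N → M} {x : N} {b : A (f x) →ₗ[ℝ] TangentSpace I' x} {s s' t t' : ∀ y, A (f y)}

lemma metric_pullbackBracketAt (u : A (f x)) :
    C.metric (f x) (C.pullbackBracketAt f x b s t) u =
      C.metric (f x) (C.bracket (extB I F (f x) (s x)) (extB I F (f x) (t x)) (f x)) u +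
      C.metric (f x) (nab F I' f x t (b (s x))) u - C.metric (f x) (nab F I' f x s (b (t x))) u +
      C.metric (f x) (nab F I' f x s (b u)) (t x) := by
  have h := C.toPreCourant.metric_sharp (f x)
    (((C.metric (f x)).flip (t x)).comp ((nab F I' f x s).comp b)) u
  change C.metric (f x) _ u = _ at h
  rw [pullbackBracketAt, map_add, LinearMap.add_apply, h, map_sub, map_add]
  rfl

lemma pullbackBracketAt_add_right (ht : SecDiffAt F I' f x t) (ht' : SecDiffAt F I' f x t')
    (u : A (f x)) :
    C.metric (f x) (C.pullbackBracketAt f x b s (fun y => t y + t' y)) u =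
      C.metric (f x) (C.pullbackBracketAt f x b s t) u +
        C.metric (f x) (C.pullbackBracketAt f x b s t') u := by
  simp only [metric_pullbackBracketAt, nab_add ht ht', map_add, LinearMap.add_apply,
    ContMDiffSection.coe_add, Pi.add_apply]
  ring

lemma pullbackBracketAt_smul_right {φ : N → ℝ} (hφ : MDifferentiableAt I' 𝓘(ℝ, ℝ) φ x)
    (ht : SecDiffAt F I' f x t) (u : A (f x)) :
    C.metric (f x) (C.pullbackBracketAt f x b s (fun y => φ y • t y)) u =
      φ x * C.metric (f x) (C.pullbackBracketAt f x b s t) u +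
        dR I' φ x (b (s x)) * C.metric (f x) (t x) u := by
  simp only [metric_pullbackBracketAt, nab_smul hφ ht, map_add, map_smul, LinearMap.add_apply,
    LinearMap.smul_apply, ContMDiffSection.coe_smul, Pi.smul_apply, smul_eq_mul]
  ring

lemma pullbackBracketAt_add_left (hs : SecDiffAt F I' f x s) (hs' : SecDiffAt F I' f x s')
    (u : A (f x)) :
    C.metric (f x) (C.pullbackBracketAt f x b (fun y => s y + s' y) t) u =
      C.metric (f x) (C.pullbackBracketAt f x b s t) u +
        C.metric (f x) (C.pullbackBracketAt f x b s' t) u := by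
  simp only [metric_pullbackBracketAt, nab_add hs hs', map_add, LinearMap.add_apply,
    ContMDiffSection.coe_add, Pi.add_apply]
  ring

lemma pullbackBracketAt_smul_left {φ : N → ℝ} (hφ : MDifferentiableAt I' 𝓘(ℝ, ℝ) φ x)
    (hs : SecDiffAt F I' f x s) (u : A (f x)) :
    C.metric (f x) (C.pullbackBracketAt f x b (fun y => φ y • s y) t) u =
      φ x * C.metric (f x) (C.pullbackBracketAt f x b s t) u -
        dR I' φ x (b (t x)) * C.metric (f x) (s x) u +
        C.metric (f x) (s x) (t x) * dR I' φ x (b u) := by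
  simp only [metric_pullbackBracketAt, nab_smul hφ hs, map_add, map_smul, LinearMap.add_apply,
    LinearMap.smul_apply, ContMDiffSection.coe_smul, Pi.smul_apply, smul_eq_mul]
  ring

end

/-- For `f = id` the formula in the trivialization gives back the bracket. -/
lemma pullbackBracketAt_id (m : M) (σ τ : Cₛ^∞⟮I; F, A⟯) :
    C.pullbackBracketAt (I' := I) id m (C.anchor m) σ τ = C.bracket σ τ m := by
  refine C.toPreCourant.metric_ext fun u => ?_
  -- both sides satisfy the same Leibniz rules, and they agree on the parallel frame
  let T (σ τ : Cₛ^∞⟮I; F, A⟯) : ℝ :=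
    C.metric m (C.pullbackBracketAt (I' := I) id m (C.anchor m) σ τ) u -
      C.metric m (C.bracket σ τ m) u
  have he := isFrameAt_stdFrame (I := I) (F := F) (B := A) m
  have h1 (v : A m) (τ) : T (extB I F m v) τ = 0 := by
    refine he.tensor_eq_zero (T (extB I F m v)) ?_ ?_ ?_ τ
    · intro τ τ'
      have h := C.pullbackBracketAt_add_right (I' := I) (f := id) (x := m) (b := C.anchor m)
        (s := extB I F m v) (t := τ) (t' := τ') (secDiffAt_id m τ) (secDiffAt_id m τ') u
      have h' : C.metric m (C.bracket (extB I F m v) (τ + τ') m) u =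
          C.metric m (C.bracket (extB I F m v) τ m) u +
          C.metric m (C.bracket (extB I F m v) τ' m) u := by
        rw [map_add, ContMDiffSection.coe_add, Pi.add_apply, map_add, LinearMap.add_apply]
      exact (congrArg₂ (· - ·) h h').trans (add_sub_add_comm _ _ _ _)
    · intro φ τ
      have h := C.pullbackBracketAt_smul_right (I' := I) (f := id) (x := m) (b := C.anchor m)
        (s := extB I F m v) (t := τ) (φ.mdiffAt m) (secDiffAt_id m τ) u
      have h' : C.metric m (C.bracket (extB I F m v) (fsmul φ τ) m) u =
          φ m * C.metric m (C.bracket (extB I F m v) τ m) u +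
          dR I φ m (C.anchor m (extB I F m v m)) * C.metric m (τ m) u := by
        rw [C.leibniz_right, map_add, map_smul, map_smul]; rfl
      refine (congrArg₂ (· - ·) h h').trans ?_
      simp only [T, smul_eq_mul, id]
      ring
    · intro i
      have h := C.metric_pullbackBracketAt (I' := I) (f := id) (x := m) (b := C.anchor m)
        (s := extB I F m v) (t := stdFrame I F A m i) u
      rw [stdFrame_eq_extB] at h ⊢
      refine sub_eq_zero.2 (h.trans ?_)
      have h2 (w : A m) : nab F I id m (extB I F m w) = 0 := nab_extB m w
      simp only [h2, id, extB_self]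
      simp
  have h2 : T σ τ = 0 := by
    refine he.tensor_eq_zero (fun σ => T σ τ) ?_ ?_ ?_ σ
    · intro σ σ'
      have h := C.pullbackBracketAt_add_left (I' := I) (f := id) (x := m) (b := C.anchor m)
        (s := σ) (s' := σ') (t := τ) (secDiffAt_id m σ) (secDiffAt_id m σ') u
      have h' : C.metric m (C.bracket (σ + σ') τ m) u =
          C.metric m (C.bracket σ τ m) u + C.metric m (C.bracket σ' τ m) u := by
        rw [map_add, LinearMap.add_apply, ContMDiffSection.coe_add, Pi.add_apply, map_add,
          LinearMap.add_apply]
      exact (congrArg₂ (· - ·) h h').trans (add_sub_add_comm _ _ _ _)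
    · intro φ σ
      have h := C.pullbackBracketAt_smul_left (I' := I) (f := id) (x := m) (b := C.anchor m)
        (s := σ) (t := τ) (φ.mdiffAt m) (secDiffAt_id m σ) u
      have h' := C.toPreCourant.leibniz_left φ σ τ m u
      refine (congrArg₂ (· - ·) h h').trans ?_
      simp only [T, smul_eq_mul, id]
      change _ - (φ m * C.metric m (C.bracket σ τ m) u -
        dR I φ m (C.anchor m (τ m)) * C.metric m (σ m) u +
        C.metric m (σ m) (τ m) * dR I φ m (C.anchor m u)) = _
      ring
    · intro i
      simp only [stdFrame_eq_extB]
      exact h1 _ τ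
  exact sub_eq_zero.1 h2

/-- If `b` lifts the anchor of `A`, then the pull-back of sections preserves brackets. -/
lemma pullbackBracketAt_comp {f : N → M} {x : N} {b : A (f x) →ₗ[ℝ] TangentSpace I' x}
    (hf : MDifferentiableAt I' I f x) (hb : ∀ v, mfderiv I' I f x (b v) = C.anchor (f x) v)
    (σ τ : Cₛ^∞⟮I; F, A⟯) :
    C.pullbackBracketAt f x b (fun y => σ (f y)) (fun y => τ (f y)) = C.bracket σ τ (f x) := by
  rw [← C.pullbackBracketAt_id (f x) σ τ]
  refine C.toPreCourant.metric_ext fun u => ?_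
  refine (C.metric_pullbackBracketAt u).trans (Eq.trans ?_
    (C.metric_pullbackBracketAt (f := id) (x := f x) u).symm)
  rw [nab_comp hf (secDiffAt_id (f x) τ), nab_comp hf (secDiffAt_id (f x) σ),
    nab_comp hf (secDiffAt_id (f x) σ), hb, hb, hb]
  rfl

end CourantAlgebroid

end Pullback

section Pullback

variable {E : Type*} [NormedAddCommGroup E] [NormedSpace ℝ E] [FiniteDimensional ℝ E]
  {H : Type*} [TopologicalSpace H]
  {M : Type*} [TopologicalSpace M] [T2Space M] [ChartedSpace H M] {I : ModelWithCorners ℝ E H}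
  [IsManifold I ∞ M]
  {F : Type*} [NormedAddCommGroup F] [NormedSpace ℝ F] [FiniteDimensional ℝ F]
  {A : M → Type*} [∀ m, AddCommGroup (A m)] [∀ m, Module ℝ (A m)]
  [TopologicalSpace (TotalSpace F A)] [∀ m, TopologicalSpace (A m)] [FiberBundle F A]
  [VectorBundle ℝ F A] [ContMDiffVectorBundle ∞ F A I]
  {E' : Type*} [NormedAddCommGroup E'] [NormedSpace ℝ E'] [FiniteDimensional ℝ E']
  {H' : Type*} [TopologicalSpace H']
  {N : Type*} [TopologicalSpace N] [T2Space N] [ChartedSpace H' N] {I' : ModelWithCorners ℝ E' H'}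
  [IsManifold I' ∞ N] {f : C^∞⟮I', N; I, M⟯}

lemma IsFrameAt.pullback {x : N} {k : ℕ} {e : Fin k → Cₛ^∞⟮I; F, A⟯} (he : IsFrameAt e (f x)) :
    IsFrameAt (fun i => pullbackSection f (e i)) x where
  linearIndependent := he.linearIndependent
  span := f.contMDiff.continuous.continuousAt.eventually he.span

lemma HasFrames.pullback {𝒢 : Set (Cₛ^∞⟮I; F, A⟯)} (h𝒢 : HasFrames 𝒢) :
    HasFrames (pullbackSection f '' 𝒢) := fun x => by
  obtain ⟨k, e, he, heG⟩ := h𝒢 (f x)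
  exact ⟨k, _, he.pullback, fun i => mem_image_of_mem _ (heG i)⟩

lemma secDiffAt_pullback (s : Cₛ^∞⟮I'; F, f *ᵖ A⟯) (x : N) : SecDiffAt F I' f x s := by
  have h := (contMDiffAt_section_iff_bcoord (I := I') (F := F) (B := f *ᵖ A)
    (FiberBundle.mem_baseSet_trivializationAt' x) s).1 (s.contMDiff x)
  refine MDifferentiableAt.congr_of_eventuallyEq (h.mdifferentiableAt (by simp)) ?_
  filter_upwards [eventually_mem_baseSet (F := F) (B := f *ᵖ A) x] with y hy
  have hy' : f y ∈ (trivializationAt F A (f x)).baseSet := hy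
  refine ((Trivialization.linearMapAt_apply (R := ℝ) (trivializationAt F A (f x)) (s y)).trans
    (if_pos hy')).trans (Eq.symm ?_)
  exact (Trivialization.linearMapAt_apply (R := ℝ) (trivializationAt F (f *ᵖ A) x) (s y)).trans
    (if_pos hy)

namespace CourantAlgebroid

variable (C : CourantAlgebroid I F A)

/-- Conditions under which an anchor `b : f^* A → TN` is the anchor of a Courant algebroid
structure on `f^* A` for which the pull-back of sections in `𝒢` preserves brackets. -/
structure IsPullbackAnchor (f : C^∞⟮I', N; I, M⟯) (b : ∀ x, A (f x) →ₗ[ℝ] TangentSpace I' x)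
    (𝒢 : Set (Cₛ^∞⟮I; F, A⟯)) : Prop where
  hasFrames : HasFrames 𝒢
  contMDiff : ∀ σ ∈ 𝒢,
    ContMDiff I' I'.tangent ∞ (fun x => (⟨x, b x (σ (f x))⟩ : TangentBundle I' N))
  lift : ∀ x v, mfderiv I' I f x (b x v) = C.anchor (f x) v
  coisotropic : ∀ (x : N) (w : A (f x)) (ξ : TangentSpace I' x →ₗ[ℝ] ℝ),
    (∀ u, C.metric (f x) w u = ξ (b x u)) → b x w = 0
  hom : ∀ σ ∈ 𝒢, ∀ τ ∈ 𝒢, ∀ (φ : C^∞⟮I', N; 𝓘(ℝ, ℝ), ℝ⟯) (x : N),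
    dR I' φ x (b x (C.bracket σ τ (f x))) =
      dR I' (fun y => dR I' φ y (b y (τ (f y)))) x (b x (σ (f x))) -
      dR I' (fun y => dR I' φ y (b y (σ (f y)))) x (b x (τ (f x)))

variable {C} {b : ∀ x, A (f x) →ₗ[ℝ] TangentSpace I' x} {𝒢 : Set (Cₛ^∞⟮I; F, A⟯)}

lemma IsPullbackAnchor.contMDiff_anchor (h : C.IsPullbackAnchor f b 𝒢) :
    ContMDiff (I'.prod 𝓘(ℝ, F)) I'.tangent ∞
    (fun v : TotalSpace F (f *ᵖ A) => (⟨v.proj, b v.proj v.snd⟩ : TangentBundle I' N)) := by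
  refine contMDiff_bundleMap (B := f *ᵖ A) fun x => ?_
  obtain ⟨k, e, he, heG⟩ := h.hasFrames (f x)
  exact ⟨k, _, he.pullback, fun i => h.contMDiff _ (heG i)⟩

/-- The vector field `b(s)`. -/
def IsPullbackAnchor.vf (h : C.IsPullbackAnchor f b 𝒢) (s : Cₛ^∞⟮I'; F, f *ᵖ A⟯) :
    Cₛ^∞⟮I'; E', (TangentSpace I' : N → Type _)⟯ where
  toFun y := b y (s y)
  contMDiff_toFun := h.contMDiff_anchor.comp s.contMDiff

lemma IsPullbackAnchor.contMDiff_metric (h : C.IsPullbackAnchor f b 𝒢)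
    (s t : Cₛ^∞⟮I'; F, f *ᵖ A⟯) :
    ContMDiff I' 𝓘(ℝ, ℝ) ∞ (fun x => C.metric (f x) (s x) (t x)) := by
  intro x
  obtain ⟨k, e, he, -⟩ := h.hasFrames (f x)
  have hcut (s t : Cₛ^∞⟮I'; F, f *ᵖ A⟯) (ρ : C^∞⟮I', N; 𝓘(ℝ, ℝ), ℝ⟯) (hρ : ∀ᶠ y in 𝓝 x, ρ y = 1)
      (hs : ContMDiffAt I' 𝓘(ℝ, ℝ) ∞ (fun y => C.metric (f y) (ρ y • s y : A (f y)) (t y)) x) :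
      ContMDiffAt I' 𝓘(ℝ, ℝ) ∞ (fun y => C.metric (f y) (s y) (t y)) x := by
    refine hs.congr_of_eventuallyEq ?_
    filter_upwards [hρ] with y hy
    rw [hy, one_smul]
  have hcomm (s t : Cₛ^∞⟮I'; F, f *ᵖ A⟯)
      (hs : ContMDiffAt I' 𝓘(ℝ, ℝ) ∞ (fun y => C.metric (f y) (s y) (t y)) x) :
      ContMDiffAt I' 𝓘(ℝ, ℝ) ∞ (fun y => C.metric (f y) (t y) (s y)) x :=
    hs.congr_of_eventuallyEq (Filter.Eventually.of_forall fun y => C.metric_symm _ _ _)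
  have ind (t : Cₛ^∞⟮I'; F, f *ᵖ A⟯) (ht : ∀ i, ContMDiffAt I' 𝓘(ℝ, ℝ) ∞
      (fun y => C.metric (f y) (e i (f y)) (t y)) x) (s : Cₛ^∞⟮I'; F, f *ᵖ A⟯) :
      ContMDiffAt I' 𝓘(ℝ, ℝ) ∞ (fun y => C.metric (f y) (s y) (t y)) x := by
    refine he.pullback.induction (P := fun s => ContMDiffAt I' 𝓘(ℝ, ℝ) ∞
      (fun y => C.metric (f y) (s y) (t y)) x) ?_ ?_ ?_ ?_ ht s
    · refine (contMDiffAt_const (c := (0 : ℝ))).congr_of_eventuallyEq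
        (Filter.Eventually.of_forall fun y => ?_)
      exact congrArg (fun l => l (t y)) (map_zero (C.metric (f y)))
    · intro s s' hs hs'
      refine (hs.add hs').congr_of_eventuallyEq (Filter.Eventually.of_forall fun y => ?_)
      exact congrArg (fun l => l (t y)) (map_add (C.metric (f y)) (s y) (s' y))
    · intro φ s hs
      refine ((φ.contMDiff x).mul hs).congr_of_eventuallyEq
        (Filter.Eventually.of_forall fun y => ?_)
      exact congrArg (fun l => l (t y)) (map_smul (C.metric (f y)) (φ y) (s y))
    · intro ρ s hρ hs
      exact hcut s t ρ hρ hs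
  refine ind t (fun i => hcomm t (pullbackSection f (e i)) (ind _ (fun j => ?_) t)) s
  exact (C.contMDiff_metric (e j) (e i)).comp f.contMDiff x

lemma IsPullbackAnchor.pullbackBracketAt_comp (h : C.IsPullbackAnchor f b 𝒢)
    (σ τ : Cₛ^∞⟮I; F, A⟯) (x : N) :
    C.pullbackBracketAt f x (b x) (pullbackSection f σ) (pullbackSection f τ) =
      C.bracket σ τ (f x) :=
  C.pullbackBracketAt_comp (f.contMDiff.mdifferentiableAt (by simp)) (h.lift x) σ τ

/-- The products of the bracket with sections are smooth. The formula defining the bracket uses at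
each point another trivialization; smoothness follows from the Leibniz rules, as the bracket of
pull-backs is the pull-back of a bracket. -/
lemma IsPullbackAnchor.eventually_contMDiffAt (h : C.IsPullbackAnchor f b 𝒢)
    (s t u : Cₛ^∞⟮I'; F, f *ᵖ A⟯) (x : N) :
    ∀ᶠ y in 𝓝 x, ContMDiffAt I' 𝓘(ℝ, ℝ) ∞
      (fun y => C.metric (f y) (C.pullbackBracketAt f y (b y) s t) (u y)) y := by
  obtain ⟨k, e, he, -⟩ := h.hasFrames (f x)
  let P (s t : Cₛ^∞⟮I'; F, f *ᵖ A⟯) : Prop := ∀ᶠ y in 𝓝 x, ContMDiffAt I' 𝓘(ℝ, ℝ) ∞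
      (fun y => C.metric (f y) (C.pullbackBracketAt f y (b y) s t) (u y)) y
  have hdR (φ : C^∞⟮I', N; 𝓘(ℝ, ℝ), ℝ⟯) (s : Cₛ^∞⟮I'; F, f *ᵖ A⟯) (y : N) :
      ContMDiffAt I' 𝓘(ℝ, ℝ) ∞ (fun y => dR I' φ y (b y (s y))) y :=
    (lieD (h.vf s) φ).contMDiff y
  have hloc {s t s' t' : Cₛ^∞⟮I'; F, f *ᵖ A⟯} (hP : P s t) (hEq : ∀ᶠ y in 𝓝 x,
      C.metric (f y) (C.pullbackBracketAt f y (b y) s t) (u y) =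
      C.metric (f y) (C.pullbackBracketAt f y (b y) s' t') (u y)) : P s' t' := by
    filter_upwards [hP, hEq.eventually_nhds] with y h1 h2
    exact h1.congr_of_eventuallyEq (h2.mono fun _ h => h.symm)
  have hr (s : Cₛ^∞⟮I'; F, f *ᵖ A⟯) (hs : ∀ i, P s (pullbackSection f (e i)))
      (t : Cₛ^∞⟮I'; F, f *ᵖ A⟯) : P s t := by
    refine he.pullback.induction (P := P s) ?_ ?_ ?_ ?_ hs t
    · refine Filter.Eventually.of_forall fun y => contMDiffAt_const (c := (0 : ℝ))
        |>.congr_of_eventuallyEq (Filter.Eventually.of_forall fun y => ?_)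
      have h1 := C.pullbackBracketAt_add_right (b := b y) (s := s)
        (secDiffAt_pullback (0 : Cₛ^∞⟮I'; F, f *ᵖ A⟯) y)
        (secDiffAt_pullback (0 : Cₛ^∞⟮I'; F, f *ᵖ A⟯) y) (u y)
      have h2 : (fun y => (0 : Cₛ^∞⟮I'; F, f *ᵖ A⟯) y + (0 : Cₛ^∞⟮I'; F, f *ᵖ A⟯) y) =
        (0 : Cₛ^∞⟮I'; F, f *ᵖ A⟯) := funext fun y => add_zero (0 : A (f y))
      erw [h2] at h1
      exact left_eq_add.1 h1
    · intro t t' ht ht'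
      filter_upwards [ht, ht'] with y hy hy'
      refine (hy.add hy').congr_of_eventuallyEq (Filter.Eventually.of_forall fun z => ?_)
      exact C.pullbackBracketAt_add_right (secDiffAt_pullback t z) (secDiffAt_pullback t' z) (u z)
    · intro φ t ht
      filter_upwards [ht] with y hy
      refine (((φ.contMDiff y).mul hy).add ((hdR φ s y).mul
        (h.contMDiff_metric t u y))).congr_of_eventuallyEq (Filter.Eventually.of_forall fun z => ?_)
      exact C.pullbackBracketAt_smul_right (φ.mdiffAt z) (secDiffAt_pullback t z) (u z)
    · intro ρ t hρ ht
      refine hloc ht ?_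
      filter_upwards [hρ.eventually_nhds] with y hy
      refine (C.pullbackBracketAt_smul_right (ρ.mdiffAt y) (secDiffAt_pullback t y) (u y)).trans ?_
      rw [hy.self_of_nhds, dR_eq_zero_of_eventually hy]
      simp
  have hl (t : Cₛ^∞⟮I'; F, f *ᵖ A⟯) (ht : ∀ i, P (pullbackSection f (e i)) t)
      (s : Cₛ^∞⟮I'; F, f *ᵖ A⟯) : P s t := by
    refine he.pullback.induction (P := fun s => P s t) ?_ ?_ ?_ ?_ ht s
    · refine Filter.Eventually.of_forall fun y => contMDiffAt_const (c := (0 : ℝ))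
        |>.congr_of_eventuallyEq (Filter.Eventually.of_forall fun y => ?_)
      have h1 := C.pullbackBracketAt_add_left (b := b y) (t := t)
        (secDiffAt_pullback (0 : Cₛ^∞⟮I'; F, f *ᵖ A⟯) y)
        (secDiffAt_pullback (0 : Cₛ^∞⟮I'; F, f *ᵖ A⟯) y) (u y)
      have h2 : (fun y => (0 : Cₛ^∞⟮I'; F, f *ᵖ A⟯) y + (0 : Cₛ^∞⟮I'; F, f *ᵖ A⟯) y) =
        (0 : Cₛ^∞⟮I'; F, f *ᵖ A⟯) := funext fun y => add_zero (0 : A (f y))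
      erw [h2] at h1
      exact left_eq_add.1 h1
    · intro s s' hs hs'
      filter_upwards [hs, hs'] with y hy hy'
      refine (hy.add hy').congr_of_eventuallyEq (Filter.Eventually.of_forall fun z => ?_)
      exact C.pullbackBracketAt_add_left (secDiffAt_pullback s z) (secDiffAt_pullback s' z) (u z)
    · intro φ s hs
      filter_upwards [hs] with y hy
      refine ((((φ.contMDiff y).mul hy).sub ((hdR φ t y).mul (h.contMDiff_metric s u y))).add
        ((h.contMDiff_metric s t y).mul (hdR φ u y))).congr_of_eventuallyEq
        (Filter.Eventually.of_forall fun z => ?_)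
      exact C.pullbackBracketAt_smul_left (φ.mdiffAt z) (secDiffAt_pullback s z) (u z)
    · intro ρ s hρ hs
      refine hloc hs ?_
      filter_upwards [hρ.eventually_nhds] with y hy
      refine (C.pullbackBracketAt_smul_left (ρ.mdiffAt y) (secDiffAt_pullback s y) (u y)).trans ?_
      rw [hy.self_of_nhds, dR_eq_zero_of_eventually hy]
      simp
  refine hl t (fun i => hr _ (fun j => Filter.Eventually.of_forall fun y => ?_) t) s
  refine (h.contMDiff_metric (pullbackSection f (C.bracket (e i) (e j))) u y).congr_of_eventuallyEq
    (Filter.Eventually.of_forall fun z => ?_)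
  exact congrArg (fun v => C.metric (f z) v (u z)) (h.pullbackBracketAt_comp (e i) (e j) z)

/-- The section of `f^* A` with the values `pullbackBracketAt`: the bracket of two sections. -/
def IsPullbackAnchor.bracketSec (h : C.IsPullbackAnchor f b 𝒢) (s t : Cₛ^∞⟮I'; F, f *ᵖ A⟯) :
    Cₛ^∞⟮I'; F, f *ᵖ A⟯ where
  toFun x := C.pullbackBracketAt f x (b x) s t
  contMDiff_toFun := fun x => contMDiffAt_of_metric (B := f *ᵖ A)
    (g := fun x => C.metric (f x)) (C.metric_nondegenerate (f x)) h.contMDiff_metric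
    fun u => h.eventually_contMDiffAt s t u x

/-- The pull-back `f^* A`, with anchor `b`. -/
def IsPullbackAnchor.preCourant (h : C.IsPullbackAnchor f b 𝒢) : PreCourant I' F (f *ᵖ A) where
  metric x := C.metric (f x)
  anchor := b
  bracket := LinearMap.mk₂ ℝ h.bracketSec
    (fun s s' t => by
      ext x
      refine C.toPreCourant.metric_ext (x := f x) fun u => ?_
      refine (C.pullbackBracketAt_add_left (secDiffAt_pullback s x) (secDiffAt_pullback s' x)
        u).trans ?_
      exact (congrArg (fun l => l u) (map_add (C.metric (f x)) _ _)).symm)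
    (fun c s t => by
      ext x
      refine C.toPreCourant.metric_ext (x := f x) fun u => ?_
      refine (C.pullbackBracketAt_smul_left (φ := fun _ => c) mdifferentiableAt_const
        (secDiffAt_pullback s x) u).trans ?_
      rw [dR_const]
      refine Eq.trans ?_ (congrArg (fun l => l u) (map_smul (C.metric (f x)) c _)).symm
      simp only [zero_mul, sub_zero, add_zero, mul_zero, LinearMap.zero_apply]
      rfl)
    (fun s t t' => by
      ext x
      refine C.toPreCourant.metric_ext (x := f x) fun u => ?_
      refine (C.pullbackBracketAt_add_right (secDiffAt_pullback t x) (secDiffAt_pullback t' x)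
        u).trans ?_
      exact (congrArg (fun l => l u) (map_add (C.metric (f x)) _ _)).symm)
    (fun c s t => by
      ext x
      refine C.toPreCourant.metric_ext (x := f x) fun u => ?_
      refine (C.pullbackBracketAt_smul_right (φ := fun _ => c) mdifferentiableAt_const
        (secDiffAt_pullback t x) u).trans ?_
      rw [dR_const]
      refine Eq.trans ?_ (congrArg (fun l => l u) (map_smul (C.metric (f x)) c _)).symm
      simp only [zero_mul, add_zero, LinearMap.zero_apply]
      rfl)
  metric_symm x := C.metric_symm (f x)
  metric_nondegenerate x := C.metric_nondegenerate (f x)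
  contMDiff_metric := h.contMDiff_metric
  contMDiff_anchor := h.contMDiff_anchor
  leibniz_right s φ t x := by
    refine C.toPreCourant.metric_ext (x := f x) fun u => ?_
    refine (C.pullbackBracketAt_smul_right (φ.mdiffAt x) (secDiffAt_pullback t x) u).trans ?_
    refine Eq.trans ?_ (congrArg (fun l => l u) (map_add (C.metric (f x)) _ _)).symm
    exact congrArg₂ (· + ·) (congrArg (fun l => l u) (map_smul (C.metric (f x)) _ _)).symm
      (congrArg (fun l => l u) (map_smul (C.metric (f x)) _ _)).symm
  leibniz_left φ s t x u :=
    C.pullbackBracketAt_smul_left (φ.mdiffAt x) (secDiffAt_pullback s x) u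

lemma IsPullbackAnchor.bracket_pullback (h : C.IsPullbackAnchor f b 𝒢)
    (σ τ : Cₛ^∞⟮I; F, A⟯) :
    h.preCourant.bracket (pullbackSection f σ) (pullbackSection f τ) =
      pullbackSection f (C.bracket σ τ) := by
  ext x
  exact h.pullbackBracketAt_comp σ τ x

/-- Pull-back of a Courant algebroid structure to `f^* A`, given the anchor: pull-back sections
generate, and on these the axioms are those of `A`. -/
theorem IsPullbackAnchor.exists_courantAlgebroid (h : C.IsPullbackAnchor f b 𝒢) :
    ∃ C' : CourantAlgebroid I' F (f *ᵖ A),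
    (∀ (x : N) (v w : A (f x)), C'.metric x v w = C.metric (f x) v w) ∧
    (∀ (x : N) (v : A (f x)), C'.anchor x v = b x v) ∧
    ∀ σ τ : Cₛ^∞⟮I; F, A⟯, C'.bracket (pullbackSection f σ) (pullbackSection f τ) =
      pullbackSection f (C.bracket σ τ) := by
  have hf (x : N) : MDifferentiableAt I' I f x := f.contMDiff.mdifferentiableAt (by simp)
  -- the derivative of a pulled back function along `b`
  have hd (φ : C^∞⟮I, M; 𝓘(ℝ, ℝ), ℝ⟯) (x : N) (v : A (f x)) :
      dR I' (fun y => φ (f y)) x (b x v) = dR I φ (f x) (C.anchor (f x) v) := by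
    rw [dR_comp (φ.mdiffAt (f x)) (hf x), h.lift]
  let Q := h.preCourant
  have hb (σ τ : Cₛ^∞⟮I; F, A⟯) : Q.bracket (pullbackSection f σ) (pullbackSection f τ) =
    pullbackSection f (C.bracket σ τ) := h.bracket_pullback σ τ
  refine ⟨Q.toCourantAlgebroid (𝒢 := pullbackSection f '' 𝒢) h.hasFrames.pullback ?_ ?_
    h.coisotropic ?_ ?_, fun _ _ _ => rfl, fun _ _ => rfl, hb⟩
  · rintro _ ⟨σ, -, rfl⟩ _ ⟨τ₁, -, rfl⟩ _ ⟨τ₂, -, rfl⟩ x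
    rw [hb, hb]
    exact (hd (C.toPreCourant.pair τ₁ τ₂) x (σ (f x))).trans (C.anchor_metric σ τ₁ τ₂ (f x))
  · rintro _ ⟨τ₁, -, rfl⟩ _ ⟨τ₂, -, rfl⟩
    unfold PreCourant.SkewUpToD
    rw [hb, hb]
    ext x
    refine Q.metric_ext fun u => ?_
    rw [Q.metric_D]
    exact (C.bracket_symm τ₁ τ₂ (f x) u).trans (hd (C.toPreCourant.pair τ₁ τ₂) x u).symm
  · rintro _ ⟨σ, hσ, rfl⟩ _ ⟨τ, hτ, rfl⟩ φ x
    rw [hb]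
    exact h.hom σ hσ τ hτ φ x
  · rintro _ ⟨σ, -, rfl⟩ _ ⟨τ₁, -, rfl⟩ _ ⟨τ₂, -, rfl⟩
    rw [PreCourant.jac, hb, hb, hb, hb, hb, hb, C.jacobi σ τ₁ τ₂, sub_sub, sub_eq_zero]
    rfl

/-- A Courant algebroid structure on `f^* A` is determined by its metric, its anchor, and the
brackets of pull-back sections. -/
lemma eq_of_pullback {C₁ C₂ : CourantAlgebroid I' F (f *ᵖ A)}
    (hm : ∀ (x : N) (v w : A (f x)), C₁.metric x v w = C₂.metric x v w)
    (ha : ∀ (x : N) (v : A (f x)), C₁.anchor x v = C₂.anchor x v)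
    (hb : ∀ σ τ : Cₛ^∞⟮I; F, A⟯, C₁.bracket (pullbackSection f σ) (pullbackSection f τ) =
      C₂.bracket (pullbackSection f σ) (pullbackSection f τ)) : C₁ = C₂ := by
  refine eq_of_generators (funext fun x => LinearMap.ext fun v => LinearMap.ext fun w => hm x v w)
    (funext fun x => LinearMap.ext fun v => ha x v) (hasFrames_univ I F A).pullback ?_
  rintro _ ⟨σ, -, rfl⟩ _ ⟨τ, -, rfl⟩
  exact hb σ τ

end CourantAlgebroid

end Pullback

/-! ### The restriction of a Courant algebroid to an immersed submanifold -/

section Restriction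

variable {E : Type*} [NormedAddCommGroup E] [NormedSpace ℝ E] [FiniteDimensional ℝ E]
  {M : Type*} [TopologicalSpace M] [T2Space M] [ChartedSpace E M] [IsManifold 𝓘(ℝ, E) ∞ M]
  {ES : Type*} [NormedAddCommGroup ES] [NormedSpace ℝ ES] [FiniteDimensional ℝ ES]
  {S : Type*} [TopologicalSpace S] [T2Space S] [ChartedSpace ES S] [IsManifold 𝓘(ℝ, ES) ∞ S]
  {F : Type*} [NormedAddCommGroup F] [NormedSpace ℝ F] [FiniteDimensional ℝ F]
  {ι : C^∞⟮𝓘(ℝ, ES), S; 𝓘(ℝ, E), M⟯}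
  (hι : IsImmersionOfComplement F 𝓘(ℝ, ES) 𝓘(ℝ, E) ∞ ι)

namespace NormalBundle

include hι in
lemma mfderiv_injective (s : S) : Injective (mfderiv 𝓘(ℝ, ES) 𝓘(ℝ, E) ι s) := by
  have hs := (hι s).mem_domChart_source
  refine (injective_iff_map_eq_zero _).2 fun v hv => ?_
  have h := mfderiv_chart_comp hι s hs v
  rw [hv] at h
  have h0 : ((hι s).equiv (mfderiv 𝓘(ℝ, ES) 𝓘(ℝ, ES) (hι s).domChart s v, 0) : E) = 0 :=
    h.symm.trans (map_zero _)
  have h1 := (hι s).equiv.map_eq_zero_iff.1 h0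
  exact (injective_iff_map_eq_zero _).1 ((domChart_mdiff hι s).mfderiv_injective hs) v
    (congrArg Prod.fst h1)

/-- The coordinates `M ⊃ U → ES × F` given by the slice chart around `s`, in which `S` is locally
given by `ES × {0}`. -/
def sliceCoord (s : S) (m : M) : ES × F := (hι s).equiv.symm ((hι s).codChart m)

lemma sliceCoord_comp (s : S) {t : S} (ht : t ∈ (hι s).domChart.source) :
    sliceCoord hι s (ι t) = ((hι s).domChart t, 0) := by
  unfold sliceCoord
  rw [chart_eq hι s ht, ContinuousLinearEquiv.symm_apply_apply]

lemma contMDiffAt_sliceCoord (s : S) {m : M} (hm : m ∈ (hι s).codChart.source) :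
    ContMDiffAt 𝓘(ℝ, E) 𝓘(ℝ, ES × F) ∞ (sliceCoord hι s) m :=
  ((hι s).equiv.symm.contDiff.contMDiff.contMDiffAt).comp m
    ((contMDiffOn_of_mem_maximalAtlas (hι s).codChart_mem_maximalAtlas).contMDiffAt
      ((hι s).codChart.open_source.mem_nhds hm))

lemma eventually_mem_domChart (s : S) : ∀ᶠ t in 𝓝 s, t ∈ (hι s).domChart.source :=
  (hι s).domChart.open_source.mem_nhds (hι s).mem_domChart_source

lemma eventually_mem_codChart (s : S) : ∀ᶠ m in 𝓝 (ι s), m ∈ (hι s).codChart.source :=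
  (hι s).codChart.open_source.mem_nhds
    ((hι s).source_subset_preimage_source (hι s).mem_domChart_source)

include hι in
/-- Functions on `S` extend locally to `M`. -/
lemma exists_extension (φ : C^∞⟮𝓘(ℝ, ES), S; 𝓘(ℝ, ℝ), ℝ⟯) (s : S) :
    ∃ f : C^∞⟮𝓘(ℝ, E), M; 𝓘(ℝ, ℝ), ℝ⟯, ∀ᶠ t in 𝓝 s, f (ι t) = φ t := by
  have hcod := eventually_mem_codChart hι s
  have hs := (hι s).mem_domChart_source
  have hcont : ContinuousAt (fun m => (sliceCoord hι s m).1) (ι s) :=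
    continuous_fst.continuousAt.comp (contMDiffAt_sliceCoord hι s hcod.self_of_nhds).continuousAt
  have htar : ∀ᶠ m in 𝓝 (ι s), (sliceCoord hι s m).1 ∈ (hι s).domChart.target := by
    refine hcont.eventually ((hι s).domChart.open_target.mem_nhds ?_)
    change (sliceCoord hι s (ι s)).1 ∈ (hι s).domChart.target
    have h := congrArg Prod.fst (sliceCoord_comp hι s hs)
    exact h ▸ (hι s).domChart.map_source hs
  obtain ⟨f, hf⟩ := exists_function_eventuallyEq (I := 𝓘(ℝ, E)) (x := ι s)
    (φ := fun m => φ ((hι s).domChart.symm (sliceCoord hι s m).1)) (by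
      filter_upwards [hcod, htar] with m hm hm'
      have h1 : ContMDiffAt 𝓘(ℝ, E) 𝓘(ℝ, ES) ∞ (fun m => (sliceCoord hι s m).1) m :=
        contDiff_fst.contMDiff.contMDiffAt.comp m (contMDiffAt_sliceCoord hι s hm)
      have h2 : ContMDiffAt 𝓘(ℝ, ES) 𝓘(ℝ, ES) ∞ (hι s).domChart.symm (sliceCoord hι s m).1 :=
        (contMDiffOn_symm_of_mem_maximalAtlas (hι s).domChart_mem_maximalAtlas).contMDiffAt
          ((hι s).domChart.open_target.mem_nhds hm')
      exact (φ.contMDiff _).comp m (h2.comp m h1))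
  refine ⟨f, ?_⟩
  filter_upwards [ι.contMDiff.continuous.continuousAt.eventually hf, eventually_mem_domChart hι s]
    with t ht ht'
  rw [ht, sliceCoord_comp hι s ht', (hι s).domChart.left_inv ht']

/-- Linear forms in the coordinates normal to `S`, extended to functions on `M`. -/
lemma exists_normalCoord (μ : F →L[ℝ] ℝ) (s : S) : ∃ f : C^∞⟮𝓘(ℝ, E), M; 𝓘(ℝ, ℝ), ℝ⟯,
    ∀ᶠ m in 𝓝 (ι s), f m = μ (sliceCoord hι s m).2 := by
  refine exists_function_eventuallyEq (I := 𝓘(ℝ, E)) ?_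
  filter_upwards [eventually_mem_codChart hι s] with m hm
  have h1 : ContMDiffAt 𝓘(ℝ, E) 𝓘(ℝ, F) ∞ (fun m => (sliceCoord hι s m).2) m :=
    contDiff_snd.contMDiff.contMDiffAt.comp m (contMDiffAt_sliceCoord hι s hm)
  exact μ.contDiff.contMDiff.contMDiffAt.comp m h1

end NormalBundle

lemma mdifferentiableAt_coe {E' : Type*} [NormedAddCommGroup E'] [NormedSpace ℝ E'] {N : Type*}
    [TopologicalSpace N] [ChartedSpace E' N] (g : C^∞⟮𝓘(ℝ, E'), N; 𝓘(ℝ, E), M⟯) (x : N) :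
    MDifferentiableAt 𝓘(ℝ, E') 𝓘(ℝ, E) g x := g.contMDiff.mdifferentiableAt (by simp)

variable {FA : Type*} [NormedAddCommGroup FA] [NormedSpace ℝ FA] [FiniteDimensional ℝ FA]
  {A : M → Type*} [∀ m, AddCommGroup (A m)] [∀ m, Module ℝ (A m)]
  [TopologicalSpace (TotalSpace FA A)] [∀ m, TopologicalSpace (A m)] [FiberBundle FA A]
  [VectorBundle ℝ FA A] [ContMDiffVectorBundle ∞ FA A 𝓘(ℝ, E)]
  (C : CourantAlgebroid 𝓘(ℝ, E) FA A)
  (ha : ∀ (s : S) (v : A (ι s)), C.anchor (ι s) v ∈ NormalBundle.tangentRange ι s)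

namespace CourantAlgebroid

open NormalBundle

/-- The anchor of `A|_S`: the anchor of `A`, which takes values in `TS = dι(TS)` along `S`. -/
def restrAnchor (s : S) : A (ι s) →ₗ[ℝ] TangentSpace 𝓘(ℝ, ES) s :=
  (LinearEquiv.ofInjective (mfderiv 𝓘(ℝ, ES) 𝓘(ℝ, E) ι s).toLinearMap
    (mfderiv_injective hι s)).symm.toLinearMap.comp
      ((C.anchor (ι s)).codRestrict (tangentRange ι s) (ha s))

lemma mfderiv_restrAnchor (s : S) (v : A (ι s)) :
    mfderiv 𝓘(ℝ, ES) 𝓘(ℝ, E) ι s (C.restrAnchor hι ha s v) = C.anchor (ι s) v := by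
  have h := LinearEquiv.apply_symm_apply (LinearEquiv.ofInjective
    (mfderiv 𝓘(ℝ, ES) 𝓘(ℝ, E) ι s).toLinearMap (mfderiv_injective hι s))
    ((C.anchor (ι s)).codRestrict (tangentRange ι s) (ha s) v)
  exact congrArg Subtype.val h

/-- The derivative along `S` of a function that is locally the restriction of a function on `M`. -/
lemma dR_restrAnchor {φ : S → ℝ} {f : C^∞⟮𝓘(ℝ, E), M; 𝓘(ℝ, ℝ), ℝ⟯} {s : S}
    (hf : ∀ᶠ t in 𝓝 s, f (ι t) = φ t) (v : A (ι s)) :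
    dR 𝓘(ℝ, ES) φ s (C.restrAnchor hι ha s v) = dR 𝓘(ℝ, E) f (ι s) (C.anchor (ι s) v) := by
  rw [← dR_congr hf, dR_comp (f.mdiffAt _) (mdifferentiableAt_coe ι s), mfderiv_restrAnchor]

/-- The restricted anchor inherits its properties from the anchor of `A`, as functions on `S` extend
locally to `M` and covectors on `S` extend to `M`. -/
lemma isPullbackAnchor_restrAnchor :
    C.IsPullbackAnchor ι (C.restrAnchor hι ha) univ where
  hasFrames := hasFrames_univ _ _ _
  contMDiff σ _ s := by
    refine contMDiffAt_vectorField_of_separating (𝓕 := univ)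
      (fun v hv => eq_zero_of_dR_eq_zero fun φ => hv φ trivial) fun φ _ => ?_
    obtain ⟨f, hf⟩ := exists_extension hι φ s
    filter_upwards [hf.eventually_nhds] with t ht
    refine (((C.toPreCourant.act σ f).contMDiff (ι t)).comp t
      (ι.contMDiff t)).congr_of_eventuallyEq ?_
    filter_upwards [ht.eventually_nhds] with t ht
    exact C.dR_restrAnchor hι ha ht _
  lift := C.mfderiv_restrAnchor hι ha
  coisotropic s w ξ hw := by
    obtain ⟨Λ, hΛ⟩ := (mfderiv 𝓘(ℝ, ES) 𝓘(ℝ, E) ι s).toLinearMap.exists_leftInverse_of_injective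
      (LinearMap.ker_eq_bot.2 (mfderiv_injective hι s))
    refine mfderiv_injective hι s ((C.mfderiv_restrAnchor hι ha s w).trans (Eq.trans ?_
      (map_zero _).symm))
    refine C.isCoisotropic (ι s) w (ξ.comp Λ) fun u => (hw u).trans ?_
    have h := congrArg (fun T => T (C.restrAnchor hι ha s u)) hΛ
    have h2 : Λ (C.anchor (ι s) u) = C.restrAnchor hι ha s u :=
      (congrArg Λ (C.mfderiv_restrAnchor hι ha s u)).symm.trans h
    exact (congrArg ξ h2).symm
  hom σ _ τ _ φ s := by
    obtain ⟨f, hf⟩ := exists_extension hι φ s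
    have h (σ : Cₛ^∞⟮𝓘(ℝ, E); FA, A⟯) : ∀ᶠ t in 𝓝 s, C.toPreCourant.act σ f (ι t) =
        dR 𝓘(ℝ, ES) φ t (C.restrAnchor hι ha t (σ (ι t))) := by
      filter_upwards [hf.eventually_nhds] with t ht
      exact (C.dR_restrAnchor hι ha ht _).symm
    rw [C.dR_restrAnchor hι ha hf, C.dR_restrAnchor hι ha (h τ), C.dR_restrAnchor hι ha (h σ)]
    exact C.anchorHom σ τ f (ι s)

include hι ha in
lemma exists_isRestriction :
    ∃ AS : CourantAlgebroid 𝓘(ℝ, ES) FA (ι *ᵖ A), C.IsRestriction AS := by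
  obtain ⟨AS, h1, h2, h3⟩ := (C.isPullbackAnchor_restrAnchor hι ha).exists_courantAlgebroid
  exact ⟨AS, h1, fun s v => by rw [h2, mfderiv_restrAnchor], h3⟩

variable {C}

include hι in
lemma IsRestriction.unique {AS AS' : CourantAlgebroid 𝓘(ℝ, ES) FA (ι *ᵖ A)}
    (h : C.IsRestriction AS) (h' : C.IsRestriction AS') : AS' = AS := by
  refine eq_of_pullback (fun s v w => ?_) (fun s v => mfderiv_injective hι s ?_) fun σ τ => ?_
  · rw [h.metric_eq, h'.metric_eq]
  · exact (h'.anchor_eq s v).trans (h.anchor_eq s v).symm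
  · rw [h.bracket_eq, h'.bracket_eq]

end CourantAlgebroid

end Restriction

/-! ### Functions on the normal bundle -/

section Normal

variable {E : Type*} [NormedAddCommGroup E] [NormedSpace ℝ E] [FiniteDimensional ℝ E]
  {M : Type*} [TopologicalSpace M] [T2Space M] [ChartedSpace E M] [IsManifold 𝓘(ℝ, E) ∞ M]
  {ES : Type*} [NormedAddCommGroup ES] [NormedSpace ℝ ES] [FiniteDimensional ℝ ES]
  {S : Type*} [TopologicalSpace S] [T2Space S] [ChartedSpace ES S] [IsManifold 𝓘(ℝ, ES) ∞ S]
  {F : Type*} [NormedAddCommGroup F] [NormedSpace ℝ F] [FiniteDimensional ℝ F]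
  {ι : C^∞⟮𝓘(ℝ, ES), S; 𝓘(ℝ, E), M⟯}
  (hι : IsImmersionOfComplement F 𝓘(ℝ, ES) 𝓘(ℝ, E) ∞ ι)

instance {B : Type*} [TopologicalSpace B] [T2Space B] {F : Type*} [TopologicalSpace F] [T2Space F]
    {V : B → Type*} [TopologicalSpace (TotalSpace F V)] [∀ b, TopologicalSpace (V b)]
    [FiberBundle F V] : T2Space (TotalSpace F V) where
  t2 x y hxy := by
    by_cases hp : x.proj = y.proj
    · let e := trivializationAt F V x.proj
      have hx : x ∈ e.source := FiberBundle.mem_trivializationAt_proj_source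
      have hy : y ∈ e.source := by rw [e.mem_source, ← hp, ← e.mem_source]; exact hx
      obtain ⟨U, W, hU, hW, hxU, hyW, hd⟩ := t2_separation (e.injOn.ne hx hy hxy)
      exact ⟨_, _, e.continuousOn.isOpen_inter_preimage e.open_source hU,
        e.continuousOn.isOpen_inter_preimage e.open_source hW, ⟨hx, hxU⟩, ⟨hy, hyW⟩,
        (hd.preimage e).mono inter_subset_right inter_subset_right⟩
    · obtain ⟨U, W, hU, hW, hxU, hyW, hd⟩ := t2_separation hp
      have hc : Continuous (fun z : TotalSpace F V => z.proj) := FiberBundle.continuous_proj F V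
      exact ⟨_, _, hU.preimage hc, hW.preimage hc, hxU, hyW, hd.preimage _⟩

namespace NormalBundle

lemma mk_surjective (s : S) : Surjective (mk hι s) := (tangentRange ι s).mkQ_surjective

/-- The fibre coordinate of a point of the normal bundle, given by the slice chart around `s`. -/
def fiberCoord (s : S) (y : NormalTotal hι) : F := (trivializationAt F (NormalFiber hι) s y).2

lemma fiberCoord_mk (s : S) {t : S} (ht : t ∈ (hι s).domChart.source)
    (u : TangentSpace 𝓘(ℝ, E) (ι t)) :
    fiberCoord hι s ⟨t, mk hι t u⟩ = normalComp hι s t u :=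
  congrArg Prod.snd (pretriv_apply hι s ht (mk hι t u))

lemma mk_normalLift (s : S) {y : NormalTotal hι} (hy : y.proj ∈ (hι s).domChart.source) :
    mk hι y.proj (normalLift hι s y.proj (fiberCoord hι s y)) = y.snd := by
  obtain ⟨t, z⟩ := y
  obtain ⟨u, rfl⟩ := mk_surjective hι t z
  have hy' : t ∈ (hι s).domChart.source := hy
  refine (fiberEquiv_symm hι s hy' _).symm.trans ?_
  rw [LinearEquiv.symm_apply_eq, fiberEquiv_mk]
  exact fiberCoord_mk hι s hy' u

lemma contMDiffAt_trivialization (s : S) {y : NormalTotal hι}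
    (hy : y.proj ∈ (hι s).domChart.source) :
    ContMDiffAt (𝓘(ℝ, ES).prod 𝓘(ℝ, F)) (𝓘(ℝ, ES).prod 𝓘(ℝ, F)) ∞
      (trivializationAt F (NormalFiber hι) s) y := by
  have h := (trivializationAt F (NormalFiber hι) s).contMDiffOn (IB := 𝓘(ℝ, ES)) (n := ∞)
  exact h.contMDiffAt ((trivializationAt F (NormalFiber hι) s).open_source.mem_nhds
    ((trivializationAt F (NormalFiber hι) s).mem_source.2 hy))

lemma contMDiffAt_fiberCoord (s : S) {y : NormalTotal hι}
    (hy : y.proj ∈ (hι s).domChart.source) :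
    ContMDiffAt (𝓘(ℝ, ES).prod 𝓘(ℝ, F)) 𝓘(ℝ, F) ∞ (fiberCoord hι s) y :=
  contMDiffAt_snd.comp y (contMDiffAt_trivialization hι s hy)

lemma contMDiffAt_trivialization_symm (s : S) {q : S × F} (hq : q.1 ∈ (hι s).domChart.source) :
    ContMDiffAt (𝓘(ℝ, ES).prod 𝓘(ℝ, F)) (𝓘(ℝ, ES).prod 𝓘(ℝ, F)) ∞
      (trivializationAt F (NormalFiber hι) s).toOpenPartialHomeomorph.symm q := by
  have h := (trivializationAt F (NormalFiber hι) s).contMDiffOn_symm (IB := 𝓘(ℝ, ES)) (n := ∞)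
  exact h.contMDiffAt ((trivializationAt F (NormalFiber hι) s).open_target.mem_nhds
    ((trivializationAt F (NormalFiber hι) s).mem_target.2 hq))

lemma eventually_proj {P : S → Prop} {x : NormalTotal hι} (h : ∀ᶠ s in 𝓝 x.proj, P s) :
    ∀ᶠ y : NormalTotal hι in 𝓝 x, P y.proj :=
  (normalProj hι).contMDiff.continuous.continuousAt.eventually h

end NormalBundle

open NormalBundle

section

variable {f : M → ℝ} {s : S}

/-- The differential of a function that vanishes along `S` vanishes on `TS`. -/
lemma tangentRange_le_ker (hf : MDifferentiableAt 𝓘(ℝ, E) 𝓘(ℝ, ℝ) f (ι s))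
    (h0 : ∀ᶠ t in 𝓝 s, f (ι t) = 0) :
    tangentRange ι s ≤ LinearMap.ker (dR 𝓘(ℝ, E) f (ι s)) := by
  rintro _ ⟨v, rfl⟩
  refine LinearMap.mem_ker.2 ((dR_comp hf (mdifferentiableAt_coe ι s) v).symm.trans ?_)
  rw [dR_eq_zero_of_eventually h0, LinearMap.zero_apply]

lemma normalDeriv_mk (hf : MDifferentiableAt 𝓘(ℝ, E) 𝓘(ℝ, ℝ) f (ι s))
    (h0 : ∀ᶠ t in 𝓝 s, f (ι t) = 0) (u : TangentSpace 𝓘(ℝ, E) (ι s)) :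
    normalDeriv hι f ⟨s, mk hι s u⟩ = dR 𝓘(ℝ, E) f (ι s) u := by
  unfold normalDeriv
  rw [dif_pos (tangentRange_le_ker hf h0)]
  rfl

end

section

variable (f : C^∞⟮𝓘(ℝ, E), M; 𝓘(ℝ, ℝ), ℝ⟯)

lemma normalDeriv_eq (s : S) {y : NormalTotal hι} (hy : y.proj ∈ (hι s).domChart.source)
    (h0 : ∀ᶠ t in 𝓝 y.proj, f (ι t) = 0) :
    normalDeriv hι f y =
      dR 𝓘(ℝ, E) f (ι y.proj) (normalLift hι s y.proj (fiberCoord hι s y)) := by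
  rw [← normalDeriv_mk hι (f.mdiffAt _) h0, mk_normalLift hι s hy]

/-- In the slice chart `κ`, `f^ν` is the derivative of `f ∘ κ⁻¹` along `S`, applied to the normal
coordinates. -/
lemma contMDiffAt_normalDeriv {x : NormalTotal hι} (h0 : ∀ᶠ t in 𝓝 x.proj, f (ι t) = 0) :
    ContMDiffAt (𝓘(ℝ, ES).prod 𝓘(ℝ, F)) 𝓘(ℝ, ℝ) ∞ (normalDeriv hι f) x := by
  let s := x.proj
  let κ := (hι s).codChart
  have hs : s ∈ (hι s).domChart.source := (hι s).mem_domChart_source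
  have hκs : ι s ∈ κ.source := (hι s).source_subset_preimage_source hs
  have hg : ContDiffAt ℝ ∞ (f ∘ κ.symm) (κ (ι s)) := by
    have h1 : ContMDiffAt 𝓘(ℝ, E) 𝓘(ℝ, E) ∞ κ.symm (κ (ι s)) :=
      (contMDiffOn_symm_of_mem_maximalAtlas (hι s).codChart_mem_maximalAtlas).contMDiffAt
        (κ.open_target.mem_nhds (κ.map_source hκs))
    exact ((f.contMDiff _).comp _ h1).contDiffAt
  have h1 : ContMDiffAt (𝓘(ℝ, ES).prod 𝓘(ℝ, F)) 𝓘(ℝ, E) ∞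
      (fun y : NormalTotal hι => κ (ι y.proj)) x := by
    have h2 : ContMDiffAt 𝓘(ℝ, E) 𝓘(ℝ, E) ∞ κ (ι s) :=
      (contMDiffOn_of_mem_maximalAtlas (hι s).codChart_mem_maximalAtlas).contMDiffAt
        (κ.open_source.mem_nhds hκs)
    exact h2.comp x ((ι.contMDiff s).comp x ((normalProj hι).contMDiff x))
  have h2 : ContMDiffAt (𝓘(ℝ, ES).prod 𝓘(ℝ, F)) 𝓘(ℝ, E →L[ℝ] ℝ) ∞
      (fun y : NormalTotal hι => fderiv ℝ (f ∘ κ.symm) (κ (ι y.proj))) x :=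
    ContMDiffAt.comp x (I' := 𝓘(ℝ, E))
      (hg.fderiv_right (m := ∞) (by simp)).contMDiffAt h1
  have h3 : ContMDiffAt (𝓘(ℝ, ES).prod 𝓘(ℝ, F)) 𝓘(ℝ, E) ∞
      (fun y : NormalTotal hι => (hι s).equiv ((0 : ES), fiberCoord hι s y)) x := by
    let Λ : F →L[ℝ] E := ((hι s).equiv : ES × F →L[ℝ] E).comp (ContinuousLinearMap.inr ℝ ES F)
    exact Λ.contDiff.contMDiff.contMDiffAt.comp x (contMDiffAt_fiberCoord hι s hs)
  refine (h2.clm_apply h3).congr_of_eventuallyEq ?_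
  filter_upwards [eventually_proj hι h0.eventually_nhds,
    eventually_proj hι (eventually_mem_domChart hι s)] with y hy hy'
  rw [normalDeriv_eq hι f s hy' hy]
  have hκ : ι y.proj ∈ κ.source := (hι s).source_subset_preimage_source hy'
  have h4 := mfderiv_comp (I' := 𝓘(ℝ, E)) (κ (ι y.proj)) (g := f) (f := κ.symm) (f.mdiffAt _)
    ((codChart_mdiff hι s).mdifferentiableAt_symm (κ.map_source hκ))
  rw [mfderiv_eq_fderiv] at h4
  refine Eq.trans ?_ (congrArg (fun T : E →L[ℝ] ℝ => T ((hι s).equiv ((0 : ES),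
    fiberCoord hι s y))) h4).symm
  have h5 : κ.symm (κ (ι y.proj)) = ι y.proj := κ.left_inv hκ
  change dR 𝓘(ℝ, E) f (ι y.proj) _ = dR 𝓘(ℝ, E) f (κ.symm (κ (ι y.proj))) _
  rw [h5]
  rfl

lemma exists_eventuallyEq_normalDeriv {x : NormalTotal hι}
    (h0 : ∀ᶠ t in 𝓝 x.proj, f (ι t) = 0) :
    ∃ ψ : C^∞⟮𝓘(ℝ, ES).prod 𝓘(ℝ, F), NormalTotal hι; 𝓘(ℝ, ℝ), ℝ⟯,
      ∀ᶠ y in 𝓝 x, ψ y = normalDeriv hι f y := by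
  refine exists_function_eventuallyEq ?_
  filter_upwards [eventually_proj hι h0.eventually_nhds] with y hy
  exact contMDiffAt_normalDeriv hι f hy

/-- The pull-back of a function on `M` to the normal bundle. -/
def pullbackFun : C^∞⟮𝓘(ℝ, ES).prod 𝓘(ℝ, F), NormalTotal hι; 𝓘(ℝ, ℝ), ℝ⟯ :=
  ⟨fun y => f (ι y.proj), f.contMDiff.comp (ι.contMDiff.comp (normalProj hι).contMDiff)⟩

end

/-- The fibre coordinates of the normal bundle are of the form `f^ν`. -/
lemma exists_normalDeriv_eq (μ : F →L[ℝ] ℝ) (s : S) : ∃ f : C^∞⟮𝓘(ℝ, E), M; 𝓘(ℝ, ℝ), ℝ⟯,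
    (∀ᶠ t in 𝓝 s, f (ι t) = 0) ∧ ∀ᶠ t in 𝓝 s,
      (∀ u : TangentSpace 𝓘(ℝ, E) (ι t), dR 𝓘(ℝ, E) f (ι t) u = μ (normalComp hι s t u)) ∧
      ∀ y : NormalTotal hι, y.proj = t → normalDeriv hι f y = μ (fiberCoord hι s y) := by
  obtain ⟨f, hf⟩ := exists_normalCoord hι μ s
  have hf' := ι.contMDiff.continuous.continuousAt.eventually hf.eventually_nhds
  have h0 : ∀ᶠ t in 𝓝 s, f (ι t) = 0 := by
    filter_upwards [hf', eventually_mem_domChart hι s] with t ht ht'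
    rw [ht.self_of_nhds, sliceCoord_comp hι s ht']
    exact map_zero μ
  refine ⟨f, h0, ?_⟩
  filter_upwards [hf', eventually_mem_domChart hι s, h0.eventually_nhds] with t ht ht' h0t
  have key (u : TangentSpace 𝓘(ℝ, E) (ι t)) :
      dR 𝓘(ℝ, E) f (ι t) u = μ (normalComp hι s t u) := by
    let Λ : E →L[ℝ] ℝ := μ.comp ((ContinuousLinearMap.snd ℝ ES F).comp
      ((hι s).equiv.symm : E →L[ℝ] ES × F))
    have hm := (codChart_mdiff hι s).mdifferentiableAt
      ((hι s).source_subset_preimage_source ht')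
    have h1 := mfderiv_comp (I' := 𝓘(ℝ, E)) (ι t) (g := Λ) (f := (hι s).codChart)
      Λ.mdifferentiableAt hm
    have h2 : dR 𝓘(ℝ, E) f (ι t) = dR 𝓘(ℝ, E) (Λ ∘ (hι s).codChart) (ι t) := dR_congr ht
    rw [h2]
    rw [Λ.mfderiv_eq] at h1
    exact congrArg (fun T : E →L[ℝ] ℝ => T u) h1
  refine ⟨key, ?_⟩
  rintro y rfl
  rw [normalDeriv_eq hι f s ht' h0t, key, normalComp_lift hι s ht']

/-- Tangent vectors of the normal bundle are determined by their action on the functions `p^* f` and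
`f^ν`. -/
lemma eq_zero_of_pullback_normalDeriv {x : NormalTotal hι}
    {v : TangentSpace (𝓘(ℝ, ES).prod 𝓘(ℝ, F)) x}
    (h1 : ∀ f : C^∞⟮𝓘(ℝ, E), M; 𝓘(ℝ, ℝ), ℝ⟯,
      dR (𝓘(ℝ, ES).prod 𝓘(ℝ, F)) (fun y : NormalTotal hι => f (ι y.proj)) x v = 0)
    (h2 : ∀ f : C^∞⟮𝓘(ℝ, E), M; 𝓘(ℝ, ℝ), ℝ⟯, (∀ᶠ t in 𝓝 x.proj, f (ι t) = 0) →
      dR (𝓘(ℝ, ES).prod 𝓘(ℝ, F)) (normalDeriv hι f) x v = 0) : v = 0 := by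
  let J := 𝓘(ℝ, ES).prod 𝓘(ℝ, F)
  let s := x.proj
  have hs : s ∈ (hι s).domChart.source := (hι s).mem_domChart_source
  have hp : MDifferentiableAt J 𝓘(ℝ, ES) (fun y : NormalTotal hι => y.proj) x :=
    (normalProj hι).contMDiff.mdifferentiableAt (by simp)
  have hc : MDifferentiableAt J 𝓘(ℝ, F) (fiberCoord hι s) x :=
    (contMDiffAt_fiberCoord hι s hs).mdifferentiableAt (by simp)
  have hpv : mfderiv J 𝓘(ℝ, ES) (fun y : NormalTotal hι => y.proj) x v = 0 := by
    refine eq_zero_of_dR_eq_zero fun φ => ?_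
    obtain ⟨f, hf⟩ := exists_extension hι φ s
    have h := dR_comp (I := J) (φ.mdiffAt s) hp v
    refine h.symm.trans ?_
    rw [← h1 f]
    refine congrArg (fun T => T v) (dR_congr ?_)
    filter_upwards [eventually_proj hι hf] with y hy using hy.symm
  have hcv : mfderiv J 𝓘(ℝ, F) (fiberCoord hι s) x v = 0 := by
    have key (μ : F →L[ℝ] ℝ) : μ (mfderiv J 𝓘(ℝ, F) (fiberCoord hι s) x v : F) = 0 := by
      obtain ⟨f, h0, hf⟩ := exists_normalDeriv_eq hι μ s
      have h3 := mfderiv_comp (I' := 𝓘(ℝ, F)) x (g := μ) (f := fiberCoord hι s)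
        μ.mdifferentiableAt hc
      rw [μ.mfderiv_eq] at h3
      have h4 := congrArg (fun T => T v) h3
      refine Eq.trans h4.symm ((h2 f h0).symm.trans ?_).symm
      refine congrArg (fun T => T v) (dR_congr (I := J) ?_)
      filter_upwards [eventually_proj hι hf] with y hy using hy.2 y rfl
    exact (Module.forall_dual_apply_eq_zero_iff ℝ (_ : F)).1 fun μ =>
      key (LinearMap.toContinuousLinearMap μ)
  refine eq_zero_of_dR_eq_zero fun ψ => ?_
  let e := trivializationAt F (NormalFiber hι) s
  have hx : x ∈ e.source := e.mem_source.2 hs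
  have hex : e x = (s, fiberCoord hι s x) := Prod.ext (e.coe_fst hx) rfl
  have hsymm : MDifferentiableAt J J e.toOpenPartialHomeomorph.symm (x.proj, fiberCoord hι s x) :=
    (contMDiffAt_trivialization_symm hι s hs).mdifferentiableAt (by simp)
  have hinv : e.toOpenPartialHomeomorph.symm (x.proj, fiberCoord hι s x) = x := by
    rw [show (x.proj, fiberCoord hι s x) = e x from hex.symm]
    exact e.toOpenPartialHomeomorph.left_inv hx
  have h3 : ∀ᶠ y in 𝓝 x, ψ y =
      ψ (e.toOpenPartialHomeomorph.symm (y.proj, fiberCoord hι s y)) := by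
    filter_upwards [e.open_source.mem_nhds hx] with y hy
    have : (y.proj, fiberCoord hι s y) = e y := (Prod.ext (e.coe_fst hy) rfl).symm
    rw [this]
    exact congrArg ψ (e.toOpenPartialHomeomorph.left_inv hy).symm
  have hψ : MDifferentiableAt J 𝓘(ℝ, ℝ) (fun q => ψ (e.toOpenPartialHomeomorph.symm q))
      (x.proj, fiberCoord hι s x) :=
    MDifferentiableAt.comp _ (by rw [hinv]; exact ψ.mdiffAt x) hsymm
  rw [dR_congr h3]
  refine (dR_comp (I' := J) (f := fun q => ψ (e.toOpenPartialHomeomorph.symm q))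
    (g := fun y : NormalTotal hι => (y.proj, fiberCoord hι s y)) hψ (hp.prodMk hc) v).trans ?_
  have h4 := congrArg (fun T => T v) (mfderiv_prodMk hp hc)
  have h5 : mfderiv J J (fun y : NormalTotal hι => (y.proj, fiberCoord hι s y)) x v = 0 :=
    h4.trans (Prod.ext hpv hcv)
  exact (congrArg _ h5).trans (map_zero _)

end Normal

/-! ### Second derivatives along the zeros of the anchor -/

namespace CourantAlgebroid

variable {E : Type*} [NormedAddCommGroup E] [NormedSpace ℝ E] [FiniteDimensional ℝ E]
  {H : Type*} [TopologicalSpace H]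
  {N : Type*} [TopologicalSpace N] [T2Space N] [ChartedSpace H N] {I : ModelWithCorners ℝ E H}
  [IsManifold I ∞ N]
  {F : Type*} [NormedAddCommGroup F] [NormedSpace ℝ F] [FiniteDimensional ℝ F]
  {B : N → Type*} [∀ m, AddCommGroup (B m)] [∀ m, Module ℝ (B m)]
  [TopologicalSpace (TotalSpace F B)] [∀ m, TopologicalSpace (B m)] [FiberBundle F B]
  [VectorBundle ℝ F B] [ContMDiffVectorBundle ∞ F B I]
  (C : CourantAlgebroid I F B)

/-- If `df` vanishes on the image of the anchor at `m`, then the derivative of `a(σ) f` at `m`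
depends only on `σ m`. -/
lemma dR_act_eq_of_eq {m : N} {f : C^∞⟮I, N; 𝓘(ℝ, ℝ), ℝ⟯} (hf : ∀ v, dR I f m (C.anchor m v) = 0)
    (u : TangentSpace I m) {σ σ' : Cₛ^∞⟮I; F, B⟯} (h : σ m = σ' m) :
    dR I (C.toPreCourant.act σ f) m u = dR I (C.toPreCourant.act σ' f) m u := by
  let Q := C.toPreCourant
  have key (σ : Cₛ^∞⟮I; F, B⟯) :
      dR I (Q.act σ f) m u - dR I (Q.act (extB I F m (σ m)) f) m u = 0 := by
    refine (isFrameAt_stdFrame m).tensor_eq_zero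
      (fun σ => dR I (Q.act σ f) m u - dR I (Q.act (extB I F m (σ m)) f) m u) ?_ ?_ ?_ σ
    · intro s t
      have h1 : extB I F m ((s + t) m) = extB I F m (s m) + extB I F m (t m) := map_add _ _ _
      simp only [h1, Q.dR_act_add]
      ring
    · intro φ s
      have h1 : Q.act (extB I F m (fsmul φ s m)) f = φ m • Q.act (extB I F m (s m)) f := by
        have : extB I F m (fsmul φ s m) = φ m • extB I F m (s m) := map_smul _ _ _
        ext y
        rw [this]
        simp
      have h2 : dR I (φ m • Q.act (extB I F m (s m)) f : C^∞⟮I, N; 𝓘(ℝ, ℝ), ℝ⟯) m u =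
          φ m * dR I (Q.act (extB I F m (s m)) f) m u := by
        have := dR_mul (I := I) (f := fun _ => φ m) mdifferentiableAt_const
          ((Q.act (extB I F m (s m)) f).mdiffAt m) u
        rw [dR_const] at this
        exact this.trans (by rw [LinearMap.zero_apply, mul_zero, add_zero])
      simp only [h1, h2, Q.dR_act_fsmul]
      rw [show dR I f m (Q.anchor m (s m)) = 0 from hf _]
      simp only [smul_eq_mul]
      ring
    · intro i
      rw [stdFrame_eq_extB, extB_self, sub_self]
  rw [sub_eq_zero.1 (key σ), sub_eq_zero.1 (key σ'), h]

/-- If `df` and `dg` vanish on the image of the anchor at `m`, then the derivatives in the direction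
of `u` of the sections `a^* df` and `a^* dg`, which are zero at `m`, are orthogonal. This is the
second derivative of `⟨a^* df, a^* dg⟩ = 0`. -/
lemma metric_eq_zero_of_deriv {m : N} {f g : C^∞⟮I, N; 𝓘(ℝ, ℝ), ℝ⟯}
    (hf : ∀ v, dR I f m (C.anchor m v) = 0) (hg : ∀ v, dR I g m (C.anchor m v) = 0)
    {u : TangentSpace I m} {wf wg : B m}
    (hwf : ∀ σ : Cₛ^∞⟮I; F, B⟯, C.metric m wf (σ m) = dR I (C.toPreCourant.act σ f) m u)
    (hwg : ∀ σ : Cₛ^∞⟮I; F, B⟯, C.metric m wg (σ m) = dR I (C.toPreCourant.act σ g) m u) :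
    C.metric m wf wg = 0 := by
  let Q := C.toPreCourant
  let e := stdFrame I F B m
  have he : IsFrameAt e m := isFrameAt_stdFrame m
  obtain ⟨p, hp⟩ := exists_coeff he.linearIndependent (Q.D f)
    (he.span.mono fun y hy => hy ▸ Submodule.mem_top)
  -- `a^* df = ∑ p i • e i` and `q i = ⟨e i, a^* dg⟩`, so that `∑ p i * q i = ⟨a^* df, a^* dg⟩ = 0`
  let q (i) := Q.act (e i) g
  have hD : Q.D f m = 0 := Q.metric_ext fun v => by
    rw [Q.metric_D, show dR I f m (Q.anchor m v) = 0 from hf v]; simp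
  have hp0 : ∀ i, p i m = 0 :=
    Fintype.linearIndependent_iff.1 he.linearIndependent (fun i => p i m)
      (hp.self_of_nhds.symm.trans hD)
  have hq0 (i) : q i m = 0 := hg (e i m)
  have hpq : ∀ᶠ y in 𝓝 m, ∑ i, p i y * q i y = 0 := by
    filter_upwards [hp] with y hy
    have h1 : Q.anchor y (Q.D f y) = 0 := PreCourant.IsCoisotropic.anchor_D C.isCoisotropic f y
    have h2 := congrArg (dR I g y) h1
    rw [hy] at h2
    simp only [map_sum, map_smul, smul_eq_mul, map_zero] at h2
    exact h2
  have hmetric : C.metric m wf wg = ∑ i, dR I (p i) m u * dR I (q i) m u := by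
    let σ := extB I F m wg
    have h1 : ∀ᶠ y in 𝓝 m, Q.act σ f y = ∑ i, p i y * Q.pair (e i) σ y := by
      filter_upwards [hp] with y hy
      rw [Q.act_apply, ← Q.metric_D, hy]
      simp
    have h2 := hwf σ
    have hmul (i) : MDifferentiableAt I 𝓘(ℝ, ℝ) (fun y => p i y * Q.pair (e i) σ y) m :=
      ((p i).mdiffAt m).mul ((Q.pair (e i) σ).mdiffAt m)
    rw [dR_congr h1, dR_sum Finset.univ hmul] at h2
    rw [← extB_self (I := I) (F := F) m wg]
    refine h2.trans (Finset.sum_congr rfl fun i _ => ?_)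
    rw [dR_mul ((p i).mdiffAt m) ((Q.pair (e i) σ).mdiffAt m), hp0 i, ← hwg (e i), C.metric_symm,
      show Q.pair (e i) σ m = C.metric m (e i m) (σ m) from rfl,
      show σ m = wg from extB_self m wg]
    ring
  -- the second derivative of `∑ p i * q i = 0` in the direction of `u`, where all `p i` and `q i`
  -- vanish at `m`
  let X := extB I E (B := (TangentSpace I : N → Type _)) m u
  have h2 : ∀ᶠ y in 𝓝 m, ∑ i, (p i y * lieD X (q i) y + q i y * lieD X (p i) y) = 0 := by
    filter_upwards [hpq.eventually_nhds] with y hy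
    have h3 := dR_sum (I := I) Finset.univ (fun i => ((p i).mdiffAt y).mul ((q i).mdiffAt y)) (X y)
    have h4 := congrArg (fun T => T (X y)) (dR_eq_zero_of_eventually (I := I) hy)
    refine Eq.trans ?_ (h3.symm.trans h4)
    exact Finset.sum_congr rfl fun i _ => (dR_mul ((p i).mdiffAt y) ((q i).mdiffAt y) (X y)).symm
  have h3 := congrArg (fun T => T u) (dR_eq_zero_of_eventually (I := I) h2)
  have hmul (a b : C^∞⟮I, N; 𝓘(ℝ, ℝ), ℝ⟯) :
      MDifferentiableAt I 𝓘(ℝ, ℝ) (fun y => a y * b y) m := (a.mdiffAt m).mul (b.mdiffAt m)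
  have h4 := dR_sum (I := I) Finset.univ
    (fun i => (hmul (p i) (lieD X (q i))).add (hmul (q i) (lieD X (p i)))) u
  have h5 : ∑ i, (dR I (p i) m u * dR I (q i) m u + dR I (p i) m u * dR I (q i) m u) = 0 := by
    refine Eq.trans (Finset.sum_congr rfl fun i _ => ?_) (h4.symm.trans h3)
    refine Eq.trans ?_ (dR_add (hmul (p i) (lieD X (q i))) (hmul (q i) (lieD X (p i))) u).symm
    rw [dR_mul ((p i).mdiffAt m) ((lieD X (q i)).mdiffAt m),
      dR_mul ((q i).mdiffAt m) ((lieD X (p i)).mdiffAt m), hp0, hq0, lieD_apply, lieD_apply,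
      show X m = u from extB_self m u]
    ring
  rw [Finset.sum_add_distrib] at h5
  rw [hmetric]
  linarith

end CourantAlgebroid

/-! ### The linearization of the anchor -/

section LinearAnchor

variable {E : Type*} [NormedAddCommGroup E] [NormedSpace ℝ E] [FiniteDimensional ℝ E]
  {M : Type*} [TopologicalSpace M] [T2Space M] [ChartedSpace E M] [IsManifold 𝓘(ℝ, E) ∞ M]
  {ES : Type*} [NormedAddCommGroup ES] [NormedSpace ℝ ES] [FiniteDimensional ℝ ES]
  {S : Type*} [TopologicalSpace S] [T2Space S] [ChartedSpace ES S] [IsManifold 𝓘(ℝ, ES) ∞ S]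
  {F : Type*} [NormedAddCommGroup F] [NormedSpace ℝ F] [FiniteDimensional ℝ F]
  {ι : C^∞⟮𝓘(ℝ, ES), S; 𝓘(ℝ, E), M⟯}
  (hι : IsImmersionOfComplement F 𝓘(ℝ, ES) 𝓘(ℝ, E) ∞ ι)

namespace NormalBundle

lemma contMDiff_fromTangent (s : S) :
    ContMDiff 𝓘(ℝ, E) (𝓘(ℝ, ES).prod 𝓘(ℝ, F)) ∞ (fromTangent hι s) := fun u => by
  rw [Bundle.contMDiffAt_totalSpace]
  refine ⟨contMDiffAt_const, ?_⟩
  let Λ : E →L[ℝ] F := normalComp hι s s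
  exact Λ.contDiff.contMDiff.contMDiffAt.congr_of_eventuallyEq
    (Filter.Eventually.of_forall fun w => fiberCoord_mk hι s (hι s).mem_domChart_source w)

lemma dR_pullback_fromTangent (f : C^∞⟮𝓘(ℝ, E), M; 𝓘(ℝ, ℝ), ℝ⟯) (s : S) (u w : E) :
    dR (𝓘(ℝ, ES).prod 𝓘(ℝ, F)) (fun y : NormalTotal hι => f (ι y.proj)) (fromTangent hι s u)
      (mfderiv 𝓘(ℝ, E) (𝓘(ℝ, ES).prod 𝓘(ℝ, F)) (fromTangent hι s) u w) = 0 := by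
  have h1 := dR_comp (I := 𝓘(ℝ, E)) (g := fromTangent hι s) (x := u)
    ((pullbackFun hι f).mdiffAt _) ((contMDiff_fromTangent hι s).mdifferentiableAt (by simp)) w
  exact h1.symm.trans (congrArg (fun T : E →ₗ[ℝ] ℝ => T w)
    (dR_const (I := 𝓘(ℝ, E)) (N := E) (f (ι s)) u))

/-- The functions `f^ν` are linear on the fibres of the normal bundle. -/
lemma dR_normalDeriv_fromTangent (f : C^∞⟮𝓘(ℝ, E), M; 𝓘(ℝ, ℝ), ℝ⟯) {s : S}
    (h0 : ∀ᶠ t in 𝓝 s, f (ι t) = 0) (u w : E) :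
    dR (𝓘(ℝ, ES).prod 𝓘(ℝ, F)) (normalDeriv hι f) (fromTangent hι s u)
      (mfderiv 𝓘(ℝ, E) (𝓘(ℝ, ES).prod 𝓘(ℝ, F)) (fromTangent hι s) u w) =
      dR 𝓘(ℝ, E) f (ι s) w := by
  have h1 := dR_comp (I := 𝓘(ℝ, E)) (g := fromTangent hι s) (x := u)
    ((contMDiffAt_normalDeriv hι f (x := fromTangent hι s u) h0).mdifferentiableAt (by simp))
    ((contMDiff_fromTangent hι s).mdifferentiableAt (by simp)) w
  let ξ : E →L[ℝ] ℝ := mfderiv 𝓘(ℝ, E) 𝓘(ℝ, ℝ) f (ι s)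
  have h2 : (fun w : E => normalDeriv hι f (fromTangent hι s w)) = ξ :=
    funext fun w => normalDeriv_mk hι (f.mdiffAt _) h0 w
  rw [h2] at h1
  exact h1.symm.trans (congrArg (fun T : E →L[ℝ] ℝ => T w) (ξ.mfderiv_eq (x := u)))

/-- The section of the normal bundle given by a vector field on `M`. -/
def normalSec (X : Cₛ^∞⟮𝓘(ℝ, E); E, (TangentSpace 𝓘(ℝ, E) : M → Type _)⟯) (t : S) :
    NormalTotal hι := ⟨t, mk hι t (X (ι t))⟩

lemma contMDiffAt_normalSec (X : Cₛ^∞⟮𝓘(ℝ, E); E, (TangentSpace 𝓘(ℝ, E) : M → Type _)⟯) (s : S) :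
    ContMDiffAt 𝓘(ℝ, ES) (𝓘(ℝ, ES).prod 𝓘(ℝ, F)) ∞ (normalSec hι X) s := by
  rw [Bundle.contMDiffAt_totalSpace]
  refine ⟨contMDiffAt_id, ?_⟩
  let β := Module.finBasis ℝ F
  choose f h0 hf using fun j =>
    exists_normalDeriv_eq hι (LinearMap.toContinuousLinearMap (β.coord j)) s
  have h1 (j) : ContMDiffAt 𝓘(ℝ, ES) 𝓘(ℝ, F) ∞ (fun t => lieD X (f j) (ι t) • β j) s :=
    (((lieD X (f j)).contMDiff (ι s)).comp s (ι.contMDiff s)).smul contMDiffAt_const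
  refine (contMDiffAt_finsetSum fun j (_ : j ∈ Finset.univ) => h1 j).congr_of_eventuallyEq ?_
  filter_upwards [Filter.eventually_all.2 hf, eventually_mem_domChart hι s] with t ht ht'
  refine (fiberCoord_mk hι s ht' (X (ι t))).trans ?_
  rw [← β.sum_repr (normalComp hι s t (X (ι t)))]
  exact Finset.sum_congr rfl fun j _ => congrArg (· • β j) ((ht j).1 (X (ι t))).symm

end NormalBundle

open NormalBundle

variable {FA : Type*} [NormedAddCommGroup FA] [NormedSpace ℝ FA] [FiniteDimensional ℝ FA]
  {A : M → Type*} [∀ m, AddCommGroup (A m)] [∀ m, Module ℝ (A m)]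
  [TopologicalSpace (TotalSpace FA A)] [∀ m, TopologicalSpace (A m)] [FiberBundle FA A]
  [VectorBundle ℝ FA A] [ContMDiffVectorBundle ∞ FA A 𝓘(ℝ, E)]
  (C : CourantAlgebroid 𝓘(ℝ, E) FA A)
  (ha : ∀ (s : S) (v : A (ι s)), C.anchor (ι s) v ∈ NormalBundle.tangentRange ι s)

namespace CourantAlgebroid

section

variable {f : C^∞⟮𝓘(ℝ, E), M; 𝓘(ℝ, ℝ), ℝ⟯} {s : S}

include ha

lemma dR_anchor_eq_zero (h0 : ∀ᶠ t in 𝓝 s, f (ι t) = 0) (v : A (ι s)) :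
    dR 𝓘(ℝ, E) f (ι s) (C.anchor (ι s) v) = 0 :=
  tangentRange_le_ker (f.mdiffAt _) h0 (ha s v)

lemma eventually_act_eq_zero (h0 : ∀ᶠ t in 𝓝 s, f (ι t) = 0) (σ : Cₛ^∞⟮𝓘(ℝ, E); FA, A⟯) :
    ∀ᶠ t in 𝓝 s, C.toPreCourant.act σ f (ι t) = 0 := by
  filter_upwards [h0.eventually_nhds] with t ht
  exact C.dR_anchor_eq_zero ha ht (σ (ι t))

lemma normalDeriv_act_mk (h0 : ∀ᶠ t in 𝓝 s, f (ι t) = 0) (σ : Cₛ^∞⟮𝓘(ℝ, E); FA, A⟯)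
    (u : TangentSpace 𝓘(ℝ, E) (ι s)) :
    normalDeriv hι (C.toPreCourant.act σ f) ⟨s, NormalBundle.mk hι s u⟩ =
      dR 𝓘(ℝ, E) (C.toPreCourant.act σ f) (ι s) u :=
  normalDeriv_mk hι (ContMDiffMap.mdiffAt _ _) (C.eventually_act_eq_zero ha h0 σ) u

end

/-- `Z` is the value `ν(a)(x, v)` of the linearized anchor, expressed by the derivatives of the
functions `p^* f` and `f^ν` along `Z`. -/
structure IsLinearAnchorAt (x : NormalTotal hι) (v : A (ι x.proj))
    (Z : TangentSpace (𝓘(ℝ, ES).prod 𝓘(ℝ, F)) x) : Prop where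
  deriv_pullback : ∀ f : C^∞⟮𝓘(ℝ, E), M; 𝓘(ℝ, ℝ), ℝ⟯,
    dR (𝓘(ℝ, ES).prod 𝓘(ℝ, F)) (fun y : NormalTotal hι => f (ι y.proj)) x Z =
      dR 𝓘(ℝ, E) f (ι x.proj) (C.anchor (ι x.proj) v)
  deriv_normalDeriv : ∀ f : C^∞⟮𝓘(ℝ, E), M; 𝓘(ℝ, ℝ), ℝ⟯, (∀ᶠ t in 𝓝 x.proj, f (ι t) = 0) →
    ∀ σ : Cₛ^∞⟮𝓘(ℝ, E); FA, A⟯, σ (ι x.proj) = v →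
      dR (𝓘(ℝ, ES).prod 𝓘(ℝ, F)) (normalDeriv hι f) x Z =
        normalDeriv hι (C.toPreCourant.act σ f) x

section

variable {C hι} {x : NormalTotal hι}

lemma IsLinearAnchorAt.unique {v : A (ι x.proj)}
    {Z Z' : TangentSpace (𝓘(ℝ, ES).prod 𝓘(ℝ, F)) x} (h : C.IsLinearAnchorAt hι x v Z)
    (h' : C.IsLinearAnchorAt hι x v Z') : Z = Z' := by
  refine sub_eq_zero.1 (eq_zero_of_pullback_normalDeriv hι (fun f => ?_) fun f h0 => ?_)
  · rw [map_sub, h.deriv_pullback, h'.deriv_pullback, sub_self]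
  · rw [map_sub, h.deriv_normalDeriv f h0 _ (extB_self _ v),
      h'.deriv_normalDeriv f h0 _ (extB_self _ v), sub_self]

end

include ha in
/-- For a vector field `X` on `M` with `X (ι s) = u` and a section `σ` with value `v`, the value of
`ν(a)` is the sum of the image of the tangent vector `a(v)` of `S` under the differential of the
section `[X|_S]` of the normal bundle and the vertical vector given by `[X, a(σ)]` at `ι s`. -/
lemma exists_isLinearAnchorAt (x : NormalTotal hι) (v : A (ι x.proj)) :
    ∃ Z, C.IsLinearAnchorAt hι x v Z := by
  let J := 𝓘(ℝ, ES).prod 𝓘(ℝ, F)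
  obtain ⟨s, z⟩ := x
  obtain ⟨u, rfl⟩ := mk_surjective hι s z
  -- a vector field extending `u` gives a section of the normal bundle through the point
  obtain ⟨X, rfl⟩ : ∃ X : Cₛ^∞⟮𝓘(ℝ, E); E, (TangentSpace 𝓘(ℝ, E) : M → Type _)⟯, X (ι s) = u :=
    ⟨extB _ _ _ u, extB_self _ u⟩
  change A (ι s) at v
  let σ₀ := extB 𝓘(ℝ, E) FA (ι s) v
  have hσ₀ : σ₀ (ι s) = v := extB_self (ι s) v
  let W := VectorField.mlieBracket 𝓘(ℝ, E) X (C.toPreCourant.anchorSec σ₀) (ι s)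
  have hX : MDifferentiableAt 𝓘(ℝ, ES) J (normalSec hι X) s :=
    (contMDiffAt_normalSec hι X s).mdifferentiableAt (by simp)
  let Z₁ : TangentSpace J (normalSec hι X s) :=
    mfderiv 𝓘(ℝ, ES) J (normalSec hι X) s (C.restrAnchor hι ha s v)
  let Z₂ : TangentSpace J (normalSec hι X s) :=
    mfderiv 𝓘(ℝ, E) J (fromTangent hι s) (X (ι s)) W
  refine ⟨Z₁ + Z₂, fun f => ?_, fun f h0 σ hσ => ?_⟩
  · have hf : MDifferentiableAt J 𝓘(ℝ, ℝ) (fun y : NormalTotal hι => f (ι y.proj))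
        (normalSec hι X s) := (pullbackFun hι f).mdiffAt _
    refine (map_add (dR J _ (normalSec hι X s)) Z₁ Z₂).trans ?_
    have h1 := dR_comp (I := 𝓘(ℝ, ES)) hf hX (C.restrAnchor hι ha s v)
    have h3 := C.dR_restrAnchor hι ha (φ := fun t => f (ι t)) (f := f) (s := s)
      (Filter.Eventually.of_forall fun _ => rfl) v
    exact (congrArg₂ (· + ·) (h1.symm.trans h3)
      (dR_pullback_fromTangent hι f s (X (ι s)) W)).trans (add_zero _)
  · have hf : MDifferentiableAt J 𝓘(ℝ, ℝ) (normalDeriv hι f) (normalSec hι X s) :=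
      (contMDiffAt_normalDeriv hι f h0).mdifferentiableAt (by simp)
    refine (map_add (dR J _ (normalSec hι X s)) Z₁ Z₂).trans ?_
    have h1 := dR_comp (I := 𝓘(ℝ, ES)) hf hX (C.restrAnchor hι ha s v)
    have h3 := C.dR_restrAnchor hι ha (φ := fun t => normalDeriv hι f (normalSec hι X t))
      (f := lieD X f) (s := s) (by
        filter_upwards [h0.eventually_nhds] with t ht
        exact (normalDeriv_mk hι (f.mdiffAt _) ht (X (ι t))).symm) v
    have h6 := dR_mlieBracket X (C.toPreCourant.anchorSec σ₀) f (ι s)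
    have h7 := C.dR_act_eq_of_eq (C.dR_anchor_eq_zero ha h0) (X (ι s)) (hσ.trans hσ₀.symm)
    refine (congrArg₂ (· + ·) (h1.symm.trans h3)
      ((dR_normalDeriv_fromTangent hι f h0 (X (ι s)) W).trans h6)).trans ?_
    rw [C.normalDeriv_act_mk hι ha h0, h7]
    have h8 : C.toPreCourant.anchorSec σ₀ (ι s) = C.anchor (ι s) v :=
      congrArg (C.anchor (ι s)) hσ₀
    change dR 𝓘(ℝ, E) (lieD X f) (ι s) (C.anchor (ι s) v) +
      (dR 𝓘(ℝ, E) (C.toPreCourant.act σ₀ f) (ι s) (X (ι s)) -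
        dR 𝓘(ℝ, E) (lieD X f) (ι s) (C.toPreCourant.anchorSec σ₀ (ι s))) = _
    rw [h8]
    ring

end CourantAlgebroid

end LinearAnchor

/-- A set of linear forms that separates the vectors of a finite-dimensional space spans the dual
space. -/
lemma Module.Dual.span_eq_top_of_separating {V : Type*} [AddCommGroup V] [Module ℝ V]
    [FiniteDimensional ℝ V] {Φ : Set (Module.Dual ℝ V)}
    (h : ∀ v, (∀ ξ ∈ Φ, ξ v = 0) → v = 0) : Submodule.span ℝ Φ = ⊤ := by
  have h1 : (Submodule.span ℝ Φ).dualCoannihilator = ⊥ := by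
    rw [eq_bot_iff]
    intro v hv
    refine h v fun ξ hξ => ?_
    exact (Submodule.mem_dualCoannihilator v).1 hv ξ (Submodule.subset_span hξ)
  rw [← Subspace.dualCoannihilator_dualAnnihilator_eq (W := Submodule.span ℝ Φ), h1,
    Submodule.dualAnnihilator_bot]

/-! ### The linearization of a Courant algebroid along a submanifold -/

section Linearization

variable {E : Type*} [NormedAddCommGroup E] [NormedSpace ℝ E] [FiniteDimensional ℝ E]
  {M : Type*} [TopologicalSpace M] [T2Space M] [ChartedSpace E M] [IsManifold 𝓘(ℝ, E) ∞ M]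
  {ES : Type*} [NormedAddCommGroup ES] [NormedSpace ℝ ES] [FiniteDimensional ℝ ES]
  {S : Type*} [TopologicalSpace S] [T2Space S] [ChartedSpace ES S] [IsManifold 𝓘(ℝ, ES) ∞ S]
  {F : Type*} [NormedAddCommGroup F] [NormedSpace ℝ F] [FiniteDimensional ℝ F]
  {ι : C^∞⟮𝓘(ℝ, ES), S; 𝓘(ℝ, E), M⟯}
  (hι : IsImmersionOfComplement F 𝓘(ℝ, ES) 𝓘(ℝ, E) ∞ ι)
  {FA : Type*} [NormedAddCommGroup FA] [NormedSpace ℝ FA] [FiniteDimensional ℝ FA]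
  {A : M → Type*} [∀ m, AddCommGroup (A m)] [∀ m, Module ℝ (A m)]
  [TopologicalSpace (TotalSpace FA A)] [∀ m, TopologicalSpace (A m)] [FiberBundle FA A]
  [VectorBundle ℝ FA A] [ContMDiffVectorBundle ∞ FA A 𝓘(ℝ, E)]
  (C : CourantAlgebroid 𝓘(ℝ, E) FA A)
  (ha : ∀ (s : S) (v : A (ι s)), C.anchor (ι s) v ∈ NormalBundle.tangentRange ι s)

open NormalBundle

namespace CourantAlgebroid

section

variable {C hι} {x : NormalTotal hι} {v w : A (ι x.proj)}
  {Z Z' : TangentSpace (𝓘(ℝ, ES).prod 𝓘(ℝ, F)) x}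

include ha

lemma normalDeriv_act_add {f : C^∞⟮𝓘(ℝ, E), M; 𝓘(ℝ, ℝ), ℝ⟯}
    (h0 : ∀ᶠ t in 𝓝 x.proj, f (ι t) = 0) (σ τ : Cₛ^∞⟮𝓘(ℝ, E); FA, A⟯) :
    normalDeriv hι (C.toPreCourant.act (σ + τ) f) x =
      normalDeriv hι (C.toPreCourant.act σ f) x + normalDeriv hι (C.toPreCourant.act τ f) x := by
  obtain ⟨s, z⟩ := x
  obtain ⟨u, rfl⟩ := mk_surjective hι s z
  rw [C.normalDeriv_act_mk hι ha h0, C.normalDeriv_act_mk hι ha h0, C.normalDeriv_act_mk hι ha h0,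
    PreCourant.dR_act_add]

lemma normalDeriv_act_fsmul {f : C^∞⟮𝓘(ℝ, E), M; 𝓘(ℝ, ℝ), ℝ⟯}
    (h0 : ∀ᶠ t in 𝓝 x.proj, f (ι t) = 0) (φ : C^∞⟮𝓘(ℝ, E), M; 𝓘(ℝ, ℝ), ℝ⟯)
    (σ : Cₛ^∞⟮𝓘(ℝ, E); FA, A⟯) :
    normalDeriv hι (C.toPreCourant.act (fsmul φ σ) f) x =
      φ (ι x.proj) * normalDeriv hι (C.toPreCourant.act σ f) x := by
  obtain ⟨s, z⟩ := x
  obtain ⟨u, rfl⟩ := mk_surjective hι s z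
  rw [C.normalDeriv_act_mk hι ha h0, C.normalDeriv_act_mk hι ha h0, PreCourant.dR_act_fsmul]
  have h := C.dR_anchor_eq_zero ha h0 (σ (ι s))
  change _ + dR 𝓘(ℝ, E) f (ι s) (C.anchor (ι s) (σ (ι s))) * _ = _
  rw [h, zero_mul, add_zero]

lemma normalDeriv_act_eq_of_eq {f : C^∞⟮𝓘(ℝ, E), M; 𝓘(ℝ, ℝ), ℝ⟯}
    (h0 : ∀ᶠ t in 𝓝 x.proj, f (ι t) = 0) {σ τ : Cₛ^∞⟮𝓘(ℝ, E); FA, A⟯}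
    (h : σ (ι x.proj) = τ (ι x.proj)) :
    normalDeriv hι (C.toPreCourant.act σ f) x = normalDeriv hι (C.toPreCourant.act τ f) x := by
  obtain ⟨s, z⟩ := x
  obtain ⟨u, rfl⟩ := mk_surjective hι s z
  rw [C.normalDeriv_act_mk hι ha h0, C.normalDeriv_act_mk hι ha h0]
  exact C.dR_act_eq_of_eq (C.dR_anchor_eq_zero ha h0) u h

lemma IsLinearAnchorAt.add (h : C.IsLinearAnchorAt hι x v Z) (h' : C.IsLinearAnchorAt hι x w Z') :
    C.IsLinearAnchorAt hι x (v + w) (Z + Z') where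
  deriv_pullback f := by rw [map_add, map_add, map_add, h.deriv_pullback, h'.deriv_pullback]
  deriv_normalDeriv f h0 σ hσ := by
    rw [map_add, h.deriv_normalDeriv f h0 _ (extB_self _ v),
      h'.deriv_normalDeriv f h0 _ (extB_self _ w), ← normalDeriv_act_add ha h0]
    refine normalDeriv_act_eq_of_eq ha h0 ?_
    rw [hσ, ContMDiffSection.coe_add, Pi.add_apply, extB_self, extB_self]

lemma IsLinearAnchorAt.smul (c : ℝ) (h : C.IsLinearAnchorAt hι x v Z) :
    C.IsLinearAnchorAt hι x (c • v) (c • Z) where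
  deriv_pullback f := by rw [map_smul, map_smul, map_smul, h.deriv_pullback]
  deriv_normalDeriv f h0 σ hσ := by
    rw [map_smul, h.deriv_normalDeriv f h0 _ (extB_self _ v)]
    refine (normalDeriv_act_fsmul ha h0 ⟨fun _ => c, contMDiff_const⟩ _).symm.trans
      (normalDeriv_act_eq_of_eq ha h0 ?_)
    rw [hσ]
    exact congrArg (c • ·) (extB_self _ v)

end

/-- The linearization `ν(a)` of the anchor. -/
def linAnchor (x : NormalTotal hι) :
    A (ι x.proj) →ₗ[ℝ] TangentSpace (𝓘(ℝ, ES).prod 𝓘(ℝ, F)) x where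
  toFun v := (C.exists_isLinearAnchorAt hι ha x v).choose
  map_add' v w := (C.exists_isLinearAnchorAt hι ha x (v + w)).choose_spec.unique
    ((C.exists_isLinearAnchorAt hι ha x v).choose_spec.add ha
      (C.exists_isLinearAnchorAt hι ha x w).choose_spec)
  map_smul' c v := (C.exists_isLinearAnchorAt hι ha x (c • v)).choose_spec.unique
    ((C.exists_isLinearAnchorAt hι ha x v).choose_spec.smul ha c)

lemma isLinearAnchorAt_linAnchor (x : NormalTotal hι) (v : A (ι x.proj)) :
    C.IsLinearAnchorAt hι x v (C.linAnchor hι ha x v) :=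
  (C.exists_isLinearAnchorAt hι ha x v).choose_spec

lemma dR_pullback_linAnchor (f : C^∞⟮𝓘(ℝ, E), M; 𝓘(ℝ, ℝ), ℝ⟯) (x : NormalTotal hι)
    (v : A (ι x.proj)) :
    dR (𝓘(ℝ, ES).prod 𝓘(ℝ, F)) (fun y : NormalTotal hι => f (ι y.proj)) x
      (C.linAnchor hι ha x v) = dR 𝓘(ℝ, E) f (ι x.proj) (C.anchor (ι x.proj) v) :=
  (C.isLinearAnchorAt_linAnchor hι ha x v).deriv_pullback f

lemma dR_normalDeriv_linAnchor {f : C^∞⟮𝓘(ℝ, E), M; 𝓘(ℝ, ℝ), ℝ⟯} {x : NormalTotal hι}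
    (h0 : ∀ᶠ t in 𝓝 x.proj, f (ι t) = 0) (σ : Cₛ^∞⟮𝓘(ℝ, E); FA, A⟯) :
    dR (𝓘(ℝ, ES).prod 𝓘(ℝ, F)) (normalDeriv hι f) x (C.linAnchor hι ha x (σ (ι x.proj))) =
      normalDeriv hι (C.toPreCourant.act σ f) x :=
  (C.isLinearAnchorAt_linAnchor hι ha x _).deriv_normalDeriv f h0 σ rfl

lemma contMDiff_linAnchor (σ : Cₛ^∞⟮𝓘(ℝ, E); FA, A⟯) :
    ContMDiff (𝓘(ℝ, ES).prod 𝓘(ℝ, F)) (𝓘(ℝ, ES).prod 𝓘(ℝ, F)).tangent ∞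
      (fun x => (⟨x, C.linAnchor hι ha x (σ (ι x.proj))⟩ :
        TangentBundle (𝓘(ℝ, ES).prod 𝓘(ℝ, F)) (NormalTotal hι))) := fun x => by
  let J := 𝓘(ℝ, ES).prod 𝓘(ℝ, F)
  refine contMDiffAt_vectorField_of_separating (𝓕 := {ψ : C^∞⟮J, NormalTotal hι; 𝓘(ℝ, ℝ), ℝ⟯ |
    (∃ f : C^∞⟮𝓘(ℝ, E), M; 𝓘(ℝ, ℝ), ℝ⟯, ∀ᶠ y in 𝓝 x, ψ y = f (ι y.proj)) ∨
    ∃ f : C^∞⟮𝓘(ℝ, E), M; 𝓘(ℝ, ℝ), ℝ⟯, (∀ᶠ t in 𝓝 x.proj, f (ι t) = 0) ∧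
      ∀ᶠ y in 𝓝 x, ψ y = normalDeriv hι f y}) (fun v hv => ?_) ?_
  · refine eq_zero_of_pullback_normalDeriv hι (fun f => ?_) fun f h0 => ?_
    · exact hv (pullbackFun hι f) (Or.inl ⟨f, Filter.Eventually.of_forall fun _ => rfl⟩)
    · obtain ⟨ψ, hψ⟩ := exists_eventuallyEq_normalDeriv hι f h0
      rw [← dR_congr hψ]
      exact hv ψ (Or.inr ⟨f, h0, hψ⟩)
  · rintro ψ (⟨f, hf⟩ | ⟨f, h0, hf⟩)
    · filter_upwards [hf.eventually_nhds] with y hy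
      refine ((pullbackFun hι (C.toPreCourant.act σ f)).contMDiff y).congr_of_eventuallyEq ?_
      filter_upwards [hy.eventually_nhds] with z hz
      rw [dR_congr hz]
      exact C.dR_pullback_linAnchor hι ha f z _
    · filter_upwards [hf.eventually_nhds, eventually_proj hι h0.eventually_nhds] with y hy h0y
      refine (contMDiffAt_normalDeriv hι (C.toPreCourant.act σ f)
        (C.eventually_act_eq_zero ha h0y σ)).congr_of_eventuallyEq ?_
      filter_upwards [hy.eventually_nhds, eventually_proj hι h0y.eventually_nhds] with z hz h0z
      rw [dR_congr hz]
      exact C.dR_normalDeriv_linAnchor hι ha h0z σ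

/-- The vector field `ν(a(σ))` on the normal bundle. -/
def linVF (σ : Cₛ^∞⟮𝓘(ℝ, E); FA, A⟯) : Cₛ^∞⟮𝓘(ℝ, ES).prod 𝓘(ℝ, F); ES × F,
    (TangentSpace (𝓘(ℝ, ES).prod 𝓘(ℝ, F)) : NormalTotal hι → Type _)⟯ :=
  ⟨fun x => C.linAnchor hι ha x (σ (ι x.proj)), C.contMDiff_linAnchor hι ha σ⟩

/-- Linear approximation preserves brackets: both sides act in the same way on the functions `p^* f`
and `f^ν`. -/
lemma linAnchor_bracket (σ τ : Cₛ^∞⟮𝓘(ℝ, E); FA, A⟯) (x : NormalTotal hι) :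
    C.linAnchor hι ha x (C.bracket σ τ (ι x.proj)) =
      VectorField.mlieBracket (𝓘(ℝ, ES).prod 𝓘(ℝ, F)) (C.linVF hι ha σ) (C.linVF hι ha τ) x := by
  let J := 𝓘(ℝ, ES).prod 𝓘(ℝ, F)
  refine sub_eq_zero.1 (eq_zero_of_pullback_normalDeriv hι (fun f => ?_) fun f h0 => ?_)
  · have h := dR_mlieBracket (C.linVF hι ha σ) (C.linVF hι ha τ) (pullbackFun hι f) x
    have h1 (σ τ : Cₛ^∞⟮𝓘(ℝ, E); FA, A⟯) :
        dR J (lieD (C.linVF hι ha τ) (pullbackFun hι f)) x (C.linVF hι ha σ x) =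
          dR 𝓘(ℝ, E) (C.toPreCourant.act τ f) (ι x.proj)
            (C.anchor (ι x.proj) (σ (ι x.proj))) := by
      rw [← C.dR_pullback_linAnchor hι ha]
      refine DFunLike.congr_fun (dR_congr (I := J) (x := x) (Filter.Eventually.of_forall
        fun y => ?_)) (C.linVF hι ha σ x)
      exact C.dR_pullback_linAnchor hι ha f y _
    rw [h1, h1] at h
    rw [map_sub, sub_eq_zero]
    refine Eq.trans ?_ h.symm
    rw [C.dR_pullback_linAnchor hι ha]
    exact C.anchorHom σ τ f (ι x.proj)
  · obtain ⟨ψ, hψ⟩ := exists_eventuallyEq_normalDeriv hι f h0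
    have h := dR_mlieBracket (C.linVF hι ha σ) (C.linVF hι ha τ) ψ x
    have h1 (σ τ : Cₛ^∞⟮𝓘(ℝ, E); FA, A⟯) :
        dR J (lieD (C.linVF hι ha τ) ψ) x (C.linVF hι ha σ x) =
          normalDeriv hι (C.toPreCourant.act σ (C.toPreCourant.act τ f)) x := by
      refine Eq.trans ?_
        (C.dR_normalDeriv_linAnchor hι ha (C.eventually_act_eq_zero ha h0 τ) σ)
      refine DFunLike.congr_fun (dR_congr (I := J) (x := x) ?_) (C.linVF hι ha σ x)
      filter_upwards [hψ.eventually_nhds, eventually_proj hι h0.eventually_nhds] with y hy h0y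
      rw [lieD_apply, dR_congr hy]
      exact C.dR_normalDeriv_linAnchor hι ha h0y τ
    rw [h1, h1, dR_congr hψ] at h
    rw [map_sub, sub_eq_zero]
    refine Eq.trans ?_ h.symm
    rw [C.dR_normalDeriv_linAnchor hι ha h0]
    obtain ⟨s, z⟩ := x
    obtain ⟨u, rfl⟩ := mk_surjective hι s z
    rw [C.normalDeriv_act_mk hι ha h0, C.normalDeriv_act_mk hι ha
      (C.eventually_act_eq_zero ha h0 τ), C.normalDeriv_act_mk hι ha
      (C.eventually_act_eq_zero ha h0 σ), ← dR_sub (ContMDiffMap.mdiffAt _ _)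
      (ContMDiffMap.mdiffAt _ _)]
    refine congrArg (fun T => T u) (dR_congr (Filter.Eventually.of_forall fun m => ?_))
    exact C.anchorHom σ τ f m

/-- The kernel of `ν(a)` is coisotropic. It suffices to consider the covectors `d(p^* f)` and `d
f^ν`, and the derivatives of the functions `p^* g` and `g^ν`: if one of the two functions is of the
form `p^* f`, then this follows from `a (D f) = 0`; for `f^ν` and `g^ν` it is the second derivative
of `⟨D f, D g⟩ = 0` along the normal direction. -/
lemma linAnchor_coisotropic (x : NormalTotal hι) (w : A (ι x.proj))
    (ξ : TangentSpace (𝓘(ℝ, ES).prod 𝓘(ℝ, F)) x →ₗ[ℝ] ℝ)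
    (hw : ∀ u, C.metric (ι x.proj) w u = ξ (C.linAnchor hι ha x u)) :
    C.linAnchor hι ha x w = 0 := by
  let J := 𝓘(ℝ, ES).prod 𝓘(ℝ, F)
  let Q := C.toPreCourant
  let m := ι x.proj
  let b := C.linAnchor hι ha x
  have : FiniteDimensional ℝ (TangentSpace J x) := inferInstanceAs (FiniteDimensional ℝ (ES × F))
  let Φ : Set (Module.Dual ℝ (TangentSpace J x)) :=
    {ξ | (∃ f : C^∞⟮𝓘(ℝ, E), M; 𝓘(ℝ, ℝ), ℝ⟯,
        ξ = dR J (fun y : NormalTotal hι => f (ι y.proj)) x) ∨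
      ∃ f : C^∞⟮𝓘(ℝ, E), M; 𝓘(ℝ, ℝ), ℝ⟯, (∀ᶠ t in 𝓝 x.proj, f (ι t) = 0) ∧
        ξ = dR J (normalDeriv hι f) x}
  have hΦ : Submodule.span ℝ Φ = ⊤ := Module.Dual.span_eq_top_of_separating fun v hv =>
    eq_zero_of_pullback_normalDeriv hι (fun f => hv _ (Or.inl ⟨f, rfl⟩))
      fun f h0 => hv _ (Or.inr ⟨f, h0, rfl⟩)
  -- `a (D f) = 0`, so that `D f` does not act on functions
  have hDf (f g : C^∞⟮𝓘(ℝ, E), M; 𝓘(ℝ, ℝ), ℝ⟯) : normalDeriv hι (Q.act (Q.D f) g) x = 0 := by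
    have h1 : (Q.act (Q.D f) g : M → ℝ) = fun _ => 0 := funext fun y => by
      rw [Q.act_apply, PreCourant.IsCoisotropic.anchor_D C.isCoisotropic, map_zero]
    rw [h1]
    obtain ⟨s, z⟩ := x
    obtain ⟨u, rfl⟩ := mk_surjective hι s z
    rw [normalDeriv_mk hι mdifferentiableAt_const (Filter.Eventually.of_forall fun _ => rfl),
      dR_const, LinearMap.zero_apply]
  have key : ∀ ξ ∈ Submodule.span ℝ Φ, ∀ w : A m, (∀ u, C.metric m w u = ξ (b u)) → b w = 0 := by
    intro ξ hξ
    refine Submodule.span_induction (p := fun (ξ : Module.Dual ℝ (TangentSpace J x)) _ =>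
      ∀ w : A m, (∀ u, C.metric m w u = ξ (b u)) → b w = 0) ?_ ?_ ?_ ?_ hξ
    · rintro _ (⟨f, rfl⟩ | ⟨f, h0, rfl⟩) w hw
      · have hwD : w = Q.D f m := Q.metric_ext fun u => by
          rw [Q.metric_D]
          exact (hw u).trans (C.dR_pullback_linAnchor hι ha f x u)
        refine eq_zero_of_pullback_normalDeriv hι (fun g => ?_) fun g h0 => ?_
        · rw [C.dR_pullback_linAnchor hι ha, hwD,
            show C.anchor m (Q.D f m) = 0 from
              PreCourant.IsCoisotropic.anchor_D C.isCoisotropic f m, map_zero]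
        · rw [hwD]
          exact (C.dR_normalDeriv_linAnchor hι ha h0 (Q.D f)).trans (hDf f g)
      · refine eq_zero_of_pullback_normalDeriv hι (fun g => ?_) fun g h0g => ?_
        · rw [C.dR_pullback_linAnchor hι ha]
          refine (Q.metric_D g m w).symm.trans ((Q.metric_symm m _ _).trans ((hw _).trans ?_))
          exact (C.dR_normalDeriv_linAnchor hι ha h0 (Q.D g)).trans (hDf g f)
        · let wg := Q.sharp m ((dR J (normalDeriv hι g) x).comp b)
          have hwg : ∀ u, C.metric m wg u = dR J (normalDeriv hι g) x (b u) := Q.metric_sharp m _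
          rw [← hwg w]
          -- `w` and `wg` are the derivatives of `D f` and `D g` in the direction of `u`
          obtain ⟨s, z⟩ := x
          obtain ⟨u, rfl⟩ := mk_surjective hι s z
          refine C.metric_eq_zero_of_deriv (f := g) (g := f) (u := u)
            (C.dR_anchor_eq_zero ha h0g) (C.dR_anchor_eq_zero ha h0) (fun σ => ?_) fun σ => ?_
          · exact (hwg _).trans ((C.dR_normalDeriv_linAnchor hι ha h0g σ).trans
              (C.normalDeriv_act_mk hι ha h0g σ u))
          · exact (hw _).trans ((C.dR_normalDeriv_linAnchor hι ha h0 σ).trans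
              (C.normalDeriv_act_mk hι ha h0 σ u))
    · intro w hw
      rw [C.metric_nondegenerate m w hw, map_zero]
    · intro ξ η _ _ h1 h2 w hw
      let w₁ := Q.sharp m (ξ.comp b)
      have hw₁ : ∀ u, C.metric m w₁ u = ξ (b u) := Q.metric_sharp m _
      have hw₂ : ∀ u, C.metric m (w - w₁) u = η (b u) := fun u => by
        rw [map_sub, LinearMap.sub_apply, hw, hw₁, LinearMap.add_apply, add_sub_cancel_left]
      have := h2 _ hw₂
      rw [map_sub, h1 _ hw₁, sub_zero] at this
      exact this
    · intro c ξ _ h1 w hw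
      let w₁ := Q.sharp m (ξ.comp b)
      have hw₁ : ∀ u, C.metric m w₁ u = ξ (b u) := Q.metric_sharp m _
      have : w = c • w₁ := Q.metric_ext fun u => by
        refine (hw u).trans ?_
        rw [map_smul, LinearMap.smul_apply, LinearMap.smul_apply]
        exact congrArg (c • ·) (hw₁ u).symm
      rw [this, map_smul, h1 _ hw₁, smul_zero]
  exact key ξ (hΦ ▸ Submodule.mem_top) w hw

variable {C}

lemma IsRestriction.isPullbackAnchor_linAnchor {AS : CourantAlgebroid 𝓘(ℝ, ES) FA (ι *ᵖ A)}
    (h : C.IsRestriction AS) :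
    AS.IsPullbackAnchor (normalProj hι) (C.linAnchor hι ha) (pullbackSection ι '' univ) where
  hasFrames := (hasFrames_univ _ _ _).pullback
  contMDiff := by
    rintro _ ⟨σ, -, rfl⟩
    exact C.contMDiff_linAnchor hι ha σ
  lift x v := by
    refine sub_eq_zero.1 (eq_zero_of_dR_eq_zero fun φ => ?_)
    obtain ⟨f, hf⟩ := exists_extension hι φ x.proj
    have hp : MDifferentiableAt (𝓘(ℝ, ES).prod 𝓘(ℝ, F)) 𝓘(ℝ, ES) (normalProj hι) x :=
      (normalProj hι).contMDiff.mdifferentiableAt (by simp)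
    have h1 := (dR_comp (φ.mdiffAt (normalProj hι x)) hp (C.linAnchor hι ha x v)).symm
    have h2 : ∀ᶠ y in 𝓝 x, φ (normalProj hι y) = f (ι y.proj) :=
      (eventually_proj hι hf).mono fun y hy => hy.symm
    rw [dR_congr h2] at h1
    rw [map_sub, sub_eq_zero]
    refine (h1.trans (C.dR_pullback_linAnchor hι ha f x v)).trans ?_
    have h3 := dR_comp (f.mdiffAt _) (mdifferentiableAt_coe ι x.proj) (AS.anchor x.proj v)
    rw [dR_congr hf] at h3
    exact (h3.trans (congrArg (dR 𝓘(ℝ, E) f (ι x.proj)) (h.anchor_eq x.proj v))).symm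
  coisotropic x w ξ hw := C.linAnchor_coisotropic hι ha x w ξ fun u =>
    (h.metric_eq _ _ _).symm.trans (hw u)
  hom := by
    rintro _ ⟨σ, -, rfl⟩ _ ⟨τ, -, rfl⟩ φ x
    rw [h.bracket_eq]
    have h1 := C.linAnchor_bracket hι ha σ τ x
    have h2 := dR_mlieBracket (C.linVF hι ha σ) (C.linVF hι ha τ) φ x
    rw [← h1] at h2
    exact h2

include ha in
lemma IsRestriction.exists_isLinearization {AS : CourantAlgebroid 𝓘(ℝ, ES) FA (ι *ᵖ A)}
    (h : C.IsRestriction AS) :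
    ∃ N : CourantAlgebroid (𝓘(ℝ, ES).prod 𝓘(ℝ, F)) FA (normalProj hι *ᵖ (ι *ᵖ A)),
      C.IsLinearization hι AS N := by
  obtain ⟨N, h1, h2, h3⟩ := (h.isPullbackAnchor_linAnchor hι ha).exists_courantAlgebroid
  refine ⟨N, h1, fun σ => ⟨fun f x => ?_, fun f x h0 => ?_⟩, h3⟩
  · exact (congrArg _ (h2 x _)).trans (C.dR_pullback_linAnchor hι ha f x _)
  · exact (congrArg _ (h2 x _)).trans (C.dR_normalDeriv_linAnchor hι ha h0 σ)

variable {hι}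

lemma IsLinearization.isLinearAnchorAt {AS : CourantAlgebroid 𝓘(ℝ, ES) FA (ι *ᵖ A)}
    {N : CourantAlgebroid (𝓘(ℝ, ES).prod 𝓘(ℝ, F)) FA (normalProj hι *ᵖ (ι *ᵖ A))}
    (h : C.IsLinearization hι AS N) (x : NormalTotal hι) (v : A (ι x.proj)) :
    C.IsLinearAnchorAt hι x v (N.anchor x v) where
  deriv_pullback f := by
    have h1 := (h.anchor_eq (extB 𝓘(ℝ, E) FA (ι x.proj) v)).deriv_pullback f x
    rw [extB_self] at h1
    exact h1
  deriv_normalDeriv f h0 σ hσ := by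
    subst hσ
    exact (h.anchor_eq σ).deriv_normalDeriv f x h0

lemma IsLinearization.unique {AS : CourantAlgebroid 𝓘(ℝ, ES) FA (ι *ᵖ A)}
    {N N' : CourantAlgebroid (𝓘(ℝ, ES).prod 𝓘(ℝ, F)) FA (normalProj hι *ᵖ (ι *ᵖ A))}
    (h : C.IsLinearization hι AS N) (h' : C.IsLinearization hι AS N') : N' = N := by
  refine eq_of_pullback (fun x v w => ?_) (fun x v => ?_) fun σ τ => ?_
  · exact (h'.metric_eq x v w).trans (h.metric_eq x v w).symm
  · exact (h'.isLinearAnchorAt x v).unique (h.isLinearAnchorAt x v)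
  · exact (h'.bracket_eq σ τ).trans (h.bracket_eq σ τ).symm

end CourantAlgebroid

end Linearization

/-! ### Pull-backs of Dirac structures -/

section Dirac

variable {E : Type*} [NormedAddCommGroup E] [NormedSpace ℝ E] [FiniteDimensional ℝ E]
  {H : Type*} [TopologicalSpace H]
  {M : Type*} [TopologicalSpace M] [T2Space M] [ChartedSpace H M] {I : ModelWithCorners ℝ E H}
  [IsManifold I ∞ M]
  {F : Type*} [NormedAddCommGroup F] [NormedSpace ℝ F] [FiniteDimensional ℝ F]
  {A : M → Type*} [∀ m, AddCommGroup (A m)] [∀ m, Module ℝ (A m)]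
  [TopologicalSpace (TotalSpace F A)] [∀ m, TopologicalSpace (A m)] [FiberBundle F A]
  [VectorBundle ℝ F A] [ContMDiffVectorBundle ∞ F A I]
  {E' : Type*} [NormedAddCommGroup E'] [NormedSpace ℝ E'] [FiniteDimensional ℝ E']
  {H' : Type*} [TopologicalSpace H']
  {N : Type*} [TopologicalSpace N] [T2Space N] [ChartedSpace H' N] {I' : ModelWithCorners ℝ E' H'}
  [IsManifold I' ∞ N] {f : C^∞⟮I', N; I, M⟯}

namespace CourantAlgebroid

/-- Near every point a Dirac structure has a frame of globally defined sections. -/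
lemma IsDirac.exists_frame {C : CourantAlgebroid I F A} {D : ∀ m, Submodule ℝ (A m)}
    (hD : C.IsDirac D) (m : M) : ∃ (k : ℕ) (e : Fin k → Cₛ^∞⟮I; F, A⟯),
      LinearIndependent ℝ (fun i => e i m) ∧ (∀ i y, e i y ∈ D y) ∧
      ∀ᶠ y in 𝓝 m, Submodule.span ℝ (range (fun i => e i y)) = D y := by
  obtain ⟨k, e, he⟩ := hD.isSmoothSubbundle m
  obtain ⟨ρ, hρ1, hρ⟩ := exists_bump (I := I) he
  refine ⟨k, fun i => fsmul ρ (e i), ?_, fun i y => ?_, ?_⟩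
  · simp only [fsmul_apply, hρ1.self_of_nhds, one_smul]
    exact he.self_of_nhds.1
  · by_cases hy : ρ y = 0
    · rw [fsmul_apply, hy, zero_smul]
      exact zero_mem _
    · refine Submodule.smul_mem _ _ ?_
      have h : LinearIndependent ℝ (fun i => e i y) ∧ _ :=
        hρ (subset_tsupport _ (mem_support.2 hy))
      rw [← h.2]
      exact Submodule.subset_span ⟨i, rfl⟩
  · filter_upwards [he, hρ1] with y hy hy'
    simp only [fsmul_apply, hy', one_smul]
    exact hy.2

/-- The pull-back of a Dirac structure is a Dirac structure: it is spanned by pull-back sections,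
and the Leibniz rules extend the involutivity from these to all sections, the term with `D φ` in
the left Leibniz rule being absent because of isotropy. -/
lemma IsDirac.pullback {C : CourantAlgebroid I F A} {C' : CourantAlgebroid I' F (f *ᵖ A)}
    (hm : ∀ (x : N) (v w : A (f x)), C'.metric x v w = C.metric (f x) v w)
    (hb : ∀ σ τ : Cₛ^∞⟮I; F, A⟯, C'.bracket (pullbackSection f σ) (pullbackSection f τ) =
      pullbackSection f (C.bracket σ τ))
    {D : ∀ m, Submodule ℝ (A m)} (hD : C.IsDirac D) :
    C'.IsDirac (fun x => (D (f x) : Submodule ℝ (A (f x)))) where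
  isSmoothSubbundle x := by
    obtain ⟨k, e, he⟩ := hD.isSmoothSubbundle (f x)
    exact ⟨k, fun i => pullbackSection f (e i),
      f.contMDiff.continuous.continuousAt.eventually he⟩
  lagrangian x := by
    have h : C'.metric x = C.metric (f x) :=
      LinearMap.ext fun v => LinearMap.ext fun w => hm x v w
    rw [h]
    exact hD.lagrangian (f x)
  involutive s t hs ht x := by
    let Q := C'.toPreCourant
    obtain ⟨k, e, hli, heD, hspan⟩ := hD.exists_frame (f x)
    let e' (i) := pullbackSection f (e i)
    have hmem (s : Cₛ^∞⟮I'; F, f *ᵖ A⟯) (hs : ∀ y, s y ∈ D (f y)) :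
        ∀ᶠ y in 𝓝 x, s y ∈ Submodule.span ℝ (range (fun i => e' i y)) := by
      filter_upwards [f.contMDiff.continuous.continuousAt.eventually hspan] with y hy
      exact hy.symm ▸ hs y
    -- `D` is isotropic
    have hiso (v w : A (f x)) (hv : v ∈ D (f x)) (hw : w ∈ D (f x)) : C.metric (f x) v w = 0 := by
      rw [← hD.lagrangian (f x)] at hw
      exact hw v hv
    have hr (s : Cₛ^∞⟮I'; F, f *ᵖ A⟯) (hs : ∀ i, Q.bracket s (e' i) x ∈ D (f x))
        (t : Cₛ^∞⟮I'; F, f *ᵖ A⟯) (ht : ∀ y, t y ∈ D (f y)) : Q.bracket s t x ∈ D (f x) := by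
      refine (section_induction (I := I') (F := F) (B := f *ᵖ A) (x := x) (e := e')
        (P := fun t : Cₛ^∞⟮I'; F, f *ᵖ A⟯ => t x ∈ D (f x) ∧ Q.bracket s t x ∈ D (f x))
        ?_ ?_ ?_ ?_ hli
        (fun i => ⟨heD i (f x), hs i⟩) t (hmem t ht)).2
      · refine ⟨zero_mem _, ?_⟩
        rw [map_zero]
        exact zero_mem _
      · rintro t t' ⟨h1, h2⟩ ⟨h3, h4⟩
        refine ⟨add_mem h1 h3, ?_⟩
        rw [map_add]
        exact add_mem h2 h4
      · rintro φ t ⟨h1, h2⟩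
        refine ⟨Submodule.smul_mem _ _ h1, ?_⟩
        rw [Q.leibniz_right]
        exact add_mem (Submodule.smul_mem _ _ h2) (Submodule.smul_mem _ _ h1)
      · rintro ρ t hρ ⟨h1, h2⟩
        rw [Q.bracket_cut_right hρ] at h2
        rw [fsmul_apply, hρ.self_of_nhds, one_smul] at h1
        exact ⟨h1, h2⟩
    have hl (s : Cₛ^∞⟮I'; F, f *ᵖ A⟯) (hs : ∀ y, s y ∈ D (f y)) : Q.bracket s t x ∈ D (f x) := by
      refine (section_induction (I := I') (F := F) (B := f *ᵖ A) (x := x) (e := e')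
        (P := fun s : Cₛ^∞⟮I'; F, f *ᵖ A⟯ => s x ∈ D (f x) ∧ Q.bracket s t x ∈ D (f x))
        ?_ ?_ ?_ ?_ hli
        (fun i => ⟨heD i (f x), hr (e' i) (fun j => ?_) t ht⟩) s (hmem s hs)).2
      · refine ⟨zero_mem _, ?_⟩
        rw [map_zero]
        exact zero_mem _
      · rintro t t' ⟨h1, h2⟩ ⟨h3, h4⟩
        refine ⟨add_mem h1 h3, ?_⟩
        rw [map_add]
        exact add_mem h2 h4
      · rintro φ s ⟨h1, h2⟩
        refine ⟨Submodule.smul_mem _ _ h1, ?_⟩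
        rw [Q.bracket_fsmul_left]
        have h3 : Q.pair s t x = 0 := (hm x _ _).trans (hiso _ _ h1 (ht x))
        refine add_mem (sub_mem (Submodule.smul_mem _ _ h2) (Submodule.smul_mem _ _ h1)) ?_
        change Q.pair s t x • Q.D φ x ∈ D (f x)
        rw [h3, zero_smul]
        exact zero_mem _
      · rintro ρ t hρ ⟨h1, h2⟩
        rw [Q.bracket_cut_left hρ] at h2
        rw [fsmul_apply, hρ.self_of_nhds, one_smul] at h1
        exact ⟨h1, h2⟩
      · change C'.bracket (pullbackSection f (e i)) (pullbackSection f (e j)) x ∈ D (f x)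
        rw [hb]
        exact hD.involutive _ _ (heD i) (heD j) (f x)
    exact hl s hs

end CourantAlgebroid

end Dirac

/-! ### The isotropy Lie algebra at a zero of the anchor -/

namespace CourantAlgebroid

variable {E : Type*} [NormedAddCommGroup E] [NormedSpace ℝ E] [FiniteDimensional ℝ E]
  {H : Type*} [TopologicalSpace H]
  {N : Type*} [TopologicalSpace N] [T2Space N] [ChartedSpace H N] {I : ModelWithCorners ℝ E H}
  [IsManifold I ∞ N]
  {F : Type*} [NormedAddCommGroup F] [NormedSpace ℝ F] [FiniteDimensional ℝ F]
  {B : N → Type*} [∀ m, AddCommGroup (B m)] [∀ m, Module ℝ (B m)]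
  [TopologicalSpace (TotalSpace F B)] [∀ m, TopologicalSpace (B m)] [FiberBundle F B]
  [VectorBundle ℝ F B] [ContMDiffVectorBundle ∞ F B I]
  (C : CourantAlgebroid I F B) (m : N)

/-- The bracket on the fibre at `m` obtained by extending vectors to sections. (If the anchor
vanishes at `m`, then it does not depend on the choice of extensions.) -/
def isotropyBracket : B m →ₗ[ℝ] B m →ₗ[ℝ] B m :=
  LinearMap.mk₂ ℝ (fun v w => C.bracket (extB I F m v) (extB I F m w) m)
    (fun v v' w => by rw [map_add, map_add]; rfl) (fun c v w => by rw [map_smul, map_smul]; rfl)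
    (fun v w w' => by rw [map_add, map_add]; rfl) (fun c v w => by rw [map_smul, map_smul]; rfl)

variable {C m} (h0 : ∀ v, C.anchor m v = 0)

include h0

/-- All derivatives in the formula for the bracket in a trivialization are along the image of the
anchor. -/
lemma bracket_eq_isotropyBracket (σ τ : Cₛ^∞⟮I; F, B⟯) :
    C.bracket σ τ m = C.isotropyBracket m (σ m) (τ m) := by
  rw [← C.pullbackBracketAt_id m σ τ]
  refine C.toPreCourant.metric_ext fun u => ?_
  refine (C.metric_pullbackBracketAt (I' := I) (f := id) (x := m) u).trans ?_
  have h (s : ∀ y, B y) (v : B m) : nab F I id m s (C.anchor m v) = 0 := by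
    rw [h0]; exact map_zero _
  simp only [id, h]
  simp
  rfl

lemma isMetrizedLieAlgebra_isotropyBracket :
    IsMetrizedLieAlgebra (C.metric m) (C.isotropyBracket m) where
  alternating ζ := by
    have h2 : C.isotropyBracket m ζ ζ + C.isotropyBracket m ζ ζ = 0 := by
      refine C.metric_nondegenerate m _ fun w => ?_
      refine (C.bracket_symm (extB I F m ζ) (extB I F m ζ) m w).trans ?_
      rw [h0, map_zero]
    rw [← two_smul ℝ] at h2
    exact (smul_eq_zero.1 h2).resolve_left two_ne_zero
  jacobi ζ η θ := by
    have h := congrArg (fun σ : Cₛ^∞⟮I; F, B⟯ => σ m)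
      (C.jacobi (extB I F m ζ) (extB I F m η) (extB I F m θ))
    simp only [ContMDiffSection.coe_add, Pi.add_apply, bracket_eq_isotropyBracket h0,
      extB_self] at h
    exact h
  symm := C.metric_symm m
  nondegenerate := C.metric_nondegenerate m
  invariant ζ η θ := by
    have h := C.anchor_metric (extB I F m ζ) (extB I F m η) (extB I F m θ) m
    rw [h0, map_zero, bracket_eq_isotropyBracket h0, bracket_eq_isotropyBracket h0, extB_self,
      extB_self, extB_self] at h
    exact h.symm

variable [I.Boundaryless]

lemma dR_mlieBracket_anchor (σ : Cₛ^∞⟮I; F, B⟯) (Z : Cₛ^∞⟮I; E, (TangentSpace I : N → Type _)⟯)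
    (f : C^∞⟮I, N; 𝓘(ℝ, ℝ), ℝ⟯) :
    dR I f m (VectorField.mlieBracket I (fun y => C.anchor y (σ y)) Z m) =
      - dR I (C.toPreCourant.act σ f) m (Z m) := by
  refine (dR_mlieBracket (C.toPreCourant.anchorSec σ) Z f m).trans ?_
  rw [show C.toPreCourant.anchorSec σ m = 0 from h0 _, map_zero, zero_sub]
  rfl

/-- The value `[a(σ), Z]|_m`, for extensions `σ` and `Z` of the given vectors. -/
def isotropyAction (_h0 : ∀ v, C.anchor m v = 0) (ζ : B m) (u : TangentSpace I m) :
    TangentSpace I m :=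
  VectorField.mlieBracket I (fun y => C.anchor y (extB I F m ζ y))
    (extB I E (B := (TangentSpace I : N → Type _)) m u) m

lemma dR_isotropyAction (σ : Cₛ^∞⟮I; F, B⟯) (f : C^∞⟮I, N; 𝓘(ℝ, ℝ), ℝ⟯) (u : TangentSpace I m) :
    dR I f m (isotropyAction h0 (σ m) u) = - dR I (C.toPreCourant.act σ f) m u := by
  refine (dR_mlieBracket_anchor h0 (extB I F m (σ m)) _ f).trans ?_
  rw [extB_self, C.dR_act_eq_of_eq (fun v => by rw [h0, map_zero]) u (extB_self m (σ m))]

lemma dR_isotropyAction' (ζ : B m) (f : C^∞⟮I, N; 𝓘(ℝ, ℝ), ℝ⟯) (u : TangentSpace I m) :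
    dR I f m (isotropyAction h0 ζ u) = - dR I (C.toPreCourant.act (extB I F m ζ) f) m u := by
  rw [← dR_isotropyAction h0, extB_self]

/-- The representation `ϱ(σ|_m) Z|_m = [a(σ), Z]|_m` of the isotropy Lie algebra on the tangent
space. -/
def isotropyRep : B m →ₗ[ℝ] Module.End ℝ (TangentSpace I m) :=
  LinearMap.mk₂ ℝ (isotropyAction h0)
    (fun ζ η u => eq_of_dR_eq fun φ => by
      rw [map_add, dR_isotropyAction', dR_isotropyAction', dR_isotropyAction', map_add,
        PreCourant.dR_act_add]
      ring)
    (fun c ζ u => eq_of_dR_eq fun φ => by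
      let κ : C^∞⟮I, N; 𝓘(ℝ, ℝ), ℝ⟯ := ⟨fun _ => c, contMDiff_const⟩
      have h1 : dR I φ m (isotropyAction h0 (c • ζ) u) =
          - dR I (C.toPreCourant.act (fsmul κ (extB I F m ζ)) φ) m u := by
        refine Eq.trans ?_ (dR_isotropyAction h0 (fsmul κ (extB I F m ζ)) φ u)
        rw [fsmul_apply, extB_self]
        rfl
      have h2 : dR I φ m (C.toPreCourant.anchor m (extB I F m ζ m)) = 0 :=
        (congrArg _ (h0 _)).trans (map_zero _)
      rw [h1, PreCourant.dR_act_fsmul, h2, map_smul, dR_isotropyAction', smul_eq_mul, zero_mul,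
        add_zero, mul_neg]
      rfl)
    (fun ζ u w => eq_of_dR_eq fun φ => by
      rw [map_add, dR_isotropyAction', dR_isotropyAction', dR_isotropyAction', map_add]
      ring)
    (fun c ζ u => eq_of_dR_eq fun φ => by
      rw [map_smul, dR_isotropyAction', dR_isotropyAction', map_smul, smul_neg])

lemma dR_isotropyRep (σ : Cₛ^∞⟮I; F, B⟯) (f : C^∞⟮I, N; 𝓘(ℝ, ℝ), ℝ⟯) (u : TangentSpace I m) :
    dR I f m (isotropyRep h0 (σ m) u) = - dR I (C.toPreCourant.act σ f) m u :=
  dR_isotropyAction h0 σ f u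

lemma isotropyRep_eq_mlieBracket (σ : Cₛ^∞⟮I; F, B⟯)
    (Z : Cₛ^∞⟮I; E, (TangentSpace I : N → Type _)⟯) :
    isotropyRep h0 (σ m) (Z m) = VectorField.mlieBracket I (fun y => C.anchor y (σ y)) Z m :=
  eq_of_dR_eq fun φ => (dR_isotropyRep h0 σ φ (Z m)).trans (dR_mlieBracket_anchor h0 σ Z φ).symm

/-- If `ζ` is orthogonal to the stabilizer of `u`, then `⟨ζ, ·⟩ = ξ (ϱ(·) u)` for a covector `ξ`,
that is, `ζ` is the derivative of `a^* df` in the direction of `u`, for a function `f` with `df =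
-ξ` at `m`. Any two such derivatives are orthogonal, which gives `dg (ϱ(ζ) u) = 0` for all `g`. -/
lemma isCoisotropicRepresentation_isotropyRep :
    IsCoisotropicRepresentation (C.metric m) (C.isotropyBracket m) (isotropyRep h0) where
  map_bracket ζ η := by
    refine LinearMap.ext fun u => eq_of_dR_eq fun φ => ?_
    let Q := C.toPreCourant
    let σ := extB I F m ζ
    let τ := extB I F m η
    have h1 : dR I φ m (isotropyRep h0 (C.isotropyBracket m ζ η) u) =
        - dR I (Q.act (C.bracket σ τ) φ) m u := dR_isotropyRep h0 (C.bracket σ τ) φ u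
    have h2 (f : C^∞⟮I, N; 𝓘(ℝ, ℝ), ℝ⟯) (w) : dR I f m (isotropyRep h0 ζ w) =
      - dR I (Q.act σ f) m w := dR_isotropyAction' h0 ζ f w
    have h3 (f : C^∞⟮I, N; 𝓘(ℝ, ℝ), ℝ⟯) (w) : dR I f m (isotropyRep h0 η w) =
      - dR I (Q.act τ f) m w := dR_isotropyAction' h0 η f w
    have h4 : dR I (Q.act (C.bracket σ τ) φ) m u =
        dR I (Q.act σ (Q.act τ φ)) m u - dR I (Q.act τ (Q.act σ φ)) m u := by
      rw [← dR_sub (ContMDiffMap.mdiffAt _ _) (ContMDiffMap.mdiffAt _ _)]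
      exact DFunLike.congr_fun (dR_congr (I := I) (x := m)
        (Filter.Eventually.of_forall fun y => C.anchorHom σ τ φ y)) u
    rw [LinearMap.sub_apply, map_sub, Module.End.mul_apply, Module.End.mul_apply, h1, h2, h3, h3,
      h2, h4]
    ring
  coisotropic u ζ hζ := by
    let Q := C.toPreCourant
    have := finiteDimensional_fiber (F := F) (B := B) m
    let R : B m →ₗ[ℝ] TangentSpace I m := (isotropyRep h0).flip u
    -- `ζ` is the image of a covector under the dual of `R`
    have h1 : C.metric m ζ ∈ LinearMap.range R.dualMap := by
      rw [LinearMap.range_dualMap_eq_dualAnnihilator_ker, Submodule.mem_dualAnnihilator]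
      intro η hη
      rw [C.metric_symm]
      exact hζ η hη
    obtain ⟨ξ, hξ⟩ := h1
    obtain ⟨f, hf, -⟩ := exists_dR_eq m (-ξ)
    refine LinearMap.mem_ker.2 (eq_zero_of_dR_eq_zero fun g => ?_)
    let wg := Q.sharp m (-((dR I g m).comp R))
    have hwg (v : B m) : C.metric m wg v = - dR I g m (R v) := Q.metric_sharp m _ v
    have h2 (f : C^∞⟮I, N; 𝓘(ℝ, ℝ), ℝ⟯) (v : B m) : dR I f m (C.anchor m v) = 0 := by
      rw [h0, map_zero]
    have h3 : C.metric m wg ζ = 0 := by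
      refine C.metric_eq_zero_of_deriv (h2 g) (h2 f) (u := u) (fun σ => ?_) fun σ => ?_
      · rw [hwg]
        exact neg_eq_iff_eq_neg.2 (dR_isotropyRep h0 σ g u)
      · rw [← hξ]
        have h4 := dR_isotropyRep h0 σ f u
        rw [hf] at h4
        exact neg_inj.1 h4
    rw [hwg, neg_eq_zero] at h3
    exact h3

end CourantAlgebroid

/-! ### The linearization at a point -/

section Point

variable {E : Type*} [NormedAddCommGroup E] [NormedSpace ℝ E] [FiniteDimensional ℝ E]
  {M : Type*} [TopologicalSpace M] [T2Space M] [ChartedSpace E M] [IsManifold 𝓘(ℝ, E) ∞ M]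
  {ES : Type*} [NormedAddCommGroup ES] [NormedSpace ℝ ES] [FiniteDimensional ℝ ES]
  {S : Type*} [TopologicalSpace S] [T2Space S] [ChartedSpace ES S] [IsManifold 𝓘(ℝ, ES) ∞ S]
  {F : Type*} [NormedAddCommGroup F] [NormedSpace ℝ F] [FiniteDimensional ℝ F]
  {ι : C^∞⟮𝓘(ℝ, ES), S; 𝓘(ℝ, E), M⟯}
  (hι : IsImmersionOfComplement F 𝓘(ℝ, ES) 𝓘(ℝ, E) ∞ ι)
  {s₀ : S} (hS : ∀ s : S, s = s₀)

namespace NormalBundle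

section

include hS

/-- A manifold with one point has no tangent vectors, as all functions on it are constant. -/
lemma tangentRange_eq_bot : tangentRange ι s₀ = ⊥ := by
  refine LinearMap.range_eq_bot.2 (LinearMap.ext fun v => ?_)
  have hv : v = 0 := eq_zero_of_dR_eq_zero fun φ => DFunLike.congr_fun
    (dR_eq_zero_of_eventually (.of_forall fun s => congrArg φ (hS s))) v
  rw [hv, map_zero, map_zero]

lemma surjective_fromTangent : Surjective (fromTangent hι s₀) := by
  rintro ⟨s, z⟩
  obtain rfl := hS s
  obtain ⟨u, rfl⟩ := mk_surjective hι s z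
  exact ⟨u, rfl⟩

lemma normalLift_fiberCoord (u : TangentSpace 𝓘(ℝ, E) (ι s₀)) :
    normalLift hι s₀ s₀ (fiberCoord hι s₀ (fromTangent hι s₀ u)) = u := by
  have hs := (hι s₀).mem_domChart_source
  have h : normalLift hι s₀ s₀ (fiberCoord hι s₀ (fromTangent hι s₀ u)) - u ∈
      tangentRange ι s₀ := by
    rw [← ker_normalComp hι s₀ hs]
    refine LinearMap.mem_ker.2 ((map_sub (normalComp hι s₀ s₀) _ _).trans ?_)
    rw [normalComp_lift hι s₀ hs]
    exact sub_eq_zero.2 (fiberCoord_mk hι s₀ hs u)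
  rw [tangentRange_eq_bot hS] at h
  exact sub_eq_zero.1 h

end

/-- If `S = {s₀}`, then `ν(M, S)` is the tangent space of `M` at `ι s₀`. -/
def fromTangentDiffeomorph : Diffeomorph 𝓘(ℝ, E) (𝓘(ℝ, ES).prod 𝓘(ℝ, F)) E (NormalTotal hι) ∞ where
  toFun := fromTangent hι s₀
  invFun y := (normalLift hι s₀ s₀ : F →L[ℝ] E) (fiberCoord hι s₀ y)
  left_inv := normalLift_fiberCoord hι hS
  right_inv y := by
    obtain ⟨u, rfl⟩ := surjective_fromTangent hι hS y
    exact congrArg (fromTangent hι s₀) (normalLift_fiberCoord hι hS u)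
  contMDiff_toFun := contMDiff_fromTangent hι s₀
  contMDiff_invFun y := by
    have h := contMDiffAt_fiberCoord hι s₀ (y := y)
      ((hS y.proj).symm ▸ (hι s₀).mem_domChart_source)
    let Λ : F →L[ℝ] E := normalLift hι s₀ s₀
    exact Λ.contDiff.contMDiff.contMDiffAt.comp y h

end NormalBundle

open NormalBundle

variable {FA : Type*} [NormedAddCommGroup FA] [NormedSpace ℝ FA] [FiniteDimensional ℝ FA]
  {A : M → Type*} [∀ m, AddCommGroup (A m)] [∀ m, Module ℝ (A m)]
  [TopologicalSpace (TotalSpace FA A)] [∀ m, TopologicalSpace (A m)] [FiberBundle FA A]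
  [VectorBundle ℝ FA A] [ContMDiffVectorBundle ∞ FA A 𝓘(ℝ, E)]
  {C : CourantAlgebroid 𝓘(ℝ, E) FA A}
  (ha : ∀ (s : S) (v : A (ι s)), C.anchor (ι s) v ∈ NormalBundle.tangentRange ι s)
  {AS : CourantAlgebroid 𝓘(ℝ, ES) FA (ι *ᵖ A)}
  {N : CourantAlgebroid (𝓘(ℝ, ES).prod 𝓘(ℝ, F)) FA (normalProj hι *ᵖ (ι *ᵖ A))}

namespace CourantAlgebroid

include ha hS in
lemma anchor_eq_zero_of_point (v : A (ι s₀)) : C.anchor (ι s₀) v = 0 := by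
  have h := ha s₀ v
  rw [tangentRange_eq_bot hS] at h
  exact h

variable {hι}

include ha in
/-- The linearized anchor at a zero of the anchor is the action of the isotropy Lie algebra, up to
sign. -/
lemma IsLinearization.anchor_fromTangent (h : C.IsLinearization hι AS N)
    (h0 : ∀ v, C.anchor (ι s₀) v = 0) (u : E) (ζ : A (ι s₀)) :
    N.anchor (fromTangent hι s₀ u) ζ =
      mfderiv 𝓘(ℝ, E) (𝓘(ℝ, ES).prod 𝓘(ℝ, F)) (fromTangent hι s₀) u (-(isotropyRep h0 ζ u)) := by
  refine (h.isLinearAnchorAt (fromTangent hι s₀ u) ζ).unique ⟨fun f => ?_, fun f hf σ hσ => ?_⟩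
  · refine (dR_pullback_fromTangent hι f s₀ u _).trans ?_
    exact ((congrArg _ (h0 ζ)).trans (map_zero _)).symm
  · change σ (ι s₀) = ζ at hσ
    subst hσ
    refine (dR_normalDeriv_fromTangent hι f hf u _).trans ?_
    refine Eq.trans ?_ (C.normalDeriv_act_mk hι ha hf σ u).symm
    refine (map_neg (dR 𝓘(ℝ, E) f (ι s₀)) _).trans ?_
    rw [dR_isotropyRep h0 σ f u, neg_neg]
    rfl

include hS in
lemma IsLinearization.bracket_fromTangent (h : C.IsLinearization hι AS N) (hr : C.IsRestriction AS)
    {c₁ c₂ : Cₛ^∞⟮𝓘(ℝ, ES).prod 𝓘(ℝ, F); FA, normalProj hι *ᵖ (ι *ᵖ A)⟯} {ζ₁ ζ₂ : A (ι s₀)}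
    (h₁ : ∀ u : E, c₁ (fromTangent hι s₀ u) = ζ₁) (h₂ : ∀ u : E, c₂ (fromTangent hι s₀ u) = ζ₂)
    (u : E) : N.bracket c₁ c₂ (fromTangent hι s₀ u) = C.isotropyBracket (ι s₀) ζ₁ ζ₂ := by
  have key {c : Cₛ^∞⟮𝓘(ℝ, ES).prod 𝓘(ℝ, F); FA, normalProj hι *ᵖ (ι *ᵖ A)⟯} {ζ : A (ι s₀)}
      (hc : ∀ u : E, c (fromTangent hι s₀ u) = ζ) : c = pullbackSection (normalProj hι)
        (pullbackSection ι (extB 𝓘(ℝ, E) FA (ι s₀) ζ)) := by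
    refine ContMDiffSection.ext fun y => ?_
    obtain ⟨u, rfl⟩ := surjective_fromTangent hι hS y
    exact (hc u).trans (extB_self (ι s₀) ζ).symm
  rw [key h₁, key h₂, h.bracket_eq, hr.bracket_eq]
  rfl

end CourantAlgebroid

end Point

end

theorem proposition5
    -- the manifold `M`
    {E : Type*} [NormedAddCommGroup E] [NormedSpace ℝ E] [FiniteDimensional ℝ E]
    {M : Type*} [TopologicalSpace M] [T2Space M] [SecondCountableTopology M]
    [ChartedSpace E M] [IsManifold 𝓘(ℝ, E) ∞ M]
    -- the submanifold `ι : S → M`, with normal bundle of fibre type `F`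
    {ES : Type*} [NormedAddCommGroup ES] [NormedSpace ℝ ES] [FiniteDimensional ℝ ES]
    {S : Type*} [TopologicalSpace S] [T2Space S] [SecondCountableTopology S]
    [ChartedSpace ES S] [IsManifold 𝓘(ℝ, ES) ∞ S]
    {F : Type*} [NormedAddCommGroup F] [NormedSpace ℝ F] [FiniteDimensional ℝ F]
    (ι : C^∞⟮𝓘(ℝ, ES), S; 𝓘(ℝ, E), M⟯)
    (hι : IsImmersionOfComplement F 𝓘(ℝ, ES) 𝓘(ℝ, E) ∞ ι)
    -- the Courant algebroid `A → M`
    {FA : Type*} [NormedAddCommGroup FA] [NormedSpace ℝ FA] [FiniteDimensional ℝ FA]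
    {A : M → Type*} [∀ m, AddCommGroup (A m)] [∀ m, Module ℝ (A m)]
    [TopologicalSpace (TotalSpace FA A)] [∀ m, TopologicalSpace (A m)] [FiberBundle FA A]
    [VectorBundle ℝ FA A] [ContMDiffVectorBundle ∞ FA A 𝓘(ℝ, E)]
    (C : CourantAlgebroid 𝓘(ℝ, E) FA A)
    -- `a(A|_S) ⊂ TS`
    (ha : ∀ (s : S) (v : A (ι s)), C.anchor (ι s) v ∈ NormalBundle.tangentRange ι s) :
    -- the Courant algebroid `A|_S`
    ∃ AS : CourantAlgebroid 𝓘(ℝ, ES) FA (ι *ᵖ A),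
      C.IsRestriction AS ∧
      (∀ AS' : CourantAlgebroid 𝓘(ℝ, ES) FA (ι *ᵖ A), C.IsRestriction AS' → AS' = AS) ∧
      -- the Courant algebroid `ν(A, A|_S)`
      ∃ N : CourantAlgebroid (𝓘(ℝ, ES).prod 𝓘(ℝ, F)) FA (normalProj hι *ᵖ (ι *ᵖ A)),
        C.IsLinearization hι AS N ∧
        (∀ N' : CourantAlgebroid (𝓘(ℝ, ES).prod 𝓘(ℝ, F)) FA (normalProj hι *ᵖ (ι *ᵖ A)),
          C.IsLinearization hι AS N' → N' = N) ∧
        -- Dirac structures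
        (∀ D : ∀ m, Submodule ℝ (A m), C.IsDirac D →
          N.IsDirac (fun x : NormalTotal hι => D (ι x.proj))) ∧
        -- the case `S = {m}`, `m = ι s₀` (where `a(A|_S) ⊂ TS` means that `m` is a critical point)
        (∀ s₀ : S, (∀ s : S, s = s₀) →
          ∃ (β : A (ι s₀) →ₗ[ℝ] A (ι s₀) →ₗ[ℝ] A (ι s₀))
            (ϱ : A (ι s₀) →ₗ[ℝ] Module.End ℝ (TangentSpace 𝓘(ℝ, E) (ι s₀))),
            (∀ σ τ : Cₛ^∞⟮𝓘(ℝ, E); FA, A⟯,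
              C.bracket σ τ (ι s₀) = β (σ (ι s₀)) (τ (ι s₀))) ∧
            IsMetrizedLieAlgebra (C.metric (ι s₀)) β ∧
            (∀ (σ : Cₛ^∞⟮𝓘(ℝ, E); FA, A⟯)
              (Z : Cₛ^∞⟮𝓘(ℝ, E); E, (TangentSpace 𝓘(ℝ, E) : M → Type _)⟯),
              ϱ (σ (ι s₀)) (Z (ι s₀)) =
                VectorField.mlieBracket 𝓘(ℝ, E) (fun m => C.anchor m (σ m)) Z (ι s₀)) ∧
            IsCoisotropicRepresentation (C.metric (ι s₀)) β ϱ ∧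
            -- `ν(A, A|_S)` is the action Courant algebroid `T_m M × A_m`
            (∃ Φ : Diffeomorph 𝓘(ℝ, E) (𝓘(ℝ, ES).prod 𝓘(ℝ, F)) E (NormalTotal hι) ∞,
              ∀ u, Φ u = fromTangent hι s₀ u) ∧
            (∀ (u : E) (ζ η : A (ι s₀)),
              N.metric (fromTangent hι s₀ u) ζ η = C.metric (ι s₀) ζ η) ∧
            (∀ (u : E) (ζ : A (ι s₀)),
              N.anchor (fromTangent hι s₀ u) ζ =
                mfderiv 𝓘(ℝ, E) (𝓘(ℝ, ES).prod 𝓘(ℝ, F)) (fromTangent hι s₀) u (-(ϱ ζ u))) ∧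
            (∀ (c₁ c₂ : Cₛ^∞⟮𝓘(ℝ, ES).prod 𝓘(ℝ, F); FA, normalProj hι *ᵖ (ι *ᵖ A)⟯)
              (ζ₁ ζ₂ : A (ι s₀)),
              (∀ u : E, c₁ (fromTangent hι s₀ u) = ζ₁) →
              (∀ u : E, c₂ (fromTangent hι s₀ u) = ζ₂) →
              ∀ u : E, N.bracket c₁ c₂ (fromTangent hι s₀ u) = β ζ₁ ζ₂)) := by
  obtain ⟨AS, hAS⟩ := C.exists_isRestriction hι ha
  obtain ⟨N, hN⟩ := hAS.exists_isLinearization hι ha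
  refine ⟨AS, hAS, fun AS' h => hAS.unique hι h, N, hN, fun N' h => hN.unique h,
    fun D hD => ?_, fun s₀ hS => ?_⟩
  · have hDS : AS.IsDirac (fun s => (D (ι s) : Submodule ℝ (A (ι s)))) :=
      hD.pullback hAS.metric_eq hAS.bracket_eq
    exact hDS.pullback hN.metric_eq hN.bracket_eq
  · have h0 := CourantAlgebroid.anchor_eq_zero_of_point hS ha
    exact ⟨C.isotropyBracket (ι s₀), CourantAlgebroid.isotropyRep h0,
      CourantAlgebroid.bracket_eq_isotropyBracket h0,
      CourantAlgebroid.isMetrizedLieAlgebra_isotropyBracket h0,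
      CourantAlgebroid.isotropyRep_eq_mlieBracket h0,
      CourantAlgebroid.isCoisotropicRepresentation_isotropyRep h0,
      ⟨NormalBundle.fromTangentDiffeomorph hι hS, fun _ => rfl⟩,
      fun u ζ η => (hN.metric_eq (fromTangent hι s₀ u) ζ η).trans (hAS.metric_eq s₀ ζ η),
      hN.anchor_fromTangent ha h0,
      fun _ _ _ _ h₁ h₂ => hN.bracket_fromTangent hS hAS h₁ h₂⟩
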